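/- \textbf{Proposition (Pinwheel).} \emph{Graphs.} For a simple graph in which every vertex has finitely many neighbours, a solution to the 1-2-3 problem is a labelling $l$ of the edges by $\{1,2,3\}$ such that $s_l(u)\neq s_l(v)$ for all adjacent $u,v$, where $s_l(u)=\sum_{uv\in E}l(uv)$. The graph of a tiling by triangles has the corners of the tiles as its vertices; two vertices are adjacent if the line segment joining them lies in the union of the boundaries of the tiles and contains no further vertex. \emph{Pinwheel tilings.} A pinwheel triangle of size $s>0$ is a right triangle with right angle at $A$ and legs $|AB|=s$, $|AC|=2s$ (of either orientation). In the affine coordinates with $A=(0,0)$, $B=(5,0)$, $C=(0,10)$ it is dissected into the five pinwheel triangles (right-angled corner, end of short leg, end of long leg) $$(2,6),(0,5),(0,10);\quad (4,2),(5,0),(0,0);\quad (2,1),(0,0),(0,5);\quad (2,1),(4,2),(0,5);\quad (2,6),(0,5),(4,2).$$ A pinwheel tiling is a tiling of the plane by pinwheel triangles of size $1$ such that every finite set of its tiles is contained, for some $n\ge 0$, in the $n$-fold dissection of some pinwheel triangle of size $\sqrt5^{\,n}$. \emph{Supertiles.} A supertile is a union of two dissected pinwheel triangles of size $\sqrt5$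 with a common hypotenuse, with six coloured external vertices. In coordinates in units of $1/\sqrt5$, and up to rotations and translations, there are four kinds. \begin{itemize} \item Rectangle: halves $ABC=(0,0),(5,0),(0,10)$ and $(5,10),(0,10),(5,0)$; blue vertices $(0,0),(0,10),(5,5)$; red vertices $(5,0),(5,10),(0,5)$; weights $1$ on the edges $(1,8)(2,6)$, $(1,8)(3,9)$, $(2,1)(4,2)$, weight $2$ on $(2,6)(3,4)$, weight $3$ on $(3,4)(4,2)$. \item Mirror rectangle: the image of the rectangle, with its colours and weights, under $(x,y)\mapsto(-x,y)$. \item Blue kite: halves $(0,0),(5,0),(0,10)$ and $(8,4),(5,0),(0,10)$; blue vertices $(0,0),(0,10),(8,4)$; red vertices $(5,0),(0,5),(4,7)$; weight $1$ on the edges $(2,6)(4,2)$, $(2,1)(4,2)$, $(4,2)(6,3)$. \item Red kite: the blue kite with the two colours exchanged. \end{itemize} A coloured partition of a tiling $T$ is a set $D$ of such supertiles, all of whose tiles belong to $T$, such that every tile of $T$ belongs to exactly one supertile in $D$, and such that an external vertex of one supertile in $D$ that lies on another supertile in $D$ is an external vertex of the latter too, of the same colour. \emph{Weights.} An edge is external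 to a supertile if it lies on the boundary of the supertile, and internal to it if it lies in the supertile but not on its boundary. The weighting rules for $D$ are: edges external to a supertile in $D$ have weight $3$; edges internal to a supertile in $D$ and incident to one of its red (respectively blue) vertices have weight $1$ (respectively $2$); the remaining internal edges have the weights listed above. \emph{Claim.} Every pinwheel tiling $T$ has a coloured partition. For every coloured partition of $T$ there is exactly one edge weighting of the graph of $T$ that follows the weighting rules. For this weighting, every red vertex has sum at most $16$, every blue vertex has sum at least $18$, every vertex of the graph has finitely many neighbours, and the weighting is a solution to the 1-2-3 problem. -/

import Mathlib

/-! The plane is `ℂ`, with its Euclidean distance. -/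

/-! ## Edge labellings of graphs -/

/-- A `k`-edge labelling: every edge gets a label in `{1, …, k}`. -/
def IsEdgeLabelling {V : Type*} {G : SimpleGraph V} (k : ℕ) (l : G.edgeSet → ℕ) : Prop :=
  ∀ e, 1 ≤ l e ∧ l e ≤ k

/-- The weighted degree of `u`: the sum of the labels of the edges incident to `u`
(a finite sum when `u` has finitely many neighbours). -/
noncomputable def weightedDegree {V : Type*} {G : SimpleGraph V} (l : G.edgeSet → ℕ) (u : V) : ℕ :=
  ∑ᶠ (e : G.edgeSet) (_ : u ∈ (e : Sym2 V)), l e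

/-- Adjacent vertices have different weighted degrees. -/
def IsVertexColouring {V : Type*} {G : SimpleGraph V} (l : G.edgeSet → ℕ) : Prop :=
  ∀ u v : V, G.Adj u v → weightedDegree l u ≠ weightedDegree l v

/-- A solution to the 1-2-3 problem: a 3-edge labelling that is a vertex colouring, on a graph
all of whose vertices have finitely many neighbours. -/
def IsOneTwoThreeSolution {V : Type*} {G : SimpleGraph V} (l : G.edgeSet → ℕ) : Prop :=
  (∀ v, (G.neighborSet v).Finite) ∧ IsEdgeLabelling 3 l ∧ IsVertexColouring l

namespace Pinwheel

/-! ## Triangles, tilings and their graphs -/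

/-- A triangle with named corners. For the triangles used below, `a` is the corner with the right
angle, `b` the other end of the short leg and `c` the other end of the long leg. -/
@[ext] structure Triangle where
  a : ℂ
  b : ℂ
  c : ℂ

namespace Triangle

/-- The set of the three corners. -/
def corners (t : Triangle) : Set ℂ := {t.a, t.b, t.c}

/-- The closed triangle as a subset of the plane. -/
def region (t : Triangle) : Set ℂ := convexHull ℝ t.corners

/-- The image of a triangle under a map of the plane, corner by corner. -/
def map (f : ℂ → ℂ) (t : Triangle) : Triangle := ⟨f t.a, f t.b, f t.c⟩

/-- Side lengths `s`, `2 * s` and `√5 * s` (so there is a right angle at `a`); either orientation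
is allowed. -/
def IsPinwheel (s : ℝ) (t : Triangle) : Prop :=
  dist t.a t.b = s ∧ dist t.a t.c = 2 * s ∧ dist t.b t.c = √5 * s

/-- The point with coordinates `(i, j)` in the frame of `t` in which the corners `a`, `b`, `c`
have the coordinates `(0, 0)`, `(5, 0)`, `(0, 10)`. -/
noncomputable def frame (t : Triangle) (i j : ℝ) : ℂ :=
  t.a + (i / 5 : ℝ) • (t.b - t.a) + (j / 10 : ℝ) • (t.c - t.a)

/-- The pinwheel dissection of a triangle into five triangles, smaller by the factor `√5`. -/
noncomputable def dissect (t : Triangle) : Set Triangle :=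
  { ⟨t.frame 2 6, t.frame 0 5, t.frame 0 10⟩,
    ⟨t.frame 4 2, t.frame 5 0, t.frame 0 0⟩,
    ⟨t.frame 2 1, t.frame 0 0, t.frame 0 5⟩,
    ⟨t.frame 2 1, t.frame 4 2, t.frame 0 5⟩,
    ⟨t.frame 2 6, t.frame 0 5, t.frame 4 2⟩ }

/-- The dissection carried out `n` times. -/
noncomputable def dissectIter : ℕ → Triangle → Set Triangle
  | 0, t => {t}
  | n + 1, t => ⋃ t' ∈ t.dissect, dissectIter n t'

end Triangle

/-- The triangles of `T` tile the plane: they cover it and have disjoint interiors. -/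
structure IsTriangleTiling (T : Set Triangle) : Prop where
  cover : ⋃ t ∈ T, t.region = Set.univ
  disjoint : ∀ t ∈ T, ∀ t' ∈ T, t ≠ t' → Disjoint (interior t.region) (interior t'.region)

/-- The pinwheel tilings: the tilings of the plane by right triangles with legs `1` and `2` each
finite part of which is contained in an inflated tile (legs `√5 ^ n` and `2 * √5 ^ n`, in any
position) that has been dissected `n` times. -/
structure IsPinwheelTiling (T : Set Triangle) : Prop where
  isTiling : IsTriangleTiling T
  isTile : ∀ t ∈ T, t.IsPinwheel 1
  legal : ∀ F : Set Triangle, F.Finite → F ⊆ T →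
    ∃ (n : ℕ) (t : Triangle), t.IsPinwheel (√5 ^ n) ∧ F ⊆ t.dissectIter n

/-- The vertices of a tiling: the corners of its tiles. -/
def vertices (T : Set Triangle) : Set ℂ := ⋃ t ∈ T, t.corners

/-- The graph of a tiling: two vertices are adjacent if the line segment between them lies in the
union of the boundaries of the tiles and has no further vertex on it. -/
def graph (T : Set Triangle) : SimpleGraph (vertices T) where
  Adj p q := p ≠ q ∧ segment ℝ (p : ℂ) q ⊆ ⋃ t ∈ T, frontier t.region ∧
    ∀ x ∈ vertices T, x ∉ openSegment ℝ (p : ℂ) q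
  symm := ⟨fun p q h => ⟨h.1.symm, by rw [segment_symm]; exact h.2.1,
    by intro x hx; rw [openSegment_symm]; exact h.2.2 x hx⟩⟩
  loopless := ⟨fun _ h => h.1 rfl⟩

/-! ## The four supertiles -/

/-- The four coloured supertiles: a rectangle, its mirror image, and one kite with two
colourings. -/
inductive Kind
  | rectangle
  | mirrorRectangle
  | kiteBlue
  | kiteRed

/-- The point `(i / √5, j / √5)`. -/
noncomputable def pt (i j : ℝ) : ℂ := ⟨i / √5, j / √5⟩

namespace Kind

/-- The tiles of a supertile in standard position. Each supertile consists of two dissected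
triangles with legs `√5` and `2 * √5` that share their hypotenuse. -/
noncomputable def tiles : Kind → Set Triangle
  | rectangle =>
      Triangle.dissect ⟨pt 0 0, pt 5 0, pt 0 10⟩ ∪ Triangle.dissect ⟨pt 5 10, pt 0 10, pt 5 0⟩
  | mirrorRectangle =>
      Triangle.dissect ⟨pt 0 0, pt (-5) 0, pt 0 10⟩ ∪
        Triangle.dissect ⟨pt (-5) 10, pt 0 10, pt (-5) 0⟩
  | kiteBlue | kiteRed =>
      Triangle.dissect ⟨pt 0 0, pt 5 0, pt 0 10⟩ ∪ Triangle.dissect ⟨pt 8 4, pt 5 0, pt 0 10⟩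

/-- The blue external vertices in standard position. -/
noncomputable def blue : Kind → Set ℂ
  | rectangle => {pt 0 0, pt 0 10, pt 5 5}
  | mirrorRectangle => {pt 0 0, pt 0 10, pt (-5) 5}
  | kiteBlue => {pt 0 0, pt 0 10, pt 8 4}
  | kiteRed => {pt 5 0, pt 0 5, pt 4 7}

/-- The red external vertices in standard position. -/
noncomputable def red : Kind → Set ℂ
  | rectangle => {pt 5 0, pt 5 10, pt 0 5}
  | mirrorRectangle => {pt (-5) 0, pt (-5) 10, pt 0 5}
  | kiteBlue => {pt 5 0, pt 0 5, pt 4 7}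
  | kiteRed => {pt 0 0, pt 0 10, pt 8 4}

/-- The weights of the edges between two internal vertices, in standard position: `(p, q, w)`
means that the edge from `p` to `q` has weight `w`. -/
noncomputable def inner : Kind → Set (ℂ × ℂ × ℕ)
  | rectangle =>
      { (pt 1 8, pt 2 6, 1), (pt 2 6, pt 3 4, 2), (pt 3 4, pt 4 2, 3),
        (pt 1 8, pt 3 9, 1), (pt 2 1, pt 4 2, 1) }
  | mirrorRectangle =>
      { (pt (-1) 8, pt (-2) 6, 1), (pt (-2) 6, pt (-3) 4, 2), (pt (-3) 4, pt (-4) 2, 3),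
        (pt (-1) 8, pt (-3) 9, 1), (pt (-2) 1, pt (-4) 2, 1) }
  | kiteBlue | kiteRed =>
      { (pt 2 6, pt 4 2, 1), (pt 2 1, pt 4 2, 1), (pt 4 2, pt 6 3, 1) }

end Kind

/-- A supertile in the plane: one of the four kinds, rotated by `u` and then translated by `b`. -/
structure Supertile where
  kind : Kind
  u : Circle
  b : ℂ

namespace Supertile

/-- The rigid motion that carries the standard position to the supertile. -/
noncomputable def place (S : Supertile) (z : ℂ) : ℂ := S.u * z + S.b

/-- The ten tiles of a supertile. -/
def tiles (S : Supertile) : Set Triangle := Triangle.map S.place '' S.kind.tiles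

/-- The part of the plane that the supertile covers. -/
def region (S : Supertile) : Set ℂ := ⋃ t ∈ S.tiles, t.region

/-- The blue external vertices. -/
def blue (S : Supertile) : Set ℂ := S.place '' S.kind.blue

/-- The red external vertices. -/
def red (S : Supertile) : Set ℂ := S.place '' S.kind.red

/-- The segment from `p` to `q` runs along the boundary of the supertile. -/
def IsExternal (S : Supertile) (p q : ℂ) : Prop := segment ℝ p q ⊆ frontier S.region

/-- The segment from `p` to `q` runs through the inside of the supertile. -/
def IsInternal (S : Supertile) (p q : ℂ) : Prop :=
  segment ℝ p q ⊆ S.region ∧ ¬ S.IsExternal p q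

end Supertile

/-- `D` is a partition of the tiling `T` into coloured supertiles that fit together: where an
external vertex of one of them lies on another one, it is an external vertex of the same colour
there. -/
structure IsColouredPartition (T : Set Triangle) (D : Set Supertile) : Prop where
  subset : ∀ S ∈ D, S.tiles ⊆ T
  existsUnique : ∀ t ∈ T, ∃! S : Supertile, S ∈ D ∧ t ∈ S.tiles
  blue_fits : ∀ S ∈ D, ∀ S' ∈ D, ∀ p ∈ S.blue, p ∈ S'.region → p ∈ S'.blue
  red_fits : ∀ S ∈ D, ∀ S' ∈ D, ∀ p ∈ S.red, p ∈ S'.region → p ∈ S'.red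

/-- The weighting rules: external edges of supertiles get weight 3, internal edges at a red
external vertex weight 1, internal edges at a blue external vertex weight 2, and the edges between
two internal vertices the weights listed in `Kind.inner`. -/
structure FollowsRules (T : Set Triangle) (D : Set Supertile)
    (l : (graph T).edgeSet → ℕ) : Prop where
  external : ∀ S ∈ D, ∀ (p q : vertices T) (h : (graph T).Adj p q),
    S.IsExternal p q → l ⟨s(p, q), h⟩ = 3
  red : ∀ S ∈ D, ∀ (p q : vertices T) (h : (graph T).Adj p q),
    S.IsInternal p q → (p : ℂ) ∈ S.red → l ⟨s(p, q), h⟩ = 1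
  blue : ∀ S ∈ D, ∀ (p q : vertices T) (h : (graph T).Adj p q),
    S.IsInternal p q → (p : ℂ) ∈ S.blue → l ⟨s(p, q), h⟩ = 2
  inner : ∀ S ∈ D, ∀ x ∈ S.kind.inner, ∃ (p q : vertices T) (h : (graph T).Adj p q),
    (p : ℂ) = S.place x.1 ∧ (q : ℂ) = S.place x.2.1 ∧ l ⟨s(p, q), h⟩ = x.2.2

end Pinwheel

/-! Existence of a coloured partition comes from undoing one dissection. Finite parts of `T` sit in
(n+1)-fold dissections of large triangles. Along an ultrafilter on the finite sets of tiles, the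
n-fold dissections converge to a set of "parents" of size `√5` whose dissections make up `T`
(`exists_isParentTiling`). A tile has only five candidate parents, so the ultrafilter selects one.
If the midpoint of the long leg counts as a vertex, iterated dissections are edge-to-edge, with
hypotenuses meeting hypotenuses (`exists_side_eq`). This survives the limit, so parents pair off
along hypotenuses, and each pair is a rectangle or a kite (`std_mate_cases`).

The colours are residues modulo 1 + i in ℤ[i, 1/5]. Measured from the right angle in units of the
short leg, the boundary vertices of a triangle are 0, 1, ±2i, ±i, with alternating residues in
cyclic order. Passing to a child is an affine change of coordinate whose factor is a unit of residue
1 (`sameCol_child`). Hence all parents share the same two colour classes, and the colours of the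
supertiles fit.

For the weights, every supertile is described by integer coordinates, so its combinatorics are
decidable. Because external vertices fit, a vertex of the graph lying on a supertile is one of the
listed vertices of that supertile (`exists_pos_eq`). With external edges directed anticlockwise and
internal edges taken in both directions, each directed edge of the graph belongs to exactly one
supertile (`exists_mem_out`, `out_eq`). So the rules prescribe one weight per edge without conflict,
and the sum at a vertex splits into contributions `outSum` of the supertiles around it
(`weightedDegree_eq`).

An internal vertex has sum at most 9, and neighbouring internal vertices differ by a finite check.
At an external vertex the angles are right, straight, obtuse or acute, the acute one having cosine
3/5, which is not a rational multiple of π. Hence obtuse and acute angles occur equally often, and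
their numbers satisfy a + 2b + 2c = 4 (`exists_angle_count`). A straight angle contributes 6 to a
red and 9 to a blue vertex, any other angle 4 and 5. Red sums are therefore 16 - 2b, between 12 and
16, and blue sums are 20 - b, at least 18. Colours alternate around a supertile, so the gaps 9 < 12
and 16 < 18 separate all remaining adjacent vertices. -/

namespace Pinwheel

open Complex Set

/-! ## Segments in the plane -/

theorem mem_segment_iff_exists {x y z : ℂ} :
    z ∈ segment ℝ x y ↔ ∃ s : ℝ, 0 ≤ s ∧ s ≤ 1 ∧ z = x + s * (y - x) := by
  rw [segment_eq_image']
  constructor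
  · rintro ⟨s, ⟨h0, h1⟩, rfl⟩
    exact ⟨s, h0, h1, by simp⟩
  · rintro ⟨s, h0, h1, rfl⟩
    exact ⟨s, ⟨h0, h1⟩, by simp⟩

theorem mem_openSegment_iff_exists {x y z : ℂ} :
    z ∈ openSegment ℝ x y ↔ ∃ s : ℝ, 0 < s ∧ s < 1 ∧ z = x + s * (y - x) := by
  rw [openSegment_eq_image']
  constructor
  · rintro ⟨s, ⟨h0, h1⟩, rfl⟩
    exact ⟨s, h0, h1, by simp⟩
  · rintro ⟨s, h0, h1, rfl⟩
    exact ⟨s, ⟨h0, h1⟩, by simp⟩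

theorem infinite_openSegment {p q : ℂ} (hpq : p ≠ q) : (openSegment ℝ p q).Infinite := by
  rw [openSegment_eq_image']
  refine (Ioo_infinite (zero_lt_one' ℝ)).image ?_
  intro s _ r _ h
  have h' : ((s : ℂ) - r) * (q - p) = 0 := by
    simp only [real_smul] at h
    linear_combination h
  rcases mul_eq_zero.1 h' with h' | h'
  · exact_mod_cast sub_eq_zero.1 h'
  · exact absurd (sub_eq_zero.1 h').symm hpq

/-- A segment sharing two points with the relative interior of another segment, and with no
endpoint there, contains the latter. -/
theorem segment_subset_of_two_points {p q x y m n : ℂ} (hpq : p ≠ q) (hmn : m ≠ n)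
    (hm : m ∈ openSegment ℝ p q) (hn : n ∈ openSegment ℝ p q)
    (hm' : m ∈ segment ℝ x y) (hn' : n ∈ segment ℝ x y)
    (hx : x ∉ openSegment ℝ p q) (hy : y ∉ openSegment ℝ p q) :
    segment ℝ p q ⊆ segment ℝ x y := by
  obtain ⟨s, hs0, hs1, rfl⟩ := mem_openSegment_iff_exists.1 hm
  obtain ⟨s', hs0', hs1', rfl⟩ := mem_openSegment_iff_exists.1 hn
  obtain ⟨r, hr0, hr1, hr⟩ := mem_segment_iff_exists.1 hm'
  obtain ⟨r', hr0', hr1', hr'⟩ := mem_segment_iff_exists.1 hn'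
  have hss : s ≠ s' := by rintro rfl; exact hmn rfl
  have hqp : q - p ≠ 0 := sub_ne_zero.2 hpq.symm
  have hrr : r ≠ r' := by
    rintro rfl
    exact hmn (hr.trans hr'.symm)
  have hrr' : ((r : ℂ) - r') ≠ 0 := by
    rw [sub_ne_zero]; exact_mod_cast hrr
  set κ : ℝ := (s - s') / (r - r') with hκ
  have hκ0 : κ ≠ 0 := div_ne_zero (sub_ne_zero.2 hss) (sub_ne_zero.2 hrr)
  have hyx : y - x = κ * (q - p) := by
    rw [hκ]
    push_cast
    field_simp
    linear_combination hr' - hr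
  set α : ℝ := s - r * κ with hα
  have hxα : x = p + α * (q - p) := by
    rw [hα]
    push_cast
    linear_combination (-1 : ℂ) * hr - (r : ℂ) * hyx
  have hyβ : y = p + ((α + κ : ℝ) : ℂ) * (q - p) := by
    push_cast
    linear_combination hxα + hyx
  have hα' : α ≤ 0 ∨ 1 ≤ α := by
    by_contra! h
    exact hx (mem_openSegment_iff_exists.2 ⟨α, h.1, h.2, hxα⟩)
  have hβ' : α + κ ≤ 0 ∨ 1 ≤ α + κ := by
    by_contra! h
    exact hy (mem_openSegment_iff_exists.2 ⟨α + κ, h.1, h.2, hyβ⟩)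
  have hsα : s = (1 - r) * α + r * (α + κ) := by rw [hα]; ring
  intro z hz
  obtain ⟨θ, hθ0, hθ1, rfl⟩ := mem_segment_iff_exists.1 hz
  refine mem_segment_iff_exists.2 ⟨(θ - α) / κ, ?_, ?_, ?_⟩
  · rcases hα' with h | h <;> rcases hβ' with h' | h'
    · nlinarith
    · exact div_nonneg (by linarith) (by linarith)
    · exact div_nonneg_of_nonpos (by linarith) (by linarith)
    · nlinarith
  · rcases hα' with h | h <;> rcases hβ' with h' | h'
    · nlinarith
    · rw [div_le_one (by linarith)]; linarith
    · rw [div_le_one_of_neg (by linarith)]; linarith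
    · nlinarith
  · have : (κ : ℂ) ≠ 0 := by exact_mod_cast hκ0
    rw [hyx, hxα]
    push_cast
    field_simp
    ring

/-- An infinite set covered by finitely many pieces meets one of them in infinitely many points,
hence in two, and two points fix the line. This turns "the segment lies in a union of boundaries"
into "the segment lies on one side of one tile". -/
theorem exists_segment_subset_of_finite_cover {ι : Type*} {p q : ℂ} (hpq : p ≠ q) {s : Set ι}
    (hs : s.Finite) (x y : ι → ℂ)
    (hcov : openSegment ℝ p q ⊆ ⋃ i ∈ s, segment ℝ (x i) (y i))
    (hx : ∀ i ∈ s, x i ∉ openSegment ℝ p q) (hy : ∀ i ∈ s, y i ∉ openSegment ℝ p q) :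
    ∃ i ∈ s, segment ℝ p q ⊆ segment ℝ (x i) (y i) := by
  have : ∃ i ∈ s, (openSegment ℝ p q ∩ segment ℝ (x i) (y i)).Infinite := by
    by_contra! h
    refine infinite_openSegment hpq ((hs.biUnion h).subset ?_)
    intro z hz
    obtain ⟨i, hi, hzi⟩ := mem_iUnion₂.1 (hcov hz)
    exact mem_iUnion₂.2 ⟨i, hi, hz, hzi⟩
  obtain ⟨i, hi, hinf⟩ := this
  obtain ⟨m, hm, n, hn, hmn⟩ := hinf.nontrivial
  exact ⟨i, hi, segment_subset_of_two_points hpq hmn hm.1 hn.1 hm.2 hn.2 (hx i hi) (hy i hi)⟩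

/-- Vanishing cross product means collinear, non-positive dot product means between. In this form
the criterion becomes decidable on integer coordinates. -/
theorem mem_segment_iff {x y z : ℂ} :
    z ∈ segment ℝ x y ↔ ((starRingEnd ℂ) (y - x) * (z - x)).im = 0 ∧
      ((starRingEnd ℂ) (z - x) * (z - y)).re ≤ 0 := by
  constructor
  · intro h
    obtain ⟨s, h0, h1, rfl⟩ := mem_segment_iff_exists.1 h
    constructor
    · simp; ring
    · simp
      nlinarith [mul_nonneg h0 (sub_nonneg.2 h1), sq_nonneg (y.re - x.re), sq_nonneg (y.im - x.im),
        mul_nonneg (mul_nonneg h0 (sub_nonneg.2 h1)) (sq_nonneg (y.re - x.re)),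
        mul_nonneg (mul_nonneg h0 (sub_nonneg.2 h1)) (sq_nonneg (y.im - x.im))]
  · rintro ⟨h1, h2⟩
    by_cases hxy : x = y
    · subst hxy
      have : normSq (z - x) ≤ 0 := by
        rw [normSq_apply]; simp at h2 ⊢; linarith
      have := normSq_eq_zero.1 (le_antisymm this (normSq_nonneg _))
      rw [sub_eq_zero.1 this]
      exact left_mem_segment ℝ _ _
    · set w := (z - x) / (y - x) with hw
      have hyx : y - x ≠ 0 := sub_ne_zero.2 (Ne.symm hxy)
      have hzw : z - x = w * (y - x) := by rw [hw]; field_simp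
      have hn : 0 < normSq (y - x) := normSq_pos.2 hyx
      have h1' : w.im * normSq (y - x) = 0 := by
        rw [← h1, hzw, mul_comm w, ← mul_assoc, ← normSq_eq_conj_mul_self]
        simp [mul_comm]
      have hwim : w.im = 0 := by
        rcases mul_eq_zero.1 h1' with h | h
        · exact h
        · exact absurd h hn.ne'
      have hwre : w = (w.re : ℂ) := by apply Complex.ext <;> simp [hwim]
      have h2' : (w.re * (w.re - 1)) * normSq (y - x) ≤ 0 := by
        refine le_trans (le_of_eq ?_) h2
        have : z - y = (w - 1) * (y - x) := by linear_combination hzw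
        rw [this, hzw, map_mul]
        have e : (starRingEnd ℂ) w * (starRingEnd ℂ) (y - x) * ((w - 1) * (y - x)) =
          ((starRingEnd ℂ) w * (w - 1)) * (normSq (y - x) : ℂ) := by
          rw [normSq_eq_conj_mul_self]; ring
        rw [e, re_mul_ofReal, hwre]
        simp
      have h3 : w.re * (w.re - 1) ≤ 0 := by
        by_contra! h
        nlinarith
      refine mem_segment_iff_exists.2 ⟨w.re, by nlinarith, by nlinarith, ?_⟩
      rw [← hwre]
      linear_combination hzw

theorem mem_openSegment_iff {x y z : ℂ} (hxy : x ≠ y) :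
    z ∈ openSegment ℝ x y ↔ ((starRingEnd ℂ) (y - x) * (z - x)).im = 0 ∧
      ((starRingEnd ℂ) (z - x) * (z - y)).re < 0 := by
  constructor
  · intro h
    obtain ⟨s, h0, h1, rfl⟩ := mem_openSegment_iff_exists.1 h
    constructor
    · simp; ring
    · have hn : 0 < normSq (y - x) := normSq_pos.2 (sub_ne_zero.2 (Ne.symm hxy))
      rw [normSq_apply] at hn
      have := mul_pos (mul_pos h0 (sub_pos.2 h1)) hn
      simp at this ⊢
      nlinarith
  · rintro ⟨h1, h2⟩
    have h := mem_segment_iff.2 ⟨h1, h2.le⟩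
    refine mem_openSegment_of_ne_left_right ?_ ?_ h
    · rintro rfl; simp at h2
    · rintro rfl; simp at h2

end Pinwheel

namespace Pinwheel

open Complex Set

/-! ## Half-planes -/

theorem interior_halfPlane {α : ℂ} (hα : α ≠ 0) (c : ℝ) :
    interior {z : ℂ | 0 ≤ (α * z).re + c} = {z : ℂ | 0 < (α * z).re + c} := by
  have h := (Homeomorph.mulLeft₀ α hα).isOpenMap.preimage_interior_eq_interior_preimage
    (Homeomorph.mulLeft₀ α hα).continuous {z : ℂ | -c ≤ z.re}
  rw [interior_setOfPred_le_re] at h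
  have e1 : {z : ℂ | 0 ≤ (α * z).re + c} = (Homeomorph.mulLeft₀ α hα) ⁻¹' {z : ℂ | -c ≤ z.re} := by
    ext z; simp only [mem_ofPred_eq, mem_preimage, Homeomorph.coe_mulLeft₀]
    constructor <;> intro h <;> linarith
  have e2 : {z : ℂ | 0 < (α * z).re + c} = (Homeomorph.mulLeft₀ α hα) ⁻¹' {z : ℂ | -c < z.re} := by
    ext z; simp only [mem_ofPred_eq, mem_preimage, Homeomorph.coe_mulLeft₀]
    constructor <;> intro h <;> linarith
  rw [e1, e2, h]

theorem convex_halfPlane (α : ℂ) (c : ℝ) : Convex ℝ {z : ℂ | 0 ≤ (α * z).re + c} := by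
  intro x hx y hy a b ha hb hab
  simp only [mem_ofPred_eq] at *
  have : (α * (a • x + b • y)).re + c = a * ((α * x).re + c) + b * ((α * y).re + c) := by
    rw [show b = 1 - a by linarith]
    simp; ring
  rw [this]; positivity

/-! ## Triangles -/

namespace Triangle

theorem mem_region {t : Triangle} {z : ℂ} : z ∈ t.region ↔
    ∃ α β γ : ℝ, 0 ≤ α ∧ 0 ≤ β ∧ 0 ≤ γ ∧ α + β + γ = 1 ∧ z = α * t.a + β * t.b + γ * t.c := by
  unfold region corners
  rw [convexHull_insert ⟨t.b, by simp⟩, convexHull_pair, mem_convexJoin]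
  constructor
  · rintro ⟨_, rfl, w, hw, hz⟩
    obtain ⟨r, h0, h1, rfl⟩ := mem_segment_iff_exists.1 hw
    obtain ⟨s, h0', h1', rfl⟩ := mem_segment_iff_exists.1 hz
    refine ⟨1 - s, s * (1 - r), s * r, by linarith, mul_nonneg h0' (by linarith), by positivity,
      by ring, ?_⟩
    push_cast; ring
  · rintro ⟨α, β, γ, h1, h2, h3, h4, rfl⟩
    have hα : (α : ℂ) = 1 - β - γ := by
      rw [← Complex.ofReal_one, ← h4]; push_cast; ring
    rcases eq_or_lt_of_le (add_nonneg h2 h3) with h | h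
    · obtain rfl : β = 0 := by linarith
      obtain rfl : γ = 0 := by linarith
      refine ⟨t.a, rfl, t.b, left_mem_segment ℝ _ _, ?_⟩
      rw [hα]; simpa using left_mem_segment ℝ _ _
    · refine ⟨t.a, rfl, t.b + ((γ / (β + γ) : ℝ) : ℂ) * (t.c - t.b),
        mem_segment_iff_exists.2 ⟨_, by positivity, (div_le_one h).2 (by linarith), rfl⟩,
        mem_segment_iff_exists.2 ⟨β + γ, h.le, by linarith, ?_⟩⟩
      have : (β : ℂ) + γ ≠ 0 := by exact_mod_cast h.ne'
      rw [hα]; push_cast; field_simp; ring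

theorem convex_region (t : Triangle) : Convex ℝ t.region := convex_convexHull _ _

theorem corner_mem_region {t : Triangle} {p : ℂ} (h : p ∈ t.corners) : p ∈ t.region :=
  subset_convexHull _ _ h

theorem region_subset {t : Triangle} {K : Set ℂ} (hK : Convex ℝ K) (ha : t.a ∈ K) (hb : t.b ∈ K)
    (hc : t.c ∈ K) : t.region ⊆ K := by
  refine convexHull_min ?_ hK
  rintro p (rfl | rfl | rfl) <;> assumption

theorem finite_corners (t : Triangle) : t.corners.Finite := by
  unfold corners; exact Set.toFinite _

theorem isCompact_region (t : Triangle) : IsCompact t.region :=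
  t.finite_corners.isCompact_convexHull ℝ

theorem isClosed_region (t : Triangle) : IsClosed t.region := t.isCompact_region.isClosed

theorem disjoint_interior_of_separated {t t' : Triangle} {α : ℂ} (hα : α ≠ 0) (c : ℝ)
    (h : ∀ p ∈ t.corners, 0 ≤ (α * p).re + c) (h' : ∀ p ∈ t'.corners, (α * p).re + c ≤ 0) :
    Disjoint (interior t.region) (interior t'.region) := by
  have h1 : t.region ⊆ {z : ℂ | 0 ≤ (α * z).re + c} :=
    convexHull_min h (convex_halfPlane _ _)
  have h2 : t'.region ⊆ {z : ℂ | 0 ≤ (-α * z).re + -c} := by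
    refine convexHull_min (fun p hp => ?_) (convex_halfPlane _ _)
    have := h' p hp
    simp only [mem_ofPred_eq, neg_mul, neg_re]; linarith
  rw [Set.disjoint_left]
  intro z hz hz'
  have a1 := interior_mono h1 hz
  have a2 := interior_mono h2 hz'
  rw [interior_halfPlane hα] at a1
  rw [interior_halfPlane (neg_ne_zero.2 hα)] at a2
  simp only [mem_ofPred_eq, neg_mul, neg_re] at a1 a2
  linarith

/-- The pinwheel triangle with right angle at `a` and short leg `u`, anticlockwise if `ε = 1` and
clockwise if `ε = -1`. -/
noncomputable def std (ε : ℝ) (a u : ℂ) : Triangle := ⟨a, a + u, a + 2 * ε * I * u⟩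

theorem IsPinwheel.exists_std {s : ℝ} {t : Triangle} (hs : 0 < s) (h : t.IsPinwheel s) :
    ∃ (ε : ℝ) (u : ℂ), (ε = 1 ∨ ε = -1) ∧ ‖u‖ = s ∧ t = std ε t.a u := by
  obtain ⟨h1, h2, h3⟩ := h
  obtain ⟨a, b, c⟩ := t
  simp only at *
  set u := b - a with hu
  have hu0 : ‖u‖ = s := by rw [hu, ← h1, dist_comm, dist_eq]
  set v := c - a with hv
  have n1 : u.re * u.re + u.im * u.im = s * s := by
    rw [← normSq_apply, normSq_eq_norm_sq, hu0, sq]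
  have n2 : v.re * v.re + v.im * v.im = 4 * (s * s) := by
    rw [← normSq_apply, normSq_eq_norm_sq, hv, ← dist_eq, dist_comm, h2]; ring
  have n3 : (u.re - v.re) * (u.re - v.re) + (u.im - v.im) * (u.im - v.im) = 5 * (s * s) := by
    have : u - v = b - c := by rw [hu, hv]; ring
    rw [← sub_re, ← sub_im, ← normSq_apply, normSq_eq_norm_sq, this, ← dist_eq, h3, mul_pow,
      Real.sq_sqrt (by norm_num)]; ring
  have n4 : u.re * v.re + u.im * v.im = 0 := by linarith
  have hss : 0 < s * s := by positivity
  -- The long leg `v` is orthogonal to `u`, so `v = κ * I * u` with `κ` the cross product over `‖u‖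
  -- ^ 2`. The lengths force `κ = ±2`, and the sign is the orientation.
  set κ := (u.re * v.im - u.im * v.re) / (s * s) with hκ
  have k1 : κ * (s * s) = u.re * v.im - u.im * v.re := by rw [hκ]; field_simp
  have e1 : v.re = - κ * u.im := by
    have : v.re * (s * s) = (- κ * u.im) * (s * s) := by
      linear_combination u.im * k1 - v.re * n1 + u.re * n4
    exact mul_right_cancel₀ hss.ne' this
  have e2 : v.im = κ * u.re := by
    have : v.im * (s * s) = (κ * u.re) * (s * s) := by
      linear_combination - u.re * k1 - v.im * n1 + u.im * n4
    exact mul_right_cancel₀ hss.ne' this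
  have k2 : κ * κ = 4 := by
    have : (κ * κ) * (s * s) = 4 * (s * s) := by
      rw [← n2, e1, e2, ← n1]; ring
    exact mul_right_cancel₀ hss.ne' this
  have k3 : κ = 2 ∨ κ = -2 := by
    have : (κ - 2) * (κ + 2) = 0 := by linear_combination k2
    rcases mul_eq_zero.1 this with h | h
    · left; linarith
    · right; linarith
  refine ⟨κ / 2, u, ?_, hu0, ?_⟩
  · rcases k3 with h | h <;> rw [h] <;> norm_num
  · have hcv : c = a + v := by rw [hv]; ring
    have hbu : b = a + u := by rw [hu]; ring
    have : v = κ * I * u := by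
      apply Complex.ext <;> simp [e1, e2]
    simp only [std, mk.injEq, true_and]
    refine ⟨hbu, ?_⟩
    rw [hcv, this]; push_cast; ring

theorem std_isPinwheel {ε : ℝ} (hε : ε = 1 ∨ ε = -1) (a u : ℂ) : (std ε a u).IsPinwheel ‖u‖ := by
  have hε2 : ε * ε = 1 := by rcases hε with rfl | rfl <;> norm_num
  have hε1 : |ε| = 1 := by rcases hε with rfl | rfl <;> norm_num
  refine ⟨?_, ?_, ?_⟩
  · simp [std]
  · simp [std, hε1]
  · have : (std ε a u).b - (std ε a u).c = (1 - 2 * ε * I) * u := by simp only [std]; ring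
    rw [dist_eq, this, norm_mul]
    congr 1
    rw [Complex.norm_def, normSq_apply]
    simp
    congr 1
    linear_combination 4 * hε2

theorem frame_std (ε : ℝ) (a u : ℂ) (i j : ℝ) :
    (std ε a u).frame i j = a + u * (i + ε * j * I) / 5 := by
  simp only [std, frame, real_smul]
  push_cast
  ring

theorem frame_a (t : Triangle) : t.frame 0 0 = t.a := by simp [frame]
theorem frame_b (t : Triangle) : t.frame 5 0 = t.b := by simp [frame]
theorem frame_c (t : Triangle) : t.frame 0 10 = t.c := by simp [frame]

theorem frame_lerp (t : Triangle) (i j i' j' s : ℝ) :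
    t.frame i j + s * (t.frame i' j' - t.frame i j) =
      t.frame (i + s * (i' - i)) (j + s * (j' - j)) := by
  simp only [frame, real_smul]; push_cast; ring

/-- The first coordinate of a point in the frame of `std ε a u`. -/
noncomputable def coordX (a u z : ℂ) : ℝ := 5 * ((z - a) / u).re

/-- The second coordinate of a point in the frame of `std ε a u`. -/
noncomputable def coordY (ε : ℝ) (a u z : ℂ) : ℝ := 5 * ε * ((z - a) / u).im

section Std

variable {ε : ℝ} {a u : ℂ} (hε : ε = 1 ∨ ε = -1) (hu : u ≠ 0)
include hu

theorem coordX_frame (i j : ℝ) : coordX a u ((std ε a u).frame i j) = i := by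
  rw [frame_std, coordX]
  have : (a + u * (i + ε * j * I) / 5 - a) / u = ((i / 5 : ℝ) : ℂ) + ((ε * j / 5 : ℝ) : ℂ) * I := by
    push_cast; field_simp; ring
  rw [this]; simp; ring

include hε

theorem coordY_frame (i j : ℝ) : coordY ε a u ((std ε a u).frame i j) = j := by
  rw [frame_std, coordY]
  have hε2 : ε * ε = 1 := by rcases hε with rfl | rfl <;> norm_num
  have : (a + u * (i + ε * j * I) / 5 - a) / u = ((i / 5 : ℝ) : ℂ) + ((ε * j / 5 : ℝ) : ℂ) * I := by
    push_cast; field_simp; ring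
  rw [this]; simp
  linear_combination j * hε2

theorem frame_coord (z : ℂ) : (std ε a u).frame (coordX a u z) (coordY ε a u z) = z := by
  have hε2 : (ε : ℂ) * ε = 1 := by rcases hε with rfl | rfl <;> norm_num
  rw [frame_std, coordX, coordY]
  have h1 := re_add_im ((z - a) / u)
  set w := (z - a) / u with hw
  have hz : z = a + u * w := by rw [hw]; field_simp; ring
  rw [hz]
  conv_rhs => rw [← h1]
  push_cast
  linear_combination (u * w.im * I) * hε2

theorem frame_std_injective {i j i' j' : ℝ}
    (h : (std ε a u).frame i j = (std ε a u).frame i' j') : i = i' ∧ j = j' := by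
  constructor
  · rw [← coordX_frame (ε := ε) (a := a) hu i j, h, coordX_frame hu]
  · rw [← coordY_frame (a := a) hε hu i j, h, coordY_frame hε hu]

theorem frame_mem_region_std {X Y : ℝ} :
    (std ε a u).frame X Y ∈ (std ε a u).region ↔ 0 ≤ X ∧ 0 ≤ Y ∧ 2 * X + Y ≤ 10 := by
  rw [mem_region]
  constructor
  · rintro ⟨α, β, γ, h1, h2, h3, h4, h5⟩
    have : (std ε a u).frame X Y = (std ε a u).frame (5 * β) (10 * γ) := by
      rw [h5]; simp only [frame, real_smul]
      push_cast
      have : (α : ℂ) = 1 - β - γ := by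
        rw [← Complex.ofReal_one, ← h4]; push_cast; ring
      rw [this]; ring
    obtain ⟨rfl, rfl⟩ := frame_std_injective hε hu this
    exact ⟨by linarith, by linarith, by linarith⟩
  · rintro ⟨h1, h2, h3⟩
    refine ⟨1 - X / 5 - Y / 10, X / 5, Y / 10, by linarith, by linarith, by linarith, by ring, ?_⟩
    simp only [frame, real_smul]; push_cast; ring

omit hε in
theorem lin_coord (α β γ : ℝ) (z : ℂ) : α * coordX a u z + β * coordY ε a u z + γ =
    ((5 * (α - ε * β * I) / u) * z).re +
      (γ - ((5 * (α - ε * β * I) / u) * a).re) := by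
  simp only [coordX, coordY]
  have : (5 * (α - ε * β * I) / u) * z =
    (5 * (α - ε * β * I) / u) * a + ((5 * α : ℝ) - (5 * ε * β : ℝ) * I) * ((z - a) / u) := by
    push_cast; field_simp; ring
  rw [this]; simp; ring

omit hε in
theorem interior_lin (α β γ : ℝ) (h : (α : ℂ) - ε * β * I ≠ 0) :
    interior {z | 0 ≤ α * coordX a u z + β * coordY ε a u z + γ} =
      {z | 0 < α * coordX a u z + β * coordY ε a u z + γ} := by
  simp only [lin_coord hu]
  exact interior_halfPlane (div_ne_zero (mul_ne_zero (by norm_num) h) hu) _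

omit hu in
theorem lin_ne_zero {α β : ℝ} (h : α ≠ 0 ∨ β ≠ 0) : (α : ℂ) - ε * β * I ≠ 0 := by
  intro h0
  have h1 := congrArg re h0
  have h2 := congrArg im h0
  simp at h1 h2
  rcases hε with rfl | rfl <;> simp at h2 <;> tauto

theorem frame_mem_interior_std {X Y : ℝ} :
    (std ε a u).frame X Y ∈ interior (std ε a u).region ↔ 0 < X ∧ 0 < Y ∧ 2 * X + Y < 10 := by
  have h : (std ε a u).region = {z | 0 ≤ 1 * coordX a u z + 0 * coordY ε a u z + 0} ∩
      ({z | 0 ≤ 0 * coordX a u z + 1 * coordY ε a u z + 0} ∩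
      {z | 0 ≤ (-2) * coordX a u z + (-1) * coordY ε a u z + 10}) := by
    ext z
    rw [← frame_coord (a := a) hε hu z, frame_mem_region_std hε hu]
    simp only [mem_inter_iff, mem_ofPred_eq, frame_coord hε hu]
    constructor
    · rintro ⟨h1, h2, h3⟩; exact ⟨by linarith, by linarith, by linarith⟩
    · rintro ⟨h1, h2, h3⟩; exact ⟨by linarith, by linarith, by linarith⟩
  rw [h, interior_inter, interior_inter, interior_lin hu, interior_lin hu, interior_lin hu]
  · simp only [mem_inter_iff, mem_ofPred_eq, coordX_frame hu, coordY_frame hε hu]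
    constructor
    · rintro ⟨h1, h2, h3⟩; exact ⟨by linarith, by linarith, by linarith⟩
    · rintro ⟨h1, h2, h3⟩; exact ⟨by linarith, by linarith, by linarith⟩
  all_goals exact lin_ne_zero hε (by norm_num)

theorem disjoint_interior_of_lin {t t' : Triangle} (α β γ : ℝ) (hαβ : α ≠ 0 ∨ β ≠ 0)
    (h : ∀ p ∈ t.corners, 0 ≤ α * coordX a u p + β * coordY ε a u p + γ)
    (h' : ∀ p ∈ t'.corners, α * coordX a u p + β * coordY ε a u p + γ ≤ 0) :
    Disjoint (interior t.region) (interior t'.region) := by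
  simp only [lin_coord hu] at h h'
  exact disjoint_interior_of_separated
    (div_ne_zero (mul_ne_zero (by norm_num) (lin_ne_zero hε hαβ)) hu) _ h h'

end Std

/-- The children of a triangle: a numbering of the dissection. -/
noncomputable def child (t : Triangle) : Fin 5 → Triangle :=
  ![⟨t.frame 2 6, t.frame 0 5, t.frame 0 10⟩,
    ⟨t.frame 4 2, t.frame 5 0, t.frame 0 0⟩,
    ⟨t.frame 2 1, t.frame 0 0, t.frame 0 5⟩,
    ⟨t.frame 2 1, t.frame 4 2, t.frame 0 5⟩,
    ⟨t.frame 2 6, t.frame 0 5, t.frame 4 2⟩]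

theorem mem_dissect {t t' : Triangle} : t' ∈ t.dissect ↔ ∃ i, t' = t.child i := by
  simp [dissect, child, Fin.exists_fin_succ]

end Triangle

end Pinwheel

namespace Pinwheel

open Complex Set

namespace Triangle

/-! ## The dissection -/

/-- The orientation of the children relative to their parent. -/
def childSign : Fin 5 → ℝ := ![-1, -1, -1, 1, 1]

/-- The short legs of the children relative to that of their parent. -/
noncomputable def childLeg (ε : ℝ) : Fin 5 → ℂ :=
  ![(-2 - ε * I) / 5, (1 - 2 * ε * I) / 5, (-2 - ε * I) / 5, (2 + ε * I) / 5, (-2 - ε * I) / 5]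

/-- The right-angled corners of the children in the frame of their parent. -/
def childCorner : Fin 5 → ℝ × ℝ := ![(2, 6), (4, 2), (2, 1), (2, 1), (2, 6)]

theorem child_std {ε : ℝ} (hε : ε = 1 ∨ ε = -1) (a u : ℂ) (i : Fin 5) :
    (std ε a u).child i = std (childSign i * ε)
      ((std ε a u).frame (childCorner i).1 (childCorner i).2) (u * childLeg ε i) := by
  rcases hε with rfl | rfl <;> fin_cases i <;>
    simp only [child, childSign, childLeg, childCorner, frame_std] <;>
    simp [std] <;> refine ⟨?_, ?_⟩ <;> ring_nf <;> simp only [I_sq] <;> ring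

theorem childSign_mul {ε : ℝ} (hε : ε = 1 ∨ ε = -1) (i : Fin 5) :
    childSign i * ε = 1 ∨ childSign i * ε = -1 := by
  fin_cases i <;> simp [childSign] <;> rcases hε with rfl | rfl <;> norm_num

theorem norm_childLeg {ε : ℝ} (hε : ε = 1 ∨ ε = -1) (i : Fin 5) : ‖childLeg ε i‖ = 1 / √5 := by
  have hε2 : ε * ε = 1 := by rcases hε with rfl | rfl <;> norm_num
  have h5 : (1 : ℝ) / √5 = √(1 / 5) := by rw [Real.sqrt_div zero_le_one, Real.sqrt_one]
  rw [h5, Complex.norm_def]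
  congr 1
  rw [normSq_apply]
  fin_cases i <;> simp [childLeg] <;> linarith

theorem IsPinwheel.of_mem_dissect {s : ℝ} (hs : 0 < s) {t t' : Triangle} (h : t.IsPinwheel s)
    (ht' : t' ∈ t.dissect) : t'.IsPinwheel (s / √5) := by
  obtain ⟨ε, u, hε, hu, ht⟩ := h.exists_std hs
  obtain ⟨i, rfl⟩ := mem_dissect.1 ht'
  rw [ht, child_std hε]
  have := std_isPinwheel (childSign_mul hε i) ((std ε t.a u).frame (childCorner i).1
    (childCorner i).2) (u * childLeg ε i)
  rwa [norm_mul, hu, norm_childLeg hε, mul_one_div] at this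

theorem frame_mem_region {t : Triangle} {X Y : ℝ} (h1 : 0 ≤ X) (h2 : 0 ≤ Y) (h3 : 2 * X + Y ≤ 10) :
    t.frame X Y ∈ t.region := by
  rw [mem_region]
  refine ⟨1 - X / 5 - Y / 10, X / 5, Y / 10, by linarith, by linarith, by linarith, by ring, ?_⟩
  simp only [frame, real_smul]; push_cast; ring

theorem exists_frame_of_mem_region {t : Triangle} {z : ℂ} (h : z ∈ t.region) :
    ∃ X Y : ℝ, 0 ≤ X ∧ 0 ≤ Y ∧ 2 * X + Y ≤ 10 ∧ z = t.frame X Y := by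
  obtain ⟨α, β, γ, h1, h2, h3, h4, rfl⟩ := mem_region.1 h
  refine ⟨5 * β, 10 * γ, by linarith, by linarith, by linarith, ?_⟩
  have : (α : ℂ) = 1 - β - γ := by
    rw [← Complex.ofReal_one, ← h4]; push_cast; ring
  simp only [frame, real_smul, this]; push_cast; ring

theorem region_child_subset (t : Triangle) (i : Fin 5) : (t.child i).region ⊆ t.region := by
  refine region_subset t.convex_region ?_ ?_ ?_ <;> fin_cases i <;>
    exact frame_mem_region (by norm_num) (by norm_num) (by norm_num)

theorem region_eq_iUnion_child (t : Triangle) : t.region = ⋃ i, (t.child i).region := by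
  refine Subset.antisymm ?_ (iUnion_subset t.region_child_subset)
  intro z hz
  obtain ⟨X, Y, h1, h2, h3, rfl⟩ := exists_frame_of_mem_region hz
  rw [mem_iUnion]
  -- Four lines cut off the children one after another: through (0,5) and (2,6); through (0,5) and
  -- (4,2); through (0,0) and (4,2); through (0,5) and (2,1). The witnesses are the barycentric
  -- coordinates in the child that is left.
  by_cases c1 : 0 ≤ Y - 5 - X / 2
  · refine ⟨0, mem_region.2 ⟨X / 2, 1 - X / 2 - (Y - 5 - X / 2) / 5, (Y - 5 - X / 2) / 5,
      by linarith, by linarith, by linarith, by ring, ?_⟩⟩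
    simp [child, frame]; ring
  by_cases c2 : 0 ≤ Y - 5 + 3 * X / 4
  · refine ⟨4, mem_region.2 ⟨X / 2 - 2 * ((5 + X / 2 - Y) / 5),
      1 - (X / 2 - 2 * ((5 + X / 2 - Y) / 5)) - (5 + X / 2 - Y) / 5, (5 + X / 2 - Y) / 5,
      by linarith, by linarith, by linarith, by ring, ?_⟩⟩
    simp [child, frame]; ring
  by_cases c3 : Y - X / 2 ≤ 0
  · refine ⟨1, mem_region.2 ⟨Y / 2, (X - 2 * Y) / 5, 1 - Y / 2 - (X - 2 * Y) / 5,
      by linarith, by linarith, by linarith, by ring, ?_⟩⟩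
    simp [child, frame]; ring
  by_cases c4 : 0 ≤ Y - 5 + 2 * X
  · refine ⟨3, mem_region.2 ⟨1 - (Y - X / 2) / 5 - (X / 2 - 1 + (Y - X / 2) / 5),
      X / 2 - 1 + (Y - X / 2) / 5, (Y - X / 2) / 5,
      by linarith, by linarith, by linarith, by ring, ?_⟩⟩
    simp [child, frame]; ring
  · refine ⟨2, mem_region.2 ⟨X / 2, 1 - X / 2 - (Y - X / 2) / 5, (Y - X / 2) / 5,
      by linarith, by linarith, by linarith, by ring, ?_⟩⟩
    simp [child, frame]; ring

theorem region_eq_biUnion_dissect (t : Triangle) : t.region = ⋃ t' ∈ t.dissect, t'.region := by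
  rw [region_eq_iUnion_child]
  ext z
  simp [mem_dissect]

theorem disjoint_interior_child {ε : ℝ} (hε : ε = 1 ∨ ε = -1) (a : ℂ) {u : ℂ} (hu : u ≠ 0)
    {i j : Fin 5} (hij : i ≠ j) : Disjoint (interior ((std ε a u).child i).region)
      (interior ((std ε a u).child j).region) := by
  obtain ⟨D, hD⟩ : ∃ D : Fin 5 → Fin 5 → Prop, D = fun i j =>
      Disjoint (interior ((std ε a u).child i).region)
        (interior ((std ε a u).child j).region) := ⟨_, rfl⟩
  have key : ∀ α β γ : ℝ, (α ≠ 0 ∨ β ≠ 0) → ∀ i j : Fin 5,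
      ((∀ p ∈ ((std ε a u).child i).corners, 0 ≤ α * coordX a u p + β * coordY ε a u p + γ) ∧
      (∀ p ∈ ((std ε a u).child j).corners, α * coordX a u p + β * coordY ε a u p + γ ≤ 0)) →
      D i j ∧ D j i := by
    rintro α β γ h i j ⟨h1, h2⟩
    rw [hD]
    exact ⟨disjoint_interior_of_lin hε hu α β γ h h1 h2,
      (disjoint_interior_of_lin hε hu α β γ h h1 h2).symm⟩
  -- The same four lines as in `region_eq_iUnion_child` separate every pair of children.
  have d0 := fun j => key (-1 / 2) 1 (-5) (by norm_num) 0 j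
  have d4 := fun j => key (3 / 4) 1 (-5) (by norm_num) 4 j
  have d1 := fun j => key (1 / 2) (-1) 0 (by norm_num) 1 j
  have d3 := key 2 1 (-5) (by norm_num) 3 2
  simp only [corners, mem_insert_iff, mem_singleton_iff, forall_eq_or_imp, forall_eq]
    at d0 d1 d3 d4
  have d01 := d0 1 (by
    simp only [child, Matrix.cons_val, coordX_frame hu, coordY_frame hε hu]; norm_num)
  have d02 := d0 2 (by
    simp only [child, Matrix.cons_val, coordX_frame hu, coordY_frame hε hu]; norm_num)
  have d03 := d0 3 (by
    simp only [child, Matrix.cons_val, coordX_frame hu, coordY_frame hε hu]; norm_num)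
  have d04 := d0 4 (by
    simp only [child, Matrix.cons_val, coordX_frame hu, coordY_frame hε hu]; norm_num)
  have d41 := d4 1 (by
    simp only [child, Matrix.cons_val, coordX_frame hu, coordY_frame hε hu]; norm_num)
  have d42 := d4 2 (by
    simp only [child, Matrix.cons_val, coordX_frame hu, coordY_frame hε hu]; norm_num)
  have d43 := d4 3 (by
    simp only [child, Matrix.cons_val, coordX_frame hu, coordY_frame hε hu]; norm_num)
  have d12 := d1 2 (by
    simp only [child, Matrix.cons_val, coordX_frame hu, coordY_frame hε hu]; norm_num)
  have d13 := d1 3 (by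
    simp only [child, Matrix.cons_val, coordX_frame hu, coordY_frame hε hu]; norm_num)
  have d32 := d3 (by
    simp only [child, Matrix.cons_val, coordX_frame hu, coordY_frame hε hu]; norm_num)
  change (fun i j => Disjoint (interior ((std ε a u).child i).region)
        (interior ((std ε a u).child j).region)) i j
  rw [← hD]
  clear hD key d0 d1 d3 d4
  fin_cases i <;> fin_cases j <;> first
    | exact absurd rfl hij
    | exact d01.1 | exact d02.1 | exact d03.1 | exact d04.1 | exact d12.1
    | exact d13.1 | exact d32.1 | exact d41.1 | exact d42.1 | exact d43.1
    | exact d01.2 | exact d02.2 | exact d03.2 | exact d04.2 | exact d12.2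
    | exact d13.2 | exact d32.2 | exact d41.2 | exact d42.2 | exact d43.2

theorem IsPinwheel.disjoint_dissect {s : ℝ} (hs : 0 < s) {t : Triangle} (h : t.IsPinwheel s)
    {t₁ t₂ : Triangle} (h₁ : t₁ ∈ t.dissect) (h₂ : t₂ ∈ t.dissect) (hne : t₁ ≠ t₂) :
    Disjoint (interior t₁.region) (interior t₂.region) := by
  obtain ⟨ε, u, hε, hu, ht⟩ := h.exists_std hs
  have hu0 : u ≠ 0 := by rintro rfl; simp at hu; linarith
  obtain ⟨i, rfl⟩ := mem_dissect.1 h₁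
  obtain ⟨j, rfl⟩ := mem_dissect.1 h₂
  rw [ht] at hne ⊢
  exact disjoint_interior_child hε _ hu0 (fun e => hne (by rw [e]))

/-! ## Iterated dissections -/

theorem mem_dissectIter_succ {n : ℕ} {t t' : Triangle} :
    t' ∈ dissectIter (n + 1) t ↔ ∃ t₁ ∈ t.dissect, t' ∈ dissectIter n t₁ := by
  simp [dissectIter]

/-- The definition splits off the first dissection. Parents of tiles appear in the last one, so the
recursion is needed from the other end too. -/
theorem mem_dissectIter_succ' {n : ℕ} {t t' : Triangle} :
    t' ∈ dissectIter (n + 1) t ↔ ∃ t₁ ∈ dissectIter n t, t' ∈ t₁.dissect := by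
  induction n generalizing t with
  | zero => simp [dissectIter]
  | succ n ih =>
    rw [mem_dissectIter_succ]
    simp only [ih]
    constructor
    · rintro ⟨t₁, h1, t₂, h2, h3⟩
      exact ⟨t₂, mem_dissectIter_succ.2 ⟨t₁, h1, h2⟩, h3⟩
    · rintro ⟨t₂, h2, h3⟩
      obtain ⟨t₁, h1, h2⟩ := mem_dissectIter_succ.1 h2
      exact ⟨t₁, h1, t₂, h2, h3⟩

theorem region_subset_of_mem_dissect {t t' : Triangle} (h : t' ∈ t.dissect) :
    t'.region ⊆ t.region := by
  obtain ⟨i, rfl⟩ := mem_dissect.1 h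
  exact region_child_subset _ _

theorem region_subset_of_mem_dissectIter {n : ℕ} {t t' : Triangle} (h : t' ∈ dissectIter n t) :
    t'.region ⊆ t.region := by
  induction n generalizing t with
  | zero => rw [dissectIter, mem_singleton_iff] at h; rw [h]
  | succ n ih =>
    obtain ⟨t₁, h1, h2⟩ := mem_dissectIter_succ.1 h
    exact (ih h2).trans (region_subset_of_mem_dissect h1)

theorem IsPinwheel.of_mem_dissectIter {n : ℕ} {s : ℝ} (hs : 0 < s) {t t' : Triangle}
    (h : t.IsPinwheel s) (ht' : t' ∈ dissectIter n t) : t'.IsPinwheel (s / √5 ^ n) := by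
  induction n generalizing t s with
  | zero => rw [dissectIter, mem_singleton_iff] at ht'; simpa [ht'] using h
  | succ n ih =>
    obtain ⟨t₁, h1, h2⟩ := mem_dissectIter_succ.1 ht'
    have := ih (by positivity) (h.of_mem_dissect hs h1) h2
    rwa [div_div, ← pow_succ'] at this

theorem IsPinwheel.disjoint_dissectIter {n : ℕ} {s : ℝ} (hs : 0 < s) {t : Triangle}
    (h : t.IsPinwheel s) {t₁ t₂ : Triangle} (h₁ : t₁ ∈ dissectIter n t) (h₂ : t₂ ∈ dissectIter n t)
    (hne : t₁ ≠ t₂) : Disjoint (interior t₁.region) (interior t₂.region) := by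
  induction n generalizing t s with
  | zero =>
    rw [dissectIter, mem_singleton_iff] at h₁ h₂
    exact absurd (h₁.trans h₂.symm) hne
  | succ n ih =>
    obtain ⟨p₁, h1, h1'⟩ := mem_dissectIter_succ.1 h₁
    obtain ⟨p₂, h2, h2'⟩ := mem_dissectIter_succ.1 h₂
    by_cases hp : p₁ = p₂
    · subst hp
      exact ih (by positivity) (h.of_mem_dissect hs h1) h1' h2'
    · exact (h.disjoint_dissect hs h1 h2 hp).mono
        (interior_mono (region_subset_of_mem_dissectIter h1'))
        (interior_mono (region_subset_of_mem_dissectIter h2'))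

/-! ## The interior of a pinwheel triangle -/

theorem IsPinwheel.nonempty_interior {s : ℝ} (hs : 0 < s) {t : Triangle} (h : t.IsPinwheel s) :
    (interior t.region).Nonempty := by
  obtain ⟨ε, u, hε, hu, ht⟩ := h.exists_std hs
  have hu0 : u ≠ 0 := by rintro rfl; simp at hu; linarith
  rw [ht]
  exact ⟨_, (frame_mem_interior_std hε hu0 (X := 1) (Y := 1)).2 (by norm_num)⟩

theorem IsPinwheel.region_subset_closure_interior {s : ℝ} (hs : 0 < s) {t : Triangle}
    (h : t.IsPinwheel s) : t.region ⊆ closure (interior t.region) := by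
  rw [t.convex_region.closure_interior_eq_closure_of_nonempty_interior (h.nonempty_interior hs)]
  exact subset_closure

/-- The long leg is listed in two halves because its midpoint is a vertex of the dissection pattern,
and neighbouring triangles may meet there. -/
theorem IsPinwheel.mem_interior_or_mem_segment {s : ℝ} (hs : 0 < s) {t : Triangle}
    (h : t.IsPinwheel s) {z : ℂ} (hz : z ∈ t.region) : z ∈ interior t.region ∨
      z ∈ segment ℝ t.b t.c ∨ z ∈ segment ℝ t.a t.b ∨ z ∈ segment ℝ t.a (t.frame 0 5) ∨
        z ∈ segment ℝ (t.frame 0 5) t.c := by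
  obtain ⟨ε, u, hε, hu, ht⟩ := h.exists_std hs
  have hu0 : u ≠ 0 := by rintro rfl; simp at hu; linarith
  rw [ht] at hz ⊢
  obtain ⟨X, Y, h1, h2, h3, rfl⟩ := exists_frame_of_mem_region hz
  rw [frame_mem_interior_std hε hu0, ← frame_a (std ε t.a u), ← frame_b (std ε t.a u),
    ← frame_c (std ε t.a u)]
  simp only [mem_segment_iff_exists, frame_lerp]
  by_cases c1 : 0 < X
  · by_cases c2 : 0 < Y
    · by_cases c3 : 2 * X + Y < 10
      · left; exact ⟨c1, c2, c3⟩
      · right; left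
        exact ⟨Y / 10, by linarith, by linarith, by congr 1 <;> linarith⟩
    · right; right; left
      obtain rfl : Y = 0 := by linarith
      exact ⟨X / 5, by linarith, by linarith, by congr 1 <;> ring⟩
  · right; right; right
    obtain rfl : X = 0 := by linarith
    by_cases c2 : Y ≤ 5
    · left; exact ⟨Y / 5, by linarith, by linarith, by congr 1 <;> ring⟩
    · right; exact ⟨(Y - 5) / 5, by linarith, by linarith, by congr 1 <;> ring⟩

theorem IsPinwheel.segment_subset_frontier {s : ℝ} (hs : 0 < s) {t : Triangle}
    (h : t.IsPinwheel s) {p q : ℂ} (hp : p ∈ t.corners) (hq : q ∈ t.corners) (hpq : p ≠ q) :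
    segment ℝ p q ⊆ frontier t.region := by
  obtain ⟨ε, u, hε, hu, ht⟩ := h.exists_std hs
  have hu0 : u ≠ 0 := by rintro rfl; simp at hu; linarith
  rw [t.isClosed_region.frontier_eq]
  intro z hz
  refine ⟨t.convex_region.segment_subset (corner_mem_region hp) (corner_mem_region hq) hz, ?_⟩
  obtain ⟨r, hr0, hr1, rfl⟩ := mem_segment_iff_exists.1 hz
  rw [ht] at hp hq ⊢
  unfold corners at hp hq
  rw [← frame_a, ← frame_b, ← frame_c] at hp hq
  simp only [mem_insert_iff, mem_singleton_iff] at hp hq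
  rcases hp with rfl | rfl | rfl <;> rcases hq with rfl | rfl | rfl <;>
    first
    | exact absurd rfl hpq
    | (rw [frame_lerp, frame_mem_interior_std hε hu0]
       rintro ⟨h1, h2, h3⟩
       linarith)

end Triangle

end Pinwheel

namespace Pinwheel

open Complex Set

/-! ## Families of pinwheel triangles with disjoint interiors -/

namespace Triangle

theorem IsPinwheel.dist_le {s : ℝ} (hs : 0 < s) {t : Triangle} (h : t.IsPinwheel s) {z w : ℂ}
    (hz : z ∈ t.region) (hw : w ∈ t.region) : dist z w ≤ 6 * s := by
  have key : t.region ⊆ Metric.closedBall t.a (3 * s) := by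
    refine region_subset (convex_closedBall _ _) ?_ ?_ ?_
    · simp; linarith
    · rw [Metric.mem_closedBall, dist_comm, h.1]; linarith
    · rw [Metric.mem_closedBall, dist_comm, h.2.1]; linarith
  have h1 := Metric.mem_closedBall.1 (key hz)
  have h2 := Metric.mem_closedBall.1 (key hw)
  have := dist_triangle_right z w t.a
  linarith

theorem IsPinwheel.exists_ball_subset {s : ℝ} (hs : 0 < s) {t : Triangle} (h : t.IsPinwheel s) :
    ∃ c ∈ t.region, Metric.ball c (s / 10) ⊆ interior t.region := by
  obtain ⟨ε, u, hε, hu, ht⟩ := h.exists_std hs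
  have hu0 : u ≠ 0 := by rintro rfl; simp at hu; linarith
  rw [ht]
  refine ⟨(std ε t.a u).frame 1 1, frame_mem_region (by norm_num) (by norm_num) (by norm_num), ?_⟩
  intro z hz
  rw [← frame_coord (a := t.a) hε hu0 z] at hz ⊢
  set X := coordX t.a u z
  set Y := coordY ε t.a u z
  rw [frame_mem_interior_std hε hu0]
  rw [Metric.mem_ball, dist_eq, frame_std, frame_std] at hz
  have e : t.a + u * (X + ε * Y * I) / 5 - (t.a + u * ((1 : ℝ) + ε * (1 : ℝ) * I) / 5) =
      u * (((X - 1) / 5 : ℝ) + (ε * (Y - 1) / 5 : ℝ) * I) := by push_cast; ring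
  rw [e, norm_mul, hu] at hz
  have hz' : ‖(((X - 1) / 5 : ℝ) + (ε * (Y - 1) / 5 : ℝ) * I : ℂ)‖ < 1 / 10 := by
    by_contra! hh
    nlinarith
  have h1 := (abs_re_le_norm _).trans_lt hz'
  have h2 := (abs_im_le_norm _).trans_lt hz'
  simp only [add_re, add_im, ofReal_re, ofReal_im, mul_re, mul_im, I_re, I_im] at h1 h2
  rw [abs_lt] at h1 h2
  have hY : -(1 / 2) < Y - 1 ∧ Y - 1 < 1 / 2 := by
    rcases hε with rfl | rfl <;> constructor <;> linarith [h2.1, h2.2]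
  exact ⟨by linarith [h1.1], by linarith [hY.1], by linarith [h1.2, hY.2]⟩

theorem IsPinwheel.exists_mem_interior {s : ℝ} (hs : 0 < s) {t : Triangle} (h : t.IsPinwheel s)
    {z : ℂ} (hz : z ∈ t.region) {O : Set ℂ} (hO : IsOpen O) (hzO : z ∈ O) :
    ∃ y ∈ O, y ∈ interior t.region :=
  mem_closure_iff.1 (h.region_subset_closure_interior hs hz) O hO hzO

end Triangle

/-- The members of `W` are pinwheel triangles of size `s` with disjoint interiors. -/
structure IsPacking (s : ℝ) (W : Set Triangle) : Prop where
  pos : 0 < s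
  isPinwheel : ∀ t ∈ W, t.IsPinwheel s
  disjoint : ∀ t ∈ W, ∀ t' ∈ W, t ≠ t' → Disjoint (interior t.region) (interior t'.region)

namespace IsPacking

variable {s : ℝ} {W : Set Triangle} (h : IsPacking s W)
include h

/-- A pinwheel triangle lies in the closure of its interior, so an open set that meets it also meets
its interior. It suffices that one of the two memberships is interior. -/
theorem eq_of_mem_interior_of_mem {t t' : Triangle} (ht : t ∈ W) (ht' : t' ∈ W) {z : ℂ}
    (hz : z ∈ interior t.region) (hz' : z ∈ t'.region) : t = t' := by
  obtain ⟨y, h1, h2⟩ := (h.isPinwheel t' ht').exists_mem_interior h.pos hz' isOpen_interior hz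
  by_contra hne
  exact Set.disjoint_left.1 (h.disjoint t ht t' ht' hne) h1 h2

/-- Each member contains a ball of radius `s / 10`. The interiors are disjoint and, for members near
`z`, lie in one bounded ball, so finite area allows only finitely many. -/
theorem finite_near (z : ℂ) (r : ℝ) :
    {t ∈ W | (t.region ∩ Metric.closedBall z r).Nonempty}.Finite := by
  classical
  set A : Set Triangle := {t ∈ W | (t.region ∩ Metric.closedBall z r).Nonempty} with hA
  have hbound : ∀ t ∈ A, t.region ⊆ Metric.closedBall z (r + 6 * s) := by
    rintro t ⟨ht, y, hy, hy'⟩ w hw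
    have := (h.isPinwheel t ht).dist_le h.pos hw hy
    rw [Metric.mem_closedBall] at hy' ⊢
    linarith [dist_triangle w y z]
  have hfin := MeasureTheory.Measure.finite_const_le_meas_of_disjoint_iUnion
    (MeasureTheory.volume : MeasureTheory.Measure ℂ)
    (ε := MeasureTheory.volume (Metric.ball (0 : ℂ) (s / 10)))
    (Metric.measure_ball_pos _ _ (by linarith [h.pos]))
    (As := fun t : A => interior t.1.region) (fun t => isOpen_interior.measurableSet)
    (fun t t' hne => h.disjoint _ t.2.1 _ t'.2.1 (fun e => hne (Subtype.ext e)))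
    (ne_top_of_le_ne_top (MeasureTheory.measure_closedBall_lt_top (x := z) (r := r + 6 * s)).ne
      (MeasureTheory.measure_mono (iUnion_subset fun t => interior_subset.trans (hbound _ t.2))))
  have huniv : {t : A | MeasureTheory.volume (Metric.ball (0 : ℂ) (s / 10)) ≤
      MeasureTheory.volume (interior t.1.region)} = univ := by
    rw [eq_univ_iff_forall]
    intro t
    obtain ⟨c, -, hc⟩ := (h.isPinwheel _ t.2.1).exists_ball_subset h.pos
    refine le_trans (le_of_eq ?_) (MeasureTheory.measure_mono hc)
    exact (MeasureTheory.Measure.addHaar_ball_center _ _ _).symm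
  rw [huniv] at hfin
  exact Set.finite_coe_iff.1 (Set.finite_univ_iff.1 hfin)

end IsPacking

end Pinwheel

namespace Pinwheel

open Complex Set

/-! ## The four supertiles in integer coordinates -/

namespace Kind

/-- The external vertices in anticlockwise order; blue and red ones alternate, beginning with a
blue one. -/
def cyc : Kind → Fin 6 → ℤ × ℤ
  | rectangle => ![(0, 0), (5, 0), (5, 5), (5, 10), (0, 10), (0, 5)]
  | mirrorRectangle => ![(0, 0), (0, 5), (0, 10), (-5, 10), (-5, 5), (-5, 0)]
  | kiteBlue => ![(0, 0), (5, 0), (8, 4), (4, 7), (0, 10), (0, 5)]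
  | kiteRed => ![(5, 0), (8, 4), (4, 7), (0, 10), (0, 5), (0, 0)]

/-- The internal vertices. -/
def inn : Kind → List (ℤ × ℤ)
  | rectangle => [(2, 1), (4, 2), (3, 4), (2, 6), (1, 8), (3, 9)]
  | mirrorRectangle => [(-2, 1), (-4, 2), (-3, 4), (-2, 6), (-1, 8), (-3, 9)]
  | kiteBlue | kiteRed => [(2, 1), (4, 2), (2, 6), (6, 3)]

/-- The internal edges with their weights. -/
def intEdges : Kind → List ((ℤ × ℤ) × (ℤ × ℤ) × ℕ)
  | rectangle =>
      [((0, 0), (2, 1), 2), ((0, 5), (2, 1), 1), ((5, 0), (4, 2), 1), ((0, 5), (4, 2), 1),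
        ((5, 5), (3, 4), 2), ((0, 5), (2, 6), 1), ((0, 10), (1, 8), 2), ((5, 5), (1, 8), 2),
        ((5, 10), (3, 9), 1), ((5, 5), (3, 9), 2), ((1, 8), (2, 6), 1), ((2, 6), (3, 4), 2),
        ((3, 4), (4, 2), 3), ((1, 8), (3, 9), 1), ((2, 1), (4, 2), 1)]
  | mirrorRectangle =>
      [((0, 0), (-2, 1), 2), ((0, 5), (-2, 1), 1), ((-5, 0), (-4, 2), 1), ((0, 5), (-4, 2), 1),
        ((-5, 5), (-3, 4), 2), ((0, 5), (-2, 6), 1), ((0, 10), (-1, 8), 2), ((-5, 5), (-1, 8), 2),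
        ((-5, 10), (-3, 9), 1), ((-5, 5), (-3, 9), 2), ((-1, 8), (-2, 6), 1),
        ((-2, 6), (-3, 4), 2), ((-3, 4), (-4, 2), 3), ((-1, 8), (-3, 9), 1),
        ((-2, 1), (-4, 2), 1)]
  | kiteBlue =>
      [((0, 0), (2, 1), 2), ((0, 5), (2, 1), 1), ((5, 0), (4, 2), 1), ((0, 5), (4, 2), 1),
        ((4, 7), (4, 2), 1), ((0, 10), (2, 6), 2), ((0, 5), (2, 6), 1), ((4, 7), (2, 6), 1),
        ((8, 4), (6, 3), 2), ((4, 7), (6, 3), 1), ((2, 6), (4, 2), 1), ((2, 1), (4, 2), 1),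
        ((4, 2), (6, 3), 1)]
  | kiteRed =>
      [((0, 0), (2, 1), 1), ((0, 5), (2, 1), 2), ((5, 0), (4, 2), 2), ((0, 5), (4, 2), 2),
        ((4, 7), (4, 2), 2), ((0, 10), (2, 6), 1), ((0, 5), (2, 6), 2), ((4, 7), (2, 6), 2),
        ((8, 4), (6, 3), 1), ((4, 7), (6, 3), 2), ((2, 6), (4, 2), 1), ((2, 1), (4, 2), 1),
        ((4, 2), (6, 3), 1)]

/-- The ten tiles. -/
def tri : Kind → List ((ℤ × ℤ) × (ℤ × ℤ) × (ℤ × ℤ))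
  | rectangle =>
      [((2, 6), (0, 5), (0, 10)), ((4, 2), (5, 0), (0, 0)), ((2, 1), (0, 0), (0, 5)),
        ((2, 1), (4, 2), (0, 5)), ((2, 6), (0, 5), (4, 2)), ((3, 4), (5, 5), (5, 0)),
        ((1, 8), (0, 10), (5, 10)), ((3, 9), (5, 10), (5, 5)), ((3, 9), (1, 8), (5, 5)),
        ((3, 4), (5, 5), (1, 8))]
  | mirrorRectangle =>
      [((-2, 6), (0, 5), (0, 10)), ((-4, 2), (-5, 0), (0, 0)), ((-2, 1), (0, 0), (0, 5)),
        ((-2, 1), (-4, 2), (0, 5)), ((-2, 6), (0, 5), (-4, 2)), ((-3, 4), (-5, 5), (-5, 0)),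
        ((-1, 8), (0, 10), (-5, 10)), ((-3, 9), (-5, 10), (-5, 5)), ((-3, 9), (-1, 8), (-5, 5)),
        ((-3, 4), (-5, 5), (-1, 8))]
  | kiteBlue | kiteRed =>
      [((2, 6), (0, 5), (0, 10)), ((4, 2), (5, 0), (0, 0)), ((2, 1), (0, 0), (0, 5)),
        ((2, 1), (4, 2), (0, 5)), ((2, 6), (0, 5), (4, 2)), ((2, 6), (4, 7), (0, 10)),
        ((4, 2), (5, 0), (8, 4)), ((6, 3), (8, 4), (4, 7)), ((6, 3), (4, 2), (4, 7)),
        ((2, 6), (4, 7), (4, 2))]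

end Kind

theorem frame_pt (a b c d e f i j : ℝ) : (⟨pt a b, pt c d, pt e f⟩ : Triangle).frame i j =
    pt (a + i / 5 * (c - a) + j / 10 * (e - a)) (b + i / 5 * (d - b) + j / 10 * (f - b)) := by
  apply Complex.ext <;> simp [Triangle.frame, pt] <;> ring

theorem Kind.mem_tiles {k : Kind} {t : Triangle} : t ∈ k.tiles ↔ ∃ τ ∈ k.tri,
    t = ⟨pt τ.1.1 τ.1.2, pt τ.2.1.1 τ.2.1.2, pt τ.2.2.1 τ.2.2.2⟩ := by
  cases k <;> simp only [Kind.tiles, Triangle.dissect, frame_pt, Kind.tri] <;> norm_num <;> tauto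

/-- The signed distance (times `5`) of `(x, y)` from the `i`-th side of a supertile. -/
def Kind.face (k : Kind) (i : Fin 6) (x y : ℝ) : ℝ :=
  ((k.cyc (i + 1)).1 - (k.cyc i).1) * (y - (k.cyc i).2) -
    ((k.cyc (i + 1)).2 - (k.cyc i).2) * (x - (k.cyc i).1)

open Triangle in
theorem pt_mem_region_std {ε : ℝ} (hε : ε = 1 ∨ ε = -1) {a b c d x y : ℝ}
    (h : c * c + d * d = 25) :
    pt x y ∈ (std ε (pt a b) (pt c d)).region ↔
      0 ≤ (x - a) * c + (y - b) * d ∧ 0 ≤ ε * ((y - b) * c - (x - a) * d) ∧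
      2 * ((x - a) * c + (y - b) * d) + ε * ((y - b) * c - (x - a) * d) ≤ 50 := by
  have h5 : √5 ≠ 0 := by positivity
  have hu : pt c d ≠ 0 := by
    intro h0
    have h1 := congrArg re h0
    have h2 := congrArg im h0
    simp [pt, h5] at h1 h2
    rw [h1, h2] at h; norm_num at h
  have e : pt x y = (std ε (pt a b) (pt c d)).frame (((x - a) * c + (y - b) * d) / 5)
      (ε * ((y - b) * c - (x - a) * d) / 5) := by
    rw [frame_std]
    apply Complex.ext <;> simp [pt] <;> field_simp <;> rcases hε with rfl | rfl
    · linear_combination (a - x) * h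
    · linear_combination (a - x) * h
    · linear_combination (b - y) * h
    · linear_combination (b - y) * h
  rw [e, frame_mem_region_std hε hu]
  constructor
  · rintro ⟨h1, h2, h3⟩; exact ⟨by linarith, by linarith, by linarith⟩
  · rintro ⟨h1, h2, h3⟩; exact ⟨by linarith, by linarith, by linarith⟩

open Triangle in
theorem biUnion_dissect_union (P Q : Triangle) :
    ⋃ t ∈ P.dissect ∪ Q.dissect, t.region = P.region ∪ Q.region := by
  rw [biUnion_union, ← region_eq_biUnion_dissect, ← region_eq_biUnion_dissect]

open Triangle in
theorem Kind.pt_mem_iUnion {k : Kind} {x y : ℝ} :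
    (pt x y ∈ ⋃ t ∈ k.tiles, t.region) ↔ ∀ i, 0 ≤ k.face i x y := by
  have e : ∀ a b c d e f : ℝ, ∀ ε : ℝ, e = a - 2 * ε * d → f = b + 2 * ε * c →
      (⟨pt a b, pt (a + c) (b + d), pt e f⟩ : Triangle) = std ε (pt a b) (pt c d) := by
    rintro a b c d e f ε rfl rfl
    simp only [std, Triangle.mk.injEq, true_and]
    constructor <;> apply Complex.ext <;> simp [pt] <;> ring
  cases k <;> simp only [Kind.tiles] <;> rw [biUnion_dissect_union, mem_union]
  · have e1 := e 0 0 5 0 0 10 1 (by norm_num) (by norm_num)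
    have e2 := e 5 10 (-5) 0 5 0 1 (by norm_num) (by norm_num)
    norm_num at e1 e2
    rw [e1, e2, pt_mem_region_std (by simp) (by norm_num),
      pt_mem_region_std (by simp) (by norm_num)]
    simp [Fin.forall_fin_succ, Kind.face, Kind.cyc]
    constructor
    · rintro (⟨h1, h2, h3⟩ | ⟨h1, h2, h3⟩) <;> refine ⟨?_, ?_, ?_, ?_, ?_, ?_⟩ <;> linarith
    · rintro ⟨h1, h2, h3, h4, h5, h6⟩
      -- The line 2x + y = 10 carries the common hypotenuse, so it decides which half contains the
      -- point.
      by_cases h : 2 * x + y ≤ 10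
      · left; refine ⟨?_, ?_, ?_⟩ <;> linarith
      · right; refine ⟨?_, ?_, ?_⟩ <;> linarith
  · have e1 := e 0 0 (-5) 0 0 10 (-1) (by norm_num) (by norm_num)
    have e2 := e (-5) 10 5 0 (-5) 0 (-1) (by norm_num) (by norm_num)
    norm_num at e1 e2
    rw [e1, e2, pt_mem_region_std (by simp) (by norm_num),
      pt_mem_region_std (by simp) (by norm_num)]
    simp [Fin.forall_fin_succ, Kind.face, Kind.cyc]
    constructor
    · rintro (⟨h1, h2, h3⟩ | ⟨h1, h2, h3⟩) <;> refine ⟨?_, ?_, ?_, ?_, ?_, ?_⟩ <;> linarith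
    · rintro ⟨h1, h2, h3, h4, h5, h6⟩
      by_cases h : -2 * x + y ≤ 10
      · left; refine ⟨?_, ?_, ?_⟩ <;> linarith
      · right; refine ⟨?_, ?_, ?_⟩ <;> linarith
  · have e1 := e 0 0 5 0 0 10 1 (by norm_num) (by norm_num)
    have e2 := e 8 4 (-3) (-4) 0 10 (-1) (by norm_num) (by norm_num)
    norm_num at e1 e2
    rw [e1, e2, pt_mem_region_std (by simp) (by norm_num),
      pt_mem_region_std (by simp) (by norm_num)]
    simp [Fin.forall_fin_succ, Kind.face, Kind.cyc]
    constructor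
    · rintro (⟨h1, h2, h3⟩ | ⟨h1, h2, h3⟩) <;> refine ⟨?_, ?_, ?_, ?_, ?_, ?_⟩ <;> linarith
    · rintro ⟨h1, h2, h3, h4, h5, h6⟩
      by_cases h : 2 * x + y ≤ 10
      · left; refine ⟨?_, ?_, ?_⟩ <;> linarith
      · right; refine ⟨?_, ?_, ?_⟩ <;> linarith
  · have e1 := e 0 0 5 0 0 10 1 (by norm_num) (by norm_num)
    have e2 := e 8 4 (-3) (-4) 0 10 (-1) (by norm_num) (by norm_num)
    norm_num at e1 e2
    rw [e1, e2, pt_mem_region_std (by simp) (by norm_num),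
      pt_mem_region_std (by simp) (by norm_num)]
    simp [Fin.forall_fin_succ, Kind.face, Kind.cyc]
    constructor
    · rintro (⟨h1, h2, h3⟩ | ⟨h1, h2, h3⟩) <;> refine ⟨?_, ?_, ?_, ?_, ?_, ?_⟩ <;> linarith
    · rintro ⟨h1, h2, h3, h4, h5, h6⟩
      by_cases h : 2 * x + y ≤ 10
      · left; refine ⟨?_, ?_, ?_⟩ <;> linarith
      · right; refine ⟨?_, ?_, ?_⟩ <;> linarith

end Pinwheel

namespace Pinwheel

open Complex Set

/-! ### Rigid motions applied to the standard supertiles -/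

namespace Supertile

variable (S : Supertile)

/-- The point of a supertile with given integer coordinates. -/
noncomputable def pos (p : ℤ × ℤ) : ℂ := S.place (pt p.1 p.2)

theorem place_lerp (z w : ℂ) (s : ℂ) :
    S.place (z + s * (w - z)) = S.place z + s * (S.place w - S.place z) := by
  simp only [place]; ring

theorem place_injective : Function.Injective S.place := by
  intro z w h
  simp only [place, add_left_inj] at h
  exact mul_left_cancel₀ S.u.coe_ne_zero h

theorem pt_injective {a b c d : ℝ} (h : pt a b = pt c d) : a = c ∧ b = d := by
  have h5 : √5 ≠ 0 := by positivity
  have h1 := congrArg re h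
  have h2 := congrArg im h
  simp only [pt] at h1 h2
  constructor
  · field_simp at h1; exact h1
  · field_simp at h2; exact h2

theorem pos_injective : Function.Injective S.pos := by
  intro p q h
  obtain ⟨h1, h2⟩ := pt_injective (S.place_injective h)
  exact Prod.ext (by exact_mod_cast h1) (by exact_mod_cast h2)

theorem exists_place_pt (z : ℂ) : ∃ x y : ℝ, z = S.place (pt x y) := by
  have h5 : √5 ≠ 0 := by positivity
  set w := (z - S.b) / S.u with hw
  refine ⟨√5 * w.re, √5 * w.im, ?_⟩
  have : pt (√5 * w.re) (√5 * w.im) = w := by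
    apply Complex.ext <;> simp [pt, h5]
  rw [this, place, hw]
  have := S.u.coe_ne_zero
  field_simp
  ring

theorem place_segment (z w : ℂ) : S.place '' segment ℝ z w = segment ℝ (S.place z) (S.place w) := by
  ext y
  simp only [mem_image, mem_segment_iff_exists]
  constructor
  · rintro ⟨_, ⟨s, h0, h1, rfl⟩, rfl⟩
    exact ⟨s, h0, h1, S.place_lerp _ _ _⟩
  · rintro ⟨s, h0, h1, rfl⟩
    exact ⟨_, ⟨s, h0, h1, rfl⟩, S.place_lerp _ _ _⟩

theorem region_map (t : Triangle) : (t.map S.place).region = S.place '' t.region := by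
  have hb : ∀ α β γ : ℝ, α + β + γ = 1 → ∀ p q r : ℂ, S.place (α * p + β * q + γ * r) =
      α * S.place p + β * S.place q + γ * S.place r := by
    intro α β γ h p q r
    have : (α : ℂ) = 1 - β - γ := by
      rw [← Complex.ofReal_one, ← h]; push_cast; ring
    simp only [place, this]; ring
  ext z
  simp only [mem_image, Triangle.mem_region, Triangle.map]
  constructor
  · rintro ⟨α, β, γ, h1, h2, h3, h4, rfl⟩
    exact ⟨_, ⟨α, β, γ, h1, h2, h3, h4, rfl⟩, hb _ _ _ h4 _ _ _⟩
  · rintro ⟨_, ⟨α, β, γ, h1, h2, h3, h4, rfl⟩, rfl⟩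
    exact ⟨α, β, γ, h1, h2, h3, h4, hb _ _ _ h4 _ _ _⟩

theorem mem_tiles {t : Triangle} : t ∈ S.tiles ↔
    ∃ τ ∈ S.kind.tri, t = ⟨S.pos τ.1, S.pos τ.2.1, S.pos τ.2.2⟩ := by
  simp only [tiles, mem_image, Kind.mem_tiles]
  constructor
  · rintro ⟨_, ⟨τ, hτ, rfl⟩, rfl⟩
    exact ⟨τ, hτ, rfl⟩
  · rintro ⟨τ, hτ, rfl⟩
    exact ⟨_, ⟨τ, hτ, rfl⟩, rfl⟩

theorem finite_tiles : S.tiles.Finite := by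
  refine ((List.finite_toSet S.kind.tri).image
    fun τ => (⟨S.pos τ.1, S.pos τ.2.1, S.pos τ.2.2⟩ : Triangle)).subset ?_
  intro t ht
  obtain ⟨τ, hτ, rfl⟩ := S.mem_tiles.1 ht
  exact ⟨τ, hτ, rfl⟩

theorem region_eq_image : S.region = S.place '' ⋃ t ∈ S.kind.tiles, t.region := by
  simp only [region, tiles, biUnion_image, region_map, image_iUnion]

theorem mem_region_iff {x y : ℝ} :
    S.place (pt x y) ∈ S.region ↔ ∀ i, 0 ≤ S.kind.face i x y := by
  rw [region_eq_image, S.place_injective.mem_set_image, Kind.pt_mem_iUnion]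

theorem isCompact_region : IsCompact S.region :=
  S.finite_tiles.isCompact_biUnion fun t _ => t.isCompact_region

theorem isClosed_region : IsClosed S.region := S.isCompact_region.isClosed

end Supertile

theorem Kind.cyc_ne (k : Kind) (i : Fin 6) : k.cyc (i + 1) ≠ k.cyc i := by
  revert i; cases k <;> decide

namespace Supertile

variable (S : Supertile)

theorem mem_interior_iff {x y : ℝ} :
    S.place (pt x y) ∈ interior S.region ↔ ∀ i, 0 < S.kind.face i x y := by
  set k := S.kind with hk
  set A : Fin 6 → ℝ := fun i => (k.cyc (i + 1)).1 - (k.cyc i).1 with hA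
  set B : Fin 6 → ℝ := fun i => (k.cyc (i + 1)).2 - (k.cyc i).2 with hB
  -- The cross product A y - B x is the real part of -i (A - B i)(x + y i). Undoing the rotation and
  -- the scaling by `√5` makes each `face` an affine function of the point in the plane, so the
  -- supertile is an intersection of six half-planes.
  set α : Fin 6 → ℂ := fun i => -I * (A i - B i * I) * √5 / S.u with hα
  set c : Fin 6 → ℝ := fun i =>
    -(α i * S.b).re - (A i * (k.cyc i).2 - B i * (k.cyc i).1) with hc
  have h5 : √5 ≠ 0 := by positivity
  have hu := S.u.coe_ne_zero
  have hα0 : ∀ i, α i ≠ 0 := by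
    intro i
    refine div_ne_zero (mul_ne_zero (mul_ne_zero (neg_ne_zero.2 I_ne_zero) ?_)
      (by exact_mod_cast h5)) hu
    intro h0
    have h1 := congrArg re h0
    have h2 := congrArg im h0
    simp [hA, hB] at h1 h2
    refine k.cyc_ne i (Prod.ext ?_ ?_)
    · have : ((k.cyc (i + 1)).1 : ℝ) = (k.cyc i).1 := by linarith
      exact_mod_cast this
    · have : ((k.cyc (i + 1)).2 : ℝ) = (k.cyc i).2 := by linarith
      exact_mod_cast this
  have key : ∀ i x y, k.face i x y = (α i * S.place (pt x y)).re + c i := by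
    intro i x y
    have e1 : α i * S.place (pt x y) = α i * S.b + (-I * (A i - B i * I)) * (√5 * pt x y) := by
      simp only [hα, place]; field_simp; ring
    have e2 : (√5 : ℂ) * pt x y = x + y * I := by
      apply Complex.ext <;> simp [pt] <;> field_simp
    simp only [hc]
    rw [e1, e2, Kind.face]
    simp [hA, hB]; ring
  have hreg : S.region = ⋂ i, {z : ℂ | 0 ≤ (α i * z).re + c i} := by
    ext z
    obtain ⟨x, y, rfl⟩ := S.exists_place_pt z
    rw [mem_region_iff, mem_iInter]
    simp only [mem_ofPred_eq, ← key, hk]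
  rw [hreg, interior_iInter_of_finite, mem_iInter]
  simp only [interior_halfPlane (hα0 _), mem_ofPred_eq, key]

theorem mem_segment_of_face_eq_zero {x y : ℝ} {i : Fin 6} (h : S.kind.face i x y = 0)
    (h1 : 0 ≤ ((S.kind.cyc (i + 1)).1 - (S.kind.cyc i).1) * (x - (S.kind.cyc i).1) +
      ((S.kind.cyc (i + 1)).2 - (S.kind.cyc i).2) * (y - (S.kind.cyc i).2))
    (h2 : ((S.kind.cyc (i + 1)).1 - (S.kind.cyc i).1) * (x - (S.kind.cyc i).1) +
      ((S.kind.cyc (i + 1)).2 - (S.kind.cyc i).2) * (y - (S.kind.cyc i).2) ≤ 25) :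
    S.place (pt x y) ∈ segment ℝ (S.pos (S.kind.cyc i)) (S.pos (S.kind.cyc (i + 1))) := by
  have h25 : ((S.kind.cyc (i + 1)).1 - (S.kind.cyc i).1) ^ 2 +
      ((S.kind.cyc (i + 1)).2 - (S.kind.cyc i).2) ^ 2 = (25 : ℤ) := by
    clear h h1 h2
    revert i; cases S.kind <;> decide
  have h25' : (((S.kind.cyc (i + 1)).1 : ℝ) - (S.kind.cyc i).1) ^ 2 +
      (((S.kind.cyc (i + 1)).2 : ℝ) - (S.kind.cyc i).2) ^ 2 = 25 := by exact_mod_cast h25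
  unfold Kind.face at h
  set A : ℝ := ((S.kind.cyc (i + 1)).1 : ℝ)
  set B : ℝ := ((S.kind.cyc (i + 1)).2 : ℝ)
  set p : ℝ := ((S.kind.cyc i).1 : ℝ)
  set q : ℝ := ((S.kind.cyc i).2 : ℝ)
  refine mem_segment_iff_exists.2
    ⟨((A - p) * (x - p) + (B - q) * (y - q)) / 25, by linarith, by linarith, ?_⟩
  unfold pos
  rw [← place_lerp]
  congr 1
  have h5 : √5 ≠ 0 := by positivity
  apply Complex.ext
  · simp [pt]
    field_simp
    linear_combination (p - x) * h25' - (B - q) * h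
  · simp [pt]
    field_simp
    linear_combination (q - y) * h25' + (A - p) * h

set_option maxHeartbeats 4000000 in
theorem mem_interior_or_mem_segment {z : ℂ} (hz : z ∈ S.region) : z ∈ interior S.region ∨
    ∃ i, z ∈ segment ℝ (S.pos (S.kind.cyc i)) (S.pos (S.kind.cyc (i + 1))) := by
  obtain ⟨x, y, rfl⟩ := S.exists_place_pt z
  rw [mem_region_iff] at hz
  rw [mem_interior_iff]
  by_contra! h
  obtain ⟨⟨i, hi⟩, hs⟩ := h
  have hi0 := le_antisymm hi (hz i)
  have key : ∀ j, S.kind.face j x y = 0 → _ → _ → False := fun j a b c =>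
    hs j (S.mem_segment_of_face_eq_zero a b c)
  clear hs hi
  generalize S.kind = k at *
  have hz0 := hz 0
  have hz1 := hz 1
  have hz2 := hz 2
  have hz3 := hz 3
  have hz4 := hz 4
  have hz5 := hz 5
  have key0 := key 0
  have key1 := key 1
  have key2 := key 2
  have key3 := key 3
  have key4 := key 4
  have key5 := key 5
  clear hz key
  -- A straight boundary line of length 10 consists of two sides. The line y = 5 separates the two
  -- sides on the vertical lines; 3y = 4x + 5 is the perpendicular through (4,7) that separates
  -- those on the slanted edge of a kite.
  cases k <;> fin_cases i <;>
    simp [Kind.face, Kind.cyc] at hi0 hz0 hz1 hz2 hz3 hz4 hz5 key0 key1 key2 key3 key4 key5 <;>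
    norm_num at hi0 key0 key1 key2 key3 key4 key5 <;> rcases le_total y 5 with h | h <;> rcases le_total (3 * y) (4 * x + 5) with h' | h' <;>
        first
        | linarith [key0 (by linarith) (by linarith)]
        | linarith [key1 (by linarith) (by linarith)]
        | linarith [key2 (by linarith) (by linarith)]
        | linarith [key3 (by linarith) (by linarith)]
        | linarith [key4 (by linarith) (by linarith)]
        | linarith [key5 (by linarith) (by linarith)]

end Supertile

end Pinwheel

namespace Pinwheel

open Complex Set

/-! ## Incidences in integer coordinates -/

/-- The integer point `p` lies on the segment from `x` to `y`. -/
def OnSeg (x y p : ℤ × ℤ) : Prop :=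
  (y.1 - x.1) * (p.2 - x.2) - (y.2 - x.2) * (p.1 - x.1) = 0 ∧
    (p.1 - x.1) * (p.1 - y.1) + (p.2 - x.2) * (p.2 - y.2) ≤ 0

/-- The integer point `p` lies on the segment from `x` to `y` and is not an endpoint. -/
def Between (x y p : ℤ × ℤ) : Prop :=
  (y.1 - x.1) * (p.2 - x.2) - (y.2 - x.2) * (p.1 - x.1) = 0 ∧
    (p.1 - x.1) * (p.1 - y.1) + (p.2 - x.2) * (p.2 - y.2) < 0

instance (x y p : ℤ × ℤ) : Decidable (OnSeg x y p) := inferInstanceAs (Decidable (_ ∧ _))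

instance (x y p : ℤ × ℤ) : Decidable (Between x y p) := inferInstanceAs (Decidable (_ ∧ _))

namespace Kind

/-- All vertices of a supertile. -/
def verts (k : Kind) : List (ℤ × ℤ) := List.ofFn k.cyc ++ k.inn

/-- The directed edges of a supertile: internal edges in both directions, external ones
anticlockwise. -/
def out (k : Kind) : List ((ℤ × ℤ) × (ℤ × ℤ) × ℕ) :=
  (List.ofFn fun i => (k.cyc i, k.cyc (i + 1), 3)) ++
    (k.intEdges ++ k.intEdges.map fun e => (e.2.1, e.1, e.2.2))

/-- The sides of the tiles of a supertile. -/
def sides (k : Kind) : List ((ℤ × ℤ) × (ℤ × ℤ)) :=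
  k.tri.flatMap fun τ => [(τ.1, τ.2.1), (τ.1, τ.2.2), (τ.2.1, τ.2.2)]

/-- The function `face` on integer points scaled by `n`. -/
def faceInt (k : Kind) (n : ℤ) (i : Fin 6) (p : ℤ × ℤ) : ℤ :=
  ((k.cyc (i + 1)).1 - (k.cyc i).1) * (p.2 - n * (k.cyc i).2) -
    ((k.cyc (i + 1)).2 - (k.cyc i).2) * (p.1 - n * (k.cyc i).1)

theorem tri_subset (k : Kind) : ∀ τ ∈ k.tri, τ.1 ∈ k.verts ∧ τ.2.1 ∈ k.verts ∧ τ.2.2 ∈ k.verts := by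
  cases k <;> decide +kernel

theorem exists_tri (k : Kind) : ∀ p ∈ k.verts, ∃ τ ∈ k.tri, τ.1 = p ∨ τ.2.1 = p ∨ τ.2.2 = p := by
  cases k <;> decide +kernel

/-- With `out_spec`, this makes `out` exactly the list of edges that run along the sides of the
tiles: consecutive vertices on a side form a listed edge, and listed edges have no vertex between
their ends. -/
theorem exists_out_of_sides (k : Kind) : ∀ s ∈ k.sides, ∀ p ∈ k.verts, OnSeg s.1 s.2 p →
    ∀ q ∈ k.verts, OnSeg s.1 s.2 q → p ≠ q → (∀ r ∈ k.verts, ¬ Between p q r) →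
    ∃ e ∈ k.out, (e.1 = p ∧ e.2.1 = q) ∨ (e.1 = q ∧ e.2.1 = p) := by
  cases k <;> decide +kernel

theorem out_spec (k : Kind) : ∀ e ∈ k.out, e.1 ≠ e.2.1 ∧ e.1 ∈ k.verts ∧ e.2.1 ∈ k.verts ∧
    (∃ s ∈ k.sides, OnSeg s.1 s.2 e.1 ∧ OnSeg s.1 s.2 e.2.1) ∧
    ∀ r ∈ k.verts, ¬ Between e.1 e.2.1 r := by
  cases k <;> decide +kernel

theorem out_unique (k : Kind) : ∀ e ∈ k.out, ∀ e' ∈ k.out, e.1 = e'.1 → e.2.1 = e'.2.1 → e = e' := by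
  cases k <;> decide +kernel

/-- The midpoint of an internal edge, doubled to stay integral, is strictly inside. One interior
point is enough to identify the supertile of an internal edge. -/
theorem intEdges_pos (k : Kind) : ∀ e ∈ k.intEdges, ∀ i,
    0 < k.faceInt 2 i (e.1.1 + e.2.1.1, e.1.2 + e.2.1.2) := by
  cases k <;> decide +kernel

theorem inn_pos (k : Kind) : ∀ p ∈ k.inn, ∀ i, 0 < k.faceInt 1 i p := by
  cases k <;> decide +kernel

/-- The point is the midpoint of a side moved to the left by a tenth of the side, in coordinates
scaled by 20. Hence the supertile lies to the left of its sides, and two supertiles with the same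
directed side overlap. -/
theorem flank_pos (k : Kind) : ∀ i j, 0 < k.faceInt 20 j
    (10 * ((k.cyc i).1 + (k.cyc (i + 1)).1) - 2 * ((k.cyc (i + 1)).2 - (k.cyc i).2),
      10 * ((k.cyc i).2 + (k.cyc (i + 1)).2) + 2 * ((k.cyc (i + 1)).1 - (k.cyc i).1)) := by
  cases k <;> decide +kernel

theorem face_eq_faceInt (k : Kind) {n : ℤ} (hn : 0 < n) (i : Fin 6) (p : ℤ × ℤ) :
    k.face i (p.1 / n) (p.2 / n) = k.faceInt n i p / n := by
  have : (n : ℝ) ≠ 0 := by exact_mod_cast hn.ne'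
  simp only [face, faceInt]; push_cast; field_simp

theorem face_nonneg (k : Kind) : ∀ p ∈ k.verts, ∀ i, 0 ≤ k.faceInt 1 i p := by
  cases k <;> decide +kernel

theorem sides_verts (k : Kind) : ∀ s ∈ k.sides, s.1 ∈ k.verts ∧ s.2 ∈ k.verts := by
  cases k <;> decide +kernel

theorem cyc_injective (k : Kind) : Function.Injective k.cyc := by
  cases k <;> decide +kernel

end Kind

namespace Supertile

variable (S : Supertile)

theorem pos_sub (p q : ℤ × ℤ) :
    S.pos p - S.pos q = S.u * (((p.1 - q.1 : ℤ) : ℂ) + ((p.2 - q.2 : ℤ) : ℂ) * I) / √5 := by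
  have h5 : (√5 : ℂ) ≠ 0 := by exact_mod_cast (by positivity : √5 ≠ 0)
  have : ∀ a b : ℝ, pt a b = (a + b * I) / √5 := by
    intro a b; apply Complex.ext <;> simp [pt]
  simp only [pos, place, this]; push_cast; field_simp; ring

/-- The rotation cancels against its conjugate and the unit `1 / √5` enters squared, so dot and
cross products in the plane are those of the integer coordinates over 5. -/
theorem conj_pos_sub (p q r t : ℤ × ℤ) :
    (starRingEnd ℂ) (S.pos p - S.pos q) * (S.pos r - S.pos t) =
      (((p.1 - q.1) * (r.1 - t.1) + (p.2 - q.2) * (r.2 - t.2) : ℤ) / 5 : ℝ) +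
      (((p.1 - q.1) * (r.2 - t.2) - (p.2 - q.2) * (r.1 - t.1) : ℤ) / 5 : ℝ) * I := by
  have h5 : (√5 : ℂ) * √5 = 5 := by
    rw [← ofReal_mul, Real.mul_self_sqrt (by norm_num)]; norm_num
  have h5' : (√5 : ℂ) ≠ 0 := by exact_mod_cast (by positivity : √5 ≠ 0)
  have hu : (starRingEnd ℂ) (S.u : ℂ) * S.u = 1 := by
    rw [← normSq_eq_conj_mul_self, Circle.normSq_coe]; norm_num
  rw [pos_sub, pos_sub]
  simp only [map_div₀, map_mul, map_add, map_intCast, conj_I, conj_ofReal]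
  have e : ∀ z w : ℂ, (starRingEnd ℂ) (S.u : ℂ) * z / √5 * (S.u * w / √5) =
      ((starRingEnd ℂ) (S.u : ℂ) * S.u) * (z * w) / (√5 * √5) := by
    intro z w; field_simp
  rw [e, hu, h5]
  push_cast
  linear_combination (-((p.2 : ℂ) - q.2) * (r.2 - t.2) / 5) * I_sq

theorem pos_mem_segment {x y p : ℤ × ℤ} :
    S.pos p ∈ segment ℝ (S.pos x) (S.pos y) ↔ OnSeg x y p := by
  rw [mem_segment_iff, conj_pos_sub, conj_pos_sub, OnSeg]
  simp only [add_re, add_im, ofReal_re, ofReal_im, mul_re, mul_im, I_re, I_im]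
  refine and_congr ?_ ?_
  · rw [← Int.cast_inj (α := ℝ)]; push_cast
    constructor <;> intro h <;> linarith
  · rw [← Int.cast_le (R := ℝ)]; push_cast
    constructor <;> intro h <;> linarith

theorem pos_mem_openSegment {x y p : ℤ × ℤ} (hxy : x ≠ y) :
    S.pos p ∈ openSegment ℝ (S.pos x) (S.pos y) ↔ Between x y p := by
  rw [mem_openSegment_iff (fun h => hxy (S.pos_injective h)), conj_pos_sub, conj_pos_sub, Between]
  simp only [add_re, add_im, ofReal_re, ofReal_im, mul_re, mul_im, I_re, I_im]
  refine and_congr ?_ ?_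
  · rw [← Int.cast_inj (α := ℝ)]; push_cast
    constructor <;> intro h <;> linarith
  · rw [← Int.cast_lt (R := ℝ)]; push_cast
    constructor <;> intro h <;> linarith

theorem mem_interior_of_faceInt {n : ℤ} (hn : 0 < n) {p : ℤ × ℤ}
    (h : ∀ i, 0 < S.kind.faceInt n i p) :
    S.place (pt (p.1 / n) (p.2 / n)) ∈ interior S.region := by
  rw [mem_interior_iff]
  intro i
  rw [Kind.face_eq_faceInt _ hn]
  have h1 : (0 : ℝ) < S.kind.faceInt n i p := by exact_mod_cast h i
  have h2 : (0 : ℝ) < n := by exact_mod_cast hn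
  positivity

theorem pos_mem_region {p : ℤ × ℤ} (hp : p ∈ S.kind.verts) : S.pos p ∈ S.region := by
  rw [pos, mem_region_iff]
  intro i
  have := S.kind.face_eq_faceInt one_pos i p
  simp only [Int.cast_one, div_one] at this
  rw [this]
  exact_mod_cast S.kind.face_nonneg p hp i

theorem pos_mem_interior {p : ℤ × ℤ} (hp : p ∈ S.kind.inn) : S.pos p ∈ interior S.region := by
  simpa [pos] using S.mem_interior_of_faceInt one_pos (S.kind.inn_pos p hp)

theorem convex_region : Convex ℝ S.region := by
  have : S.region = S.place '' {z | ∀ i, 0 ≤ S.kind.face i (√5 * z.re) (√5 * z.im)} := by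
    ext z
    obtain ⟨x, y, rfl⟩ := S.exists_place_pt z
    have h5 : √5 ≠ 0 := by positivity
    rw [mem_region_iff, S.place_injective.mem_set_image]
    simp only [mem_ofPred_eq, pt]
    field_simp
  rw [this, convex_iff_segment_subset]
  rintro _ ⟨z, hz, rfl⟩ _ ⟨w, hw, rfl⟩
  rw [← place_segment]
  refine image_mono ?_
  intro y hy
  obtain ⟨s, h0, h1, rfl⟩ := mem_segment_iff_exists.1 hy
  intro i
  have e : S.kind.face i (√5 * (z + s * (w - z)).re) (√5 * (z + s * (w - z)).im) =
      (1 - s) * S.kind.face i (√5 * z.re) (√5 * z.im) +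
        s * S.kind.face i (√5 * w.re) (√5 * w.im) := by
    simp [Kind.face]; ring
  rw [e]
  have := hz i
  have := hw i
  have : 0 ≤ 1 - s := by linarith
  positivity

theorem mid_mem_interior {e : (ℤ × ℤ) × (ℤ × ℤ) × ℕ} (he : e ∈ S.kind.intEdges) :
    (S.pos e.1 + S.pos e.2.1) / 2 ∈ interior S.region := by
  have := S.mem_interior_of_faceInt two_pos (S.kind.intEdges_pos e he)
  convert this using 1
  have : pt (((e.1.1 + e.2.1.1, e.1.2 + e.2.1.2) : ℤ × ℤ).1 / (2 : ℤ))
      (((e.1.1 + e.2.1.1, e.1.2 + e.2.1.2) : ℤ × ℤ).2 / (2 : ℤ)) =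
      (pt e.1.1 e.1.2 + pt e.2.1.1 e.2.1.2) / 2 := by
    apply Complex.ext <;> simp [pt] <;> ring
  rw [this]
  simp only [pos, place]; ring

theorem flank_mem_interior (i : Fin 6) :
    (S.pos (S.kind.cyc i) + S.pos (S.kind.cyc (i + 1))) / 2 +
      I / 10 * (S.pos (S.kind.cyc (i + 1)) - S.pos (S.kind.cyc i)) ∈ interior S.region := by
  have := S.mem_interior_of_faceInt (by norm_num : (0 : ℤ) < 20) (S.kind.flank_pos i)
  convert this using 1
  set p := S.kind.cyc i
  set q := S.kind.cyc (i + 1)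
  have : pt (((10 * (p.1 + q.1) - 2 * (q.2 - p.2), 10 * (p.2 + q.2) + 2 * (q.1 - p.1)) :
        ℤ × ℤ).1 / (20 : ℤ))
      (((10 * (p.1 + q.1) - 2 * (q.2 - p.2), 10 * (p.2 + q.2) + 2 * (q.1 - p.1)) :
        ℤ × ℤ).2 / (20 : ℤ)) =
      (pt p.1 p.2 + pt q.1 q.2) / 2 + I / 10 * (pt q.1 q.2 - pt p.1 p.2) := by
    apply Complex.ext <;> simp [pt] <;> ring
  rw [this]
  simp only [pos, place]; ring

theorem segment_cyc_subset_frontier (i : Fin 6) :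
    segment ℝ (S.pos (S.kind.cyc i)) (S.pos (S.kind.cyc (i + 1))) ⊆ frontier S.region := by
  have hv : ∀ j, S.kind.cyc j ∈ S.kind.verts := fun j =>
    List.mem_append_left _ (List.mem_ofFn.2 ⟨j, rfl⟩)
  intro z hz
  rw [S.isClosed_region.frontier_eq]
  refine ⟨S.convex_region.segment_subset (S.pos_mem_region (hv _)) (S.pos_mem_region (hv _)) hz, ?_⟩
  simp only [pos] at hz
  rw [← place_segment] at hz
  obtain ⟨_, hz, rfl⟩ := hz
  obtain ⟨s, h0, h1, rfl⟩ := mem_segment_iff_exists.1 hz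
  set p := S.kind.cyc i with hp
  set q := S.kind.cyc (i + 1) with hq
  have : (pt p.1 p.2 + s * (pt q.1 q.2 - pt p.1 p.2)) =
      pt (p.1 + s * (q.1 - p.1)) (p.2 + s * (q.2 - p.2)) := by
    apply Complex.ext <;> simp [pt] <;> ring
  rw [this, mem_interior_iff]
  intro h
  have := h i
  rw [Kind.face, ← hp, ← hq] at this
  ring_nf at this
  exact lt_irrefl _ this

theorem mem_blue {z : ℂ} : z ∈ S.blue ↔ ∃ i : Fin 6, i.val % 2 = 0 ∧ z = S.pos (S.kind.cyc i) := by
  simp only [blue, pos]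
  cases S.kind <;> simp [Kind.blue, Kind.cyc, Fin.exists_fin_succ, eq_comm] <;> tauto

theorem mem_red {z : ℂ} : z ∈ S.red ↔ ∃ i : Fin 6, i.val % 2 = 1 ∧ z = S.pos (S.kind.cyc i) := by
  simp only [red, pos]
  cases S.kind <;> simp [Kind.red, Kind.cyc, Fin.exists_fin_succ, eq_comm] <;> tauto

end Supertile

end Pinwheel

namespace Pinwheel

open Complex Set

/-! ## The graph of a tiling with a coloured partition -/

/-- A tiling by pinwheel triangles of size `1` together with a coloured partition. -/
structure IsPartitioned (T : Set Triangle) (D : Set Supertile) : Prop where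
  isTiling : IsTriangleTiling T
  isTile : ∀ t ∈ T, t.IsPinwheel 1
  isPartition : IsColouredPartition T D

theorem IsTriangleTiling.isPacking {T : Set Triangle} (hT : IsTriangleTiling T)
    (h : ∀ t ∈ T, t.IsPinwheel 1) : IsPacking 1 T :=
  ⟨one_pos, h, hT.disjoint⟩

theorem IsTriangleTiling.exists_mem_region {T : Set Triangle} (hT : IsTriangleTiling T) (z : ℂ) :
    ∃ t ∈ T, z ∈ t.region := by
  have := hT.cover.symm ▸ mem_univ z
  simpa using this

namespace Triangle

theorem corner_ne_of_isPinwheel {s : ℝ} (hs : 0 < s) {t : Triangle} (h : t.IsPinwheel s) :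
    t.a ≠ t.b ∧ t.a ≠ t.c ∧ t.b ≠ t.c := by
  have h5 : 0 < √5 := by positivity
  refine ⟨?_, ?_, ?_⟩ <;> intro e
  · have := h.1; rw [e, dist_self] at this; linarith
  · have := h.2.1; rw [e, dist_self] at this; linarith
  · have := h.2.2; rw [e, dist_self] at this; nlinarith

/-- The frontier of a triangle consists of its sides. -/
theorem IsPinwheel.frontier_subset {s : ℝ} (hs : 0 < s) {t : Triangle} (h : t.IsPinwheel s) :
    frontier t.region ⊆ segment ℝ t.b t.c ∪ (segment ℝ t.a t.b ∪ segment ℝ t.a t.c) := by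
  rw [t.isClosed_region.frontier_eq]
  rintro z ⟨hz, hz'⟩
  have hm : t.frame 0 5 ∈ segment ℝ t.a t.c := by
    rw [← frame_a, ← frame_c]
    exact mem_segment_iff_exists.2 ⟨1 / 2, by norm_num, by norm_num, by
      rw [frame_lerp]; norm_num⟩
  rcases h.mem_interior_or_mem_segment hs hz with h1 | h1 | h1 | h1 | h1
  · exact absurd h1 hz'
  · exact Or.inl h1
  · exact Or.inr (Or.inl h1)
  · exact Or.inr (Or.inr ((convex_segment _ _).segment_subset (left_mem_segment ℝ _ _) hm h1))
  · exact Or.inr (Or.inr ((convex_segment _ _).segment_subset hm (right_mem_segment ℝ _ _) h1))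

end Triangle

namespace IsPartitioned

variable {T : Set Triangle} {D : Set Supertile} (h : IsPartitioned T D)
include h

theorem isPacking : IsPacking 1 T := h.isTiling.isPacking h.isTile

theorem exists_mem (z : ℂ) : ∃ S ∈ D, z ∈ S.region := by
  obtain ⟨t, ht, hz⟩ := h.isTiling.exists_mem_region z
  obtain ⟨S, ⟨hS, htS⟩, -⟩ := h.isPartition.existsUnique t ht
  exact ⟨S, hS, mem_iUnion₂.2 ⟨t, htS, hz⟩⟩

/-- An interior point of a tile of `S'` can be found inside `S`; the tile there is then common to
both supertiles, and a tile has only one supertile. -/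
theorem eq_of_mem_interior {S S' : Supertile} (hS : S ∈ D) (hS' : S' ∈ D) {z : ℂ}
    (hz : z ∈ interior S.region) (hz' : z ∈ S'.region) : S = S' := by
  obtain ⟨t', ht', hzt'⟩ := mem_iUnion₂.1 hz'
  have hT' := h.isPartition.subset S' hS' ht'
  obtain ⟨y, hy, hyt'⟩ :=
    (h.isTile t' hT').exists_mem_interior one_pos hzt' isOpen_interior hz
  obtain ⟨t, ht, hyt⟩ := mem_iUnion₂.1 (interior_subset hy)
  have hT := h.isPartition.subset S hS ht
  have := h.isPacking.eq_of_mem_interior_of_mem hT' hT hyt' hyt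
  subst this
  exact (h.isPartition.existsUnique _ hT).unique ⟨hS, ht⟩ ⟨hS', ht'⟩

theorem finite_near (z : ℂ) (r : ℝ) :
    {S ∈ D | (S.region ∩ Metric.closedBall z r).Nonempty}.Finite := by
  have hex : ∀ S ∈ {S ∈ D | (S.region ∩ Metric.closedBall z r).Nonempty}, ∃ t : Triangle,
      t ∈ S.tiles ∧ t ∈ {t ∈ T | (t.region ∩ Metric.closedBall z r).Nonempty} := by
    rintro S ⟨hS, y, hy, hy'⟩
    obtain ⟨t, ht, hyt⟩ := mem_iUnion₂.1 hy
    exact ⟨t, ht, h.isPartition.subset S hS ht, y, hyt, hy'⟩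
  have : Nonempty Triangle := ⟨⟨0, 0, 0⟩⟩
  choose! f hf using hex
  refine Set.Finite.of_finite_image
    (((h.isPacking.finite_near z r).subset ?_) : (f '' _).Finite) ?_
  · rintro _ ⟨S, hS, rfl⟩
    exact (hf S hS).2
  · intro S hS S' hS' e
    exact (h.isPartition.existsUnique _ (hf S hS).2.1).unique ⟨hS.1, (hf S hS).1⟩
      ⟨hS'.1, e ▸ (hf S' hS').1⟩

/-- Only finitely many supertiles come near `z`, so the others among them form a closed set. If that
set missed `z`, a neighbourhood of `z` would be covered by `S` alone. -/
theorem exists_ne_of_mem_frontier {S : Supertile} {z : ℂ}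
    (hz : z ∈ frontier S.region) : ∃ S' ∈ D, S' ≠ S ∧ z ∈ S'.region := by
  by_contra! hcon
  set A := {S' ∈ D | (S'.region ∩ Metric.closedBall z 1).Nonempty} \ {S} with hA
  have hfin : A.Finite := (h.finite_near z 1).subset sdiff_subset
  have hcl : IsClosed (⋃ S' ∈ A, S'.region) := hfin.isClosed_biUnion fun S' _ => S'.isClosed_region
  have hz1 : z ∈ (⋃ S' ∈ A, S'.region)ᶜ := by
    intro hmem
    obtain ⟨S', hS', hzS'⟩ := mem_iUnion₂.1 hmem
    exact hcon S' hS'.1.1 hS'.2 hzS'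
  have hsub : (⋃ S' ∈ A, S'.region)ᶜ ∩ Metric.ball z 1 ⊆ S.region := by
    rintro y ⟨hy, hy1⟩
    obtain ⟨S', hS', hyS'⟩ := h.exists_mem y
    by_cases e : S' = S
    · exact e ▸ hyS'
    · exact absurd (mem_iUnion₂.2 ⟨S', ⟨⟨hS', y, hyS', Metric.ball_subset_closedBall hy1⟩, e⟩,
        hyS'⟩) hy
  exact hz.2 (interior_maximal hsub (hcl.isOpen_compl.inter Metric.isOpen_ball)
    ⟨hz1, Metric.mem_ball_self one_pos⟩)

theorem pos_mem_vertices {S : Supertile} (hS : S ∈ D) {p : ℤ × ℤ} (hp : p ∈ S.kind.verts) :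
    S.pos p ∈ vertices T := by
  obtain ⟨τ, hτ, hpτ⟩ := S.kind.exists_tri p hp
  refine mem_iUnion₂.2 ⟨_, h.isPartition.subset S hS (S.mem_tiles.2 ⟨τ, hτ, rfl⟩), ?_⟩
  simp only [Triangle.corners, mem_insert_iff, mem_singleton_iff]
  rcases hpτ with rfl | rfl | rfl <;> simp

theorem cyc_fits {S S' : Supertile} (hS : S ∈ D) (hS' : S' ∈ D) {i : Fin 6}
    (hi : S'.pos (S'.kind.cyc i) ∈ S.region) :
    ∃ j : Fin 6, j.val % 2 = i.val % 2 ∧ S'.pos (S'.kind.cyc i) = S.pos (S.kind.cyc j) := by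
  rcases Nat.mod_two_eq_zero_or_one i.val with hi2 | hi2
  · have := h.isPartition.blue_fits S' hS' S hS _ (S'.mem_blue.2 ⟨i, hi2, rfl⟩) hi
    obtain ⟨j, hj, e⟩ := S.mem_blue.1 this
    exact ⟨j, by rw [hj, hi2], e⟩
  · have := h.isPartition.red_fits S' hS' S hS _ (S'.mem_red.2 ⟨i, hi2, rfl⟩) hi
    obtain ⟨j, hj, e⟩ := S.mem_red.1 this
    exact ⟨j, by rw [hj, hi2], e⟩

/-- A vertex of the graph is a vertex of some supertile. If it is external there, the fitting
conditions make it external to `S`; if internal, it is an interior point and that supertile is `S`.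
This excludes vertices in the middle of a listed edge. -/
theorem exists_pos_eq {S : Supertile} (hS : S ∈ D) {v : ℂ} (hv : v ∈ vertices T)
    (hvS : v ∈ S.region) : ∃ p ∈ S.kind.verts, v = S.pos p := by
  obtain ⟨t, ht, hvt⟩ := mem_iUnion₂.1 hv
  obtain ⟨S', ⟨hS', htS'⟩, -⟩ := h.isPartition.existsUnique t ht
  have hvS' : ∃ p ∈ S'.kind.verts, v = S'.pos p := by
    obtain ⟨τ, hτ, rfl⟩ := S'.mem_tiles.1 htS'
    obtain ⟨h1, h2, h3⟩ := S'.kind.tri_subset τ hτ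
    simp only [Triangle.corners, mem_insert_iff, mem_singleton_iff] at hvt
    rcases hvt with rfl | rfl | rfl
    exacts [⟨_, h1, rfl⟩, ⟨_, h2, rfl⟩, ⟨_, h3, rfl⟩]
  obtain ⟨p, hp, rfl⟩ := hvS'
  rcases List.mem_append.1 hp with hp' | hp'
  · obtain ⟨i, rfl⟩ := List.mem_ofFn.1 hp'
    obtain ⟨j, -, e⟩ := h.cyc_fits hS hS' hvS
    exact ⟨_, List.mem_append_left _ (List.mem_ofFn.2 ⟨j, rfl⟩), e⟩
  · have := h.eq_of_mem_interior hS' hS (S'.pos_mem_interior hp') hvS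
    subst this
    exact ⟨p, hp, rfl⟩

/-- The union of the sides of the tiles of a supertile contains the frontiers of the tiles. -/
theorem exists_side_of_mem_frontier {S : Supertile} (hS : S ∈ D) {t : Triangle} (ht : t ∈ S.tiles)
    {z : ℂ} (hz : z ∈ frontier t.region) :
    ∃ s ∈ S.kind.sides, z ∈ segment ℝ (S.pos s.1) (S.pos s.2) := by
  have hzs := (h.isTile t (h.isPartition.subset S hS ht)).frontier_subset one_pos hz
  obtain ⟨τ, hτ, rfl⟩ := S.mem_tiles.1 ht
  have hmem : ∀ s ∈ [(τ.1, τ.2.1), (τ.1, τ.2.2), (τ.2.1, τ.2.2)], s ∈ S.kind.sides :=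
    fun s hs => List.mem_flatMap.2 ⟨τ, hτ, hs⟩
  rcases hzs with h1 | h1 | h1
  · exact ⟨(τ.2.1, τ.2.2), hmem _ (by simp), h1⟩
  · exact ⟨(τ.1, τ.2.1), hmem _ (by simp), h1⟩
  · exact ⟨(τ.1, τ.2.2), hmem _ (by simp), h1⟩

theorem side_subset {S : Supertile} (hS : S ∈ D) {s : (ℤ × ℤ) × (ℤ × ℤ)} (hs : s ∈ S.kind.sides) :
    segment ℝ (S.pos s.1) (S.pos s.2) ⊆ ⋃ t ∈ T, frontier t.region := by
  obtain ⟨τ, hτ, hs⟩ := List.mem_flatMap.1 hs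
  have ht : (⟨S.pos τ.1, S.pos τ.2.1, S.pos τ.2.2⟩ : Triangle) ∈ T :=
    h.isPartition.subset S hS (S.mem_tiles.2 ⟨τ, hτ, rfl⟩)
  have hpw := h.isTile _ ht
  obtain ⟨n1, n2, n3⟩ := Triangle.corner_ne_of_isPinwheel one_pos hpw
  refine Subset.trans ?_ (subset_biUnion_of_mem ht)
  simp only [List.mem_cons, List.not_mem_nil, or_false] at hs
  rcases hs with rfl | rfl | rfl
  · exact hpw.segment_subset_frontier one_pos (by simp [Triangle.corners])
      (by simp [Triangle.corners]) n1
  · exact hpw.segment_subset_frontier one_pos (by simp [Triangle.corners])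
      (by simp [Triangle.corners]) n2
  · exact hpw.segment_subset_frontier one_pos (by simp [Triangle.corners])
      (by simp [Triangle.corners]) n3

theorem adj_of_mem_out {S : Supertile} (hS : S ∈ D) {e : (ℤ × ℤ) × (ℤ × ℤ) × ℕ}
    (he : e ∈ S.kind.out) {p q : vertices T} (hp : (p : ℂ) = S.pos e.1)
    (hq : (q : ℂ) = S.pos e.2.1) : (graph T).Adj p q := by
  obtain ⟨hne, hv1, hv2, ⟨s, hs, h1, h2⟩, hb⟩ := S.kind.out_spec e he
  refine ⟨fun e' => hne (S.pos_injective (by rw [← hp, ← hq, e'])), ?_, ?_⟩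
  · rw [hp, hq]
    exact ((convex_segment _ _).segment_subset (S.pos_mem_segment.2 h1)
      (S.pos_mem_segment.2 h2)).trans (h.side_subset hS hs)
  · rw [hp, hq]
    intro x hx hxo
    have hxS : x ∈ S.region := S.convex_region.segment_subset (S.pos_mem_region hv1)
      (S.pos_mem_region hv2) (openSegment_subset_segment _ _ _ hxo)
    obtain ⟨r, hr, rfl⟩ := h.exists_pos_eq hS hx hxS
    exact hb r hr ((S.pos_mem_openSegment hne).1 hxo)

/-- The segment is covered by the sides of the finitely many nearby supertiles, and no end of a side
lies in its relative interior, so a single side contains it. The direction is left open because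
external edges are listed in one direction only. -/
theorem exists_mem_out_or {p q : vertices T} (hpq : (graph T).Adj p q) :
    ∃ S ∈ D, ∃ e ∈ S.kind.out, ((p : ℂ) = S.pos e.1 ∧ (q : ℂ) = S.pos e.2.1) ∨
      ((q : ℂ) = S.pos e.1 ∧ (p : ℂ) = S.pos e.2.1) := by
  obtain ⟨hne, hsub, hno⟩ := hpq
  have hne' : (p : ℂ) ≠ q := fun e => hne (Subtype.ext e)
  obtain ⟨r, hr⟩ : ∃ r, segment ℝ (p : ℂ) q ⊆ Metric.closedBall (p : ℂ) r :=
    ⟨dist (q : ℂ) p, (convex_closedBall _ _).segment_subset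
      (Metric.mem_closedBall_self dist_nonneg) (Metric.mem_closedBall.2 le_rfl)⟩
  set ι := {x : Supertile × ((ℤ × ℤ) × (ℤ × ℤ)) |
    x.1 ∈ {S ∈ D | (S.region ∩ Metric.closedBall (p : ℂ) r).Nonempty} ∧ x.2 ∈ x.1.kind.sides}
    with hι
  have hfin : ι.Finite := by
    refine Set.Finite.subset ((h.finite_near (p : ℂ) r).biUnion fun S _ =>
      (List.finite_toSet S.kind.sides).image fun s => (S, s)) ?_
    rintro ⟨S, s⟩ ⟨h1, h2⟩
    exact mem_iUnion₂.2 ⟨S, h1, s, h2, rfl⟩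
  have hend : ∀ x ∈ ι, ∀ y ∈ x.1.kind.verts, x.1.pos y ∉ openSegment ℝ (p : ℂ) q :=
    fun x hx y hy => hno _ (h.pos_mem_vertices hx.1.1 hy)
  obtain ⟨⟨S, s⟩, ⟨⟨hS, -⟩, hs⟩, hseg⟩ := exists_segment_subset_of_finite_cover hne' hfin
    (fun x => x.1.pos x.2.1) (fun x => x.1.pos x.2.2) (by
      intro z hz
      have hz' := openSegment_subset_segment _ _ _ hz
      obtain ⟨t, ht, hzt⟩ := mem_iUnion₂.1 (hsub hz')
      obtain ⟨S, ⟨hS, htS⟩, -⟩ := h.isPartition.existsUnique t ht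
      obtain ⟨s, hs, hzs⟩ := h.exists_side_of_mem_frontier hS htS hzt
      refine mem_iUnion₂.2 ⟨(S, s), ⟨⟨hS, z, ?_, hr hz'⟩, hs⟩, hzs⟩
      exact mem_iUnion₂.2 ⟨t, htS, t.isClosed_region.frontier_subset hzt⟩)
    (fun x hx => hend x hx _ (x.1.kind.sides_verts _ hx.2).1)
    (fun x hx => hend x hx _ (x.1.kind.sides_verts _ hx.2).2)
  simp only at hseg hs
  obtain ⟨v1, v2⟩ := S.kind.sides_verts s hs
  have hsS := S.convex_region.segment_subset (S.pos_mem_region v1) (S.pos_mem_region v2)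
  have hpS := hseg (left_mem_segment ℝ _ _)
  have hqS := hseg (right_mem_segment ℝ _ _)
  obtain ⟨P, hP, eP⟩ := h.exists_pos_eq hS p.2 (hsS hpS)
  obtain ⟨Q, hQ, eQ⟩ := h.exists_pos_eq hS q.2 (hsS hqS)
  rw [eP, eQ] at hno hne'
  have hPQ : P ≠ Q := fun e => hne' (by rw [e])
  rw [eP, S.pos_mem_segment] at hpS
  rw [eQ, S.pos_mem_segment] at hqS
  obtain ⟨e, he, h1 | h1⟩ := S.kind.exists_out_of_sides s hs P hP hpS Q hQ hqS hPQ (fun r hr hb =>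
    hno _ (h.pos_mem_vertices hS hr) ((S.pos_mem_openSegment hPQ).2 hb))
  · exact ⟨S, hS, e, he, Or.inl ⟨by rw [eP, h1.1], by rw [eQ, h1.2]⟩⟩
  · exact ⟨S, hS, e, he, Or.inr ⟨by rw [eQ, h1.1], by rw [eP, h1.2]⟩⟩

/-- Every external edge of a supertile is an external edge, with the opposite direction, of
another one. -/
theorem exists_reverse {S : Supertile} (hS : S ∈ D) (i : Fin 6) :
    ∃ S' ∈ D, ∃ j : Fin 6, S'.pos (S'.kind.cyc j) = S.pos (S.kind.cyc (i + 1)) ∧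
      S'.pos (S'.kind.cyc (j + 1)) = S.pos (S.kind.cyc i) := by
  have hv : ∀ S : Supertile, ∀ j, S.kind.cyc j ∈ S.kind.verts := fun S j =>
    List.mem_append_left _ (List.mem_ofFn.2 ⟨j, rfl⟩)
  have hadj : ∀ S ∈ D, ∀ j : Fin 6, ∀ x ∈ vertices T,
      x ∉ openSegment ℝ (S.pos (S.kind.cyc j)) (S.pos (S.kind.cyc (j + 1))) := by
    intro S hS j
    have := h.adj_of_mem_out hS (e := (S.kind.cyc j, S.kind.cyc (j + 1), 3))
      (List.mem_append_left _ (List.mem_ofFn.2 ⟨j, rfl⟩))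
      (p := ⟨_, h.pos_mem_vertices hS (hv S j)⟩) (q := ⟨_, h.pos_mem_vertices hS (hv S (j + 1))⟩)
      rfl rfl
    exact this.2.2
  set p := S.pos (S.kind.cyc i) with hp
  set q := S.pos (S.kind.cyc (i + 1)) with hq
  have hpq : p ≠ q := fun e => S.kind.cyc_ne i (S.pos_injective e).symm
  obtain ⟨r, hr⟩ : ∃ r, segment ℝ p q ⊆ Metric.closedBall p r :=
    ⟨dist q p, (convex_closedBall _ _).segment_subset
      (Metric.mem_closedBall_self dist_nonneg) (Metric.mem_closedBall.2 le_rfl)⟩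
  set ι := {x : Supertile × Fin 6 |
    x.1 ∈ {S ∈ D | (S.region ∩ Metric.closedBall p r).Nonempty} ∧ x.1 ≠ S} with hι
  have hfin : ι.Finite := by
    refine Set.Finite.subset ((h.finite_near p r).prod (Set.finite_univ (α := Fin 6))) ?_
    rintro ⟨S', j⟩ ⟨h1, h2⟩
    exact ⟨h1, mem_univ _⟩
  obtain ⟨⟨S', j⟩, ⟨⟨hS', -⟩, hne⟩, hseg⟩ := exists_segment_subset_of_finite_cover hpq hfin
    (fun x => x.1.pos (x.1.kind.cyc x.2)) (fun x => x.1.pos (x.1.kind.cyc (x.2 + 1))) (by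
      intro z hz
      have hz' := openSegment_subset_segment _ _ _ hz
      obtain ⟨S', hS', hne, hzS'⟩ :=
        h.exists_ne_of_mem_frontier (S.segment_cyc_subset_frontier i hz')
      rcases S'.mem_interior_or_mem_segment hzS' with h1 | ⟨j, h1⟩
      · exact absurd (h.eq_of_mem_interior hS' hS h1
          (S.isClosed_region.frontier_subset (S.segment_cyc_subset_frontier i hz'))) hne
      · exact mem_iUnion₂.2 ⟨(S', j), ⟨⟨hS', z, hzS', hr hz'⟩, hne⟩, h1⟩)
    (fun x hx => hadj S hS i _ (h.pos_mem_vertices hx.1.1 (hv _ _)))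
    (fun x hx => hadj S hS i _ (h.pos_mem_vertices hx.1.1 (hv _ _)))
  simp only at hseg hne
  have hmem : ∀ x ∈ vertices T, x ∈ segment ℝ p q →
      x = S'.pos (S'.kind.cyc j) ∨ x = S'.pos (S'.kind.cyc (j + 1)) := by
    intro x hx hxs
    by_contra! hcon
    exact hadj S' hS' j x hx (mem_openSegment_of_ne_left_right hcon.1.symm hcon.2.symm (hseg hxs))
  have h1 := hmem p (h.pos_mem_vertices hS (hv _ _)) (left_mem_segment ℝ _ _)
  have h2 := hmem q (h.pos_mem_vertices hS (hv _ _)) (right_mem_segment ℝ _ _)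
  rcases h1 with h1 | h1 <;> rcases h2 with h2 | h2
  · exact absurd (h1.trans h2.symm) hpq
  · exfalso
    -- If both supertiles ran along the side in the same direction, both would contain the flank
    -- point on its left in their interiors.
    have f1 := S.flank_mem_interior i
    have f2 := S'.flank_mem_interior j
    rw [← h1, ← h2] at f2
    exact hne (h.eq_of_mem_interior hS' hS f2 (interior_subset f1))
  · exact ⟨S', hS', j, h2.symm, h1.symm⟩
  · exact absurd (h1.trans h2.symm) hpq

theorem exists_out_reverse {S : Supertile} (hS : S ∈ D) {e : (ℤ × ℤ) × (ℤ × ℤ) × ℕ}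
    (he : e ∈ S.kind.out) : ∃ S' ∈ D, ∃ e' ∈ S'.kind.out, S'.pos e'.1 = S.pos e.2.1 ∧
      S'.pos e'.2.1 = S.pos e.1 ∧ e'.2.2 = e.2.2 := by
  simp only [Kind.out, List.mem_append, List.mem_ofFn, List.mem_map] at he
  rcases he with ⟨i, rfl⟩ | he | ⟨e', he', rfl⟩
  · obtain ⟨S', hS', j, h2, h3⟩ := h.exists_reverse hS i
    exact ⟨S', hS', (S'.kind.cyc j, S'.kind.cyc (j + 1), 3),
      List.mem_append_left _ (List.mem_ofFn.2 ⟨j, rfl⟩), h2, h3, rfl⟩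
  · exact ⟨S, hS, (e.2.1, e.1, e.2.2), List.mem_append_right _ (List.mem_append_right _
      (List.mem_map.2 ⟨e, he, rfl⟩)), rfl, rfl, rfl⟩
  · exact ⟨S, hS, e', List.mem_append_right _ (List.mem_append_left _ he'), rfl, rfl, rfl⟩

/-- Every directed edge of the graph belongs to a supertile. -/
theorem exists_mem_out {p q : vertices T} (hpq : (graph T).Adj p q) :
    ∃ S ∈ D, ∃ e ∈ S.kind.out, (p : ℂ) = S.pos e.1 ∧ (q : ℂ) = S.pos e.2.1 := by
  obtain ⟨S, hS, e, he, h1 | h1⟩ := h.exists_mem_out_or hpq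
  · exact ⟨S, hS, e, he, h1⟩
  · obtain ⟨S', hS', e', he', h2, h3, -⟩ := h.exists_out_reverse hS he
    exact ⟨S', hS', e', he', h1.2.trans h2.symm, h1.1.trans h3.symm⟩

/-- The supertile of a directed edge is unique. -/
theorem out_eq {S S' : Supertile} (hS : S ∈ D) (hS' : S' ∈ D) {e e' : (ℤ × ℤ) × (ℤ × ℤ) × ℕ}
    (he : e ∈ S.kind.out) (he' : e' ∈ S'.kind.out) (h1 : S.pos e.1 = S'.pos e'.1)
    (h2 : S.pos e.2.1 = S'.pos e'.2.1) : S = S' ∧ e = e' := by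
  suffices hSS : S = S' by
    subst hSS
    exact ⟨rfl, S.kind.out_unique e he e' he' (S.pos_injective h1) (S.pos_injective h2)⟩
  have hmid : ∀ S : Supertile, ∀ e ∈ S.kind.out, (S.pos e.1 + S.pos e.2.1) / 2 ∈ S.region := by
    intro S e he
    obtain ⟨-, v1, v2, -⟩ := S.kind.out_spec e he
    refine S.convex_region.segment_subset (S.pos_mem_region v1) (S.pos_mem_region v2) ?_
    exact mem_segment_iff_exists.2 ⟨1 / 2, by norm_num, by norm_num, by push_cast; ring⟩
  have hint : ∀ S : Supertile, ∀ e ∈ S.kind.out,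
      (∃ i, e = (S.kind.cyc i, S.kind.cyc (i + 1), 3)) ∨
      (S.pos e.1 + S.pos e.2.1) / 2 ∈ interior S.region := by
    intro S e he
    simp only [Kind.out, List.mem_append, List.mem_ofFn, List.mem_map] at he
    rcases he with ⟨i, rfl⟩ | he | ⟨e', he', rfl⟩
    · exact Or.inl ⟨i, rfl⟩
    · exact Or.inr (S.mid_mem_interior he)
    · right
      rw [add_comm]
      exact S.mid_mem_interior he'
  -- Two external edges are compared at their common flank point; if one edge is internal, its
  -- midpoint is an interior point lying on the other supertile.
  rcases hint S e he with ⟨i, rfl⟩ | hi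
  · rcases hint S' e' he' with ⟨j, rfl⟩ | hj
    · have f1 := S.flank_mem_interior i
      have f2 := S'.flank_mem_interior j
      simp only at h1 h2
      rw [← h1, ← h2] at f2
      exact h.eq_of_mem_interior hS hS' f1 (interior_subset f2)
    · rw [← h1, ← h2] at hj
      exact (h.eq_of_mem_interior hS' hS hj (hmid S _ he)).symm
  · refine h.eq_of_mem_interior hS hS' hi ?_
    rw [h1, h2]
    exact hmid S' _ he'

end IsPartitioned

end Pinwheel

namespace Pinwheel

open Complex Set

/-! ## The edge weighting -/

namespace Kind

/-- An edge is internal in a supertile if it is listed in one of the two directions. -/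
def inout (k : Kind) : List ((ℤ × ℤ) × (ℤ × ℤ) × ℕ) :=
  k.intEdges ++ k.intEdges.map fun e => (e.2.1, e.1, e.2.2)

theorem mem_out {k : Kind} {e : (ℤ × ℤ) × (ℤ × ℤ) × ℕ} :
    e ∈ k.out ↔ (∃ i, e = (k.cyc i, k.cyc (i + 1), 3)) ∨ e ∈ k.inout := by
  rw [out, List.mem_append, List.mem_ofFn, inout]
  simp only [eq_comm]

theorem inout_weight (k : Kind) : ∀ e ∈ k.inout, ∀ i : Fin 6, e.1 = k.cyc i →
    (i.val % 2 = 1 → e.2.2 = 1) ∧ (i.val % 2 = 0 → e.2.2 = 2) := by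
  cases k <;> decide +kernel

theorem out_weight (k : Kind) : ∀ e ∈ k.out, 1 ≤ e.2.2 ∧ e.2.2 ≤ 3 := by
  cases k <;> decide +kernel

theorem intEdges_cases (k : Kind) : ∀ e ∈ k.intEdges, (∃ i, e.1 = k.cyc i) ∨ e.1 ∈ k.inn := by
  cases k <;> decide +kernel

/-- The list `intEdges` puts the external endpoint of an edge first whenever there is one. An
internal first endpoint therefore means that both ends are internal. -/
theorem mem_inner (k : Kind) : ∀ e ∈ k.intEdges, e.1 ∈ k.inn →
    (pt e.1.1 e.1.2, pt e.2.1.1 e.2.1.2, e.2.2) ∈ k.inner := by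
  cases k <;> simp [intEdges, inn, inner]

theorem exists_of_mem_inner (k : Kind) : ∀ x ∈ k.inner, ∃ e ∈ k.intEdges,
    x = (pt e.1.1 e.1.2, pt e.2.1.1 e.2.1.2, e.2.2) := by
  cases k <;> simp [intEdges, inner]

end Kind

namespace Supertile

variable (S : Supertile)

theorem mid_mem_interior' {e : (ℤ × ℤ) × (ℤ × ℤ) × ℕ} (he : e ∈ S.kind.inout) :
    (S.pos e.1 + S.pos e.2.1) / 2 ∈ interior S.region := by
  rcases List.mem_append.1 he with he | he
  · exact S.mid_mem_interior he
  · obtain ⟨e', he', rfl⟩ := List.mem_map.1 he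
    rw [add_comm]
    exact S.mid_mem_interior he'

theorem segment_out_subset {e : (ℤ × ℤ) × (ℤ × ℤ) × ℕ} (he : e ∈ S.kind.out) :
    segment ℝ (S.pos e.1) (S.pos e.2.1) ⊆ S.region := by
  obtain ⟨-, v1, v2, -⟩ := S.kind.out_spec e he
  exact S.convex_region.segment_subset (S.pos_mem_region v1) (S.pos_mem_region v2)

theorem mid_mem_segment (z w : ℂ) : (z + w) / 2 ∈ segment ℝ z w :=
  mem_segment_iff_exists.2 ⟨1 / 2, by norm_num, by norm_num, by push_cast; ring⟩

theorem isInternal_of_mem_inout {e : (ℤ × ℤ) × (ℤ × ℤ) × ℕ} (he : e ∈ S.kind.inout) :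
    S.IsInternal (S.pos e.1) (S.pos e.2.1) :=
  ⟨S.segment_out_subset (Kind.mem_out.2 (Or.inr he)), fun hex =>
    (hex (mid_mem_segment _ _)).2 (S.mid_mem_interior' he)⟩

end Supertile

namespace IsPartitioned

variable {T : Set Triangle} {D : Set Supertile} (h : IsPartitioned T D)
include h

theorem eq_of_inout {S S' : Supertile} (hS : S ∈ D) (hS' : S' ∈ D)
    {e : (ℤ × ℤ) × (ℤ × ℤ) × ℕ} (he : e ∈ S.kind.inout)
    (hsub : segment ℝ (S.pos e.1) (S.pos e.2.1) ⊆ S'.region) : S = S' :=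
  h.eq_of_mem_interior hS hS' (S.mid_mem_interior' he) (hsub (Supertile.mid_mem_segment _ _))

omit h in
/-- A weighting that follows the rules has the listed weights. -/
theorem weight_eq {l : (graph T).edgeSet → ℕ} (hl : FollowsRules T D l) {S : Supertile}
    (hS : S ∈ D) {e : (ℤ × ℤ) × (ℤ × ℤ) × ℕ} (he : e ∈ S.kind.out) {p q : vertices T}
    (hpq : (graph T).Adj p q) (hp : (p : ℂ) = S.pos e.1) (hq : (q : ℂ) = S.pos e.2.1) :
    l ⟨s(p, q), hpq⟩ = e.2.2 := by
  have main : ∀ e ∈ S.kind.intEdges, ∀ p q : vertices T, ∀ hpq : (graph T).Adj p q,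
      (p : ℂ) = S.pos e.1 → (q : ℂ) = S.pos e.2.1 → l ⟨s(p, q), hpq⟩ = e.2.2 := by
    intro e he p q hpq hp hq
    have he' : e ∈ S.kind.inout := List.mem_append_left _ he
    rcases S.kind.intEdges_cases e he with ⟨i, hi⟩ | hi
    · have hw := S.kind.inout_weight e he' i hi
      have hin := S.isInternal_of_mem_inout he'
      rw [← hp, ← hq] at hin
      rcases Nat.mod_two_eq_zero_or_one i.val with hi2 | hi2
      · rw [hw.2 hi2]
        exact hl.blue S hS p q hpq hin (S.mem_blue.2 ⟨i, hi2, by rw [hp, hi]⟩)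
      · rw [hw.1 hi2]
        exact hl.red S hS p q hpq hin (S.mem_red.2 ⟨i, hi2, by rw [hp, hi]⟩)
    · obtain ⟨p', q', hpq', hp', hq', hw⟩ := hl.inner S hS _ (S.kind.mem_inner e he hi)
      obtain rfl : p = p' := Subtype.ext (hp.trans hp'.symm)
      obtain rfl : q = q' := Subtype.ext (hq.trans hq'.symm)
      exact hw
  rcases Kind.mem_out.1 he with ⟨i, rfl⟩ | he
  · refine hl.external S hS p q hpq ?_
    rw [hp, hq]
    exact S.segment_cyc_subset_frontier i
  · rcases List.mem_append.1 he with he | he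
    · exact main e he p q hpq hp hq
    · obtain ⟨e', he', rfl⟩ := List.mem_map.1 he
      rw [← main e' he' q p hpq.symm hq hp]
      congr 2
      exact Sym2.eq_swap

theorem exists_out_of_edge (e : (graph T).edgeSet) : ∃ w : ℕ, ∃ S ∈ D, ∃ x ∈ S.kind.out,
    ∃ p q : vertices T, e.1 = s(p, q) ∧ (p : ℂ) = S.pos x.1 ∧ (q : ℂ) = S.pos x.2.1 ∧
      w = x.2.2 := by
  obtain ⟨e, he⟩ := e
  induction e using Sym2.ind with
  | _ p q =>
    obtain ⟨S, hS, x, hx, h1, h2⟩ := h.exists_mem_out he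
    exact ⟨_, S, hS, x, hx, p, q, rfl, h1, h2, rfl⟩

/-- A directed edge has one supertile, and reversing its direction keeps the weight, so the two
possible readings of an undirected edge agree. -/
theorem weight_unique {S S' : Supertile} (hS : S ∈ D) (hS' : S' ∈ D)
    {x x' : (ℤ × ℤ) × (ℤ × ℤ) × ℕ} (hx : x ∈ S.kind.out) (hx' : x' ∈ S'.kind.out)
    {p q p' q' : vertices T} (he : s(p, q) = s(p', q')) (h1 : (p : ℂ) = S.pos x.1)
    (h2 : (q : ℂ) = S.pos x.2.1) (h1' : (p' : ℂ) = S'.pos x'.1) (h2' : (q' : ℂ) = S'.pos x'.2.1) :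
    x.2.2 = x'.2.2 := by
  rcases Sym2.eq_iff.1 he with ⟨rfl, rfl⟩ | ⟨rfl, rfl⟩
  · rw [(h.out_eq hS hS' hx hx' (h1.symm.trans h1') (h2.symm.trans h2')).2]
  · obtain ⟨S₁, hS₁, y, hy, h3, h4, h5⟩ := h.exists_out_reverse hS hx
    rw [← h5, (h.out_eq hS₁ hS' hy hx' (h3.trans (h2.symm.trans h1'))
      (h4.trans (h1.symm.trans h2'))).2]

theorem exists_followsRules : ∃ l : (graph T).edgeSet → ℕ, FollowsRules T D l := by
  choose l hl using h.exists_out_of_edge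
  have key : ∀ S ∈ D, ∀ x ∈ S.kind.out, ∀ p q : vertices T, ∀ hpq : (graph T).Adj p q,
      (p : ℂ) = S.pos x.1 → (q : ℂ) = S.pos x.2.1 → l ⟨s(p, q), hpq⟩ = x.2.2 := by
    intro S hS x hx p q hpq h1 h2
    obtain ⟨S', hS', x', hx', p', q', he, h1', h2', hw⟩ := hl ⟨s(p, q), hpq⟩
    rw [hw]
    exact (h.weight_unique hS hS' hx hx' he h1 h2 h1' h2').symm
  -- The rule speaks of `S`, whereas the directed edge is listed in some `S'`. A point of the edge
  -- in the interior of `S` rules out that it is external to `S'`, and the midpoint of an edge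
  -- internal to `S'` forces `S = S'`.
  have int : ∀ S ∈ D, ∀ p q : vertices T, ∀ hpq : (graph T).Adj p q, S.IsInternal p q →
      ∀ i : Fin 6, (p : ℂ) = S.pos (S.kind.cyc i) →
      (i.val % 2 = 1 → l ⟨s(p, q), hpq⟩ = 1) ∧ (i.val % 2 = 0 → l ⟨s(p, q), hpq⟩ = 2) := by
    intro S hS p q hpq hin i hi
    obtain ⟨S', hS', x, hx, h1, h2⟩ := h.exists_mem_out hpq
    rw [key S' hS' x hx p q hpq h1 h2]
    rcases Kind.mem_out.1 hx with ⟨j, rfl⟩ | hx'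
    · exfalso
      obtain ⟨z, hz, hzf⟩ := not_subset.1 hin.2
      have hzi : z ∈ interior S.region := by
        by_contra hcon
        exact hzf (S.isClosed_region.frontier_eq ▸ ⟨hin.1 hz, hcon⟩)
      rw [h1, h2] at hz
      have := h.eq_of_mem_interior hS hS' hzi (S'.segment_out_subset hx hz)
      subst this
      exact (S.segment_cyc_subset_frontier j hz).2 hzi
    · have hsub := hin.1
      rw [h1, h2] at hsub
      have := h.eq_of_inout hS' hS hx' hsub
      subst this
      exact S'.kind.inout_weight x hx' i (S'.pos_injective (h1.symm.trans hi))
  refine ⟨l, ⟨?_, ?_, ?_, ?_⟩⟩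
  · intro S hS p q hpq hex
    obtain ⟨S', hS', x, hx, h1, h2⟩ := h.exists_mem_out hpq
    rw [key S' hS' x hx p q hpq h1 h2]
    rcases Kind.mem_out.1 hx with ⟨j, rfl⟩ | hx'
    · rfl
    · exfalso
      unfold Supertile.IsExternal at hex
      rw [h1, h2] at hex
      have := h.eq_of_inout hS' hS hx' (hex.trans S.isClosed_region.frontier_subset)
      subst this
      exact (hex (Supertile.mid_mem_segment _ _)).2 (S'.mid_mem_interior' hx')
  · intro S hS p q hpq hin hp
    obtain ⟨i, hi, hpi⟩ := S.mem_red.1 hp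
    exact (int S hS p q hpq hin i hpi).1 hi
  · intro S hS p q hpq hin hp
    obtain ⟨i, hi, hpi⟩ := S.mem_blue.1 hp
    exact (int S hS p q hpq hin i hpi).2 hi
  · intro S hS x hx
    obtain ⟨e, he, rfl⟩ := S.kind.exists_of_mem_inner x hx
    have heo : e ∈ S.kind.out := Kind.mem_out.2 (Or.inr (List.mem_append_left _ he))
    obtain ⟨-, v1, v2, -⟩ := S.kind.out_spec e heo
    have hadj := h.adj_of_mem_out hS heo (p := ⟨_, h.pos_mem_vertices hS v1⟩)
      (q := ⟨_, h.pos_mem_vertices hS v2⟩) rfl rfl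
    exact ⟨_, _, hadj, rfl, rfl, key S hS e heo _ _ hadj rfl rfl⟩

theorem existsUnique_followsRules : ∃! l : (graph T).edgeSet → ℕ, FollowsRules T D l := by
  refine existsUnique_of_exists_of_unique h.exists_followsRules ?_
  intro l l' hl hl'
  funext ⟨e, he⟩
  induction e using Sym2.ind with
  | _ p q =>
    obtain ⟨S, hS, x, hx, h1, h2⟩ := h.exists_mem_out he
    exact (weight_eq hl hS hx he h1 h2).trans (weight_eq hl' hS hx he h1 h2).symm

theorem isEdgeLabelling {l : (graph T).edgeSet → ℕ} (hl : FollowsRules T D l) :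
    IsEdgeLabelling 3 l := by
  rintro ⟨e, he⟩
  induction e using Sym2.ind with
  | _ p q =>
    obtain ⟨S, hS, x, hx, h1, h2⟩ := h.exists_mem_out he
    rw [weight_eq hl hS hx he h1 h2]
    exact S.kind.out_weight x hx

end IsPartitioned

end Pinwheel

namespace Pinwheel

open Complex Set

/-! ## Weighted degrees -/

namespace Kind

/-- The sum of the weights of the directed edges of a supertile that start at `p`. -/
def outSum (k : Kind) (p : ℤ × ℤ) : ℕ := ∑ e ∈ k.out.toFinset with e.1 = p, e.2.2

end Kind

namespace IsPartitioned

variable {T : Set Triangle} {D : Set Supertile} (h : IsPartitioned T D)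
include h

theorem finite_at (v : ℂ) : {S ∈ D | v ∈ S.region}.Finite := by
  refine (h.finite_near v 0).subset ?_
  rintro S ⟨hS, hv⟩
  exact ⟨hS, v, hv, by simp⟩

/-- The directed edges at a vertex, each with its supertile. -/
theorem bijOn_edges {l : (graph T).edgeSet → ℕ} (hl : FollowsRules T D l) (v : vertices T)
    (P : Supertile → ℤ × ℤ) (hP : ∀ S ∈ D, (v : ℂ) ∈ S.region → (v : ℂ) = S.pos (P S)) :
    ∃ g : (graph T).edgeSet → Supertile × ((ℤ × ℤ) × (ℤ × ℤ) × ℕ),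
      BijOn g {e | v ∈ (e : Sym2 (vertices T))}
        {x | x.1 ∈ {S ∈ D | (v : ℂ) ∈ S.region} ∧ x.2 ∈ x.1.kind.out ∧ x.2.1 = P x.1} ∧
      ∀ e : (graph T).edgeSet, v ∈ (e : Sym2 (vertices T)) → l e = (g e).2.2.2 := by
  classical
  have hex : ∀ e : (graph T).edgeSet, v ∈ (e : Sym2 (vertices T)) →
      ∃ x : Supertile × ((ℤ × ℤ) × (ℤ × ℤ) × ℕ), ∃ q : vertices T, ∃ hq : (graph T).Adj v q,
        x.1 ∈ D ∧ x.2 ∈ x.1.kind.out ∧ e = ⟨s(v, q), hq⟩ ∧ (v : ℂ) = x.1.pos x.2.1 ∧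
        (q : ℂ) = x.1.pos x.2.2.1 := by
    rintro ⟨e, he⟩ hv
    obtain ⟨q, rfl⟩ := Sym2.mem_iff_exists.1 hv
    obtain ⟨S, hS, x, hx, h1, h2⟩ := h.exists_mem_out he
    exact ⟨(S, x), q, he, hS, hx, rfl, h1, h2⟩
  have : Nonempty (Supertile × ((ℤ × ℤ) × (ℤ × ℤ) × ℕ)) :=
    ⟨⟨⟨Kind.rectangle, 1, 0⟩, ((0, 0), (0, 0), 0)⟩⟩
  have hreg : ∀ S : Supertile, ∀ x ∈ S.kind.out, S.pos x.1 ∈ S.region := fun S x hx =>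
    S.pos_mem_region (S.kind.out_spec x hx).2.1
  choose! g hg using hex
  refine ⟨g, ⟨?_, ?_, ?_⟩, ?_⟩
  · intro e he
    obtain ⟨q, hq, hS, hx, -, h1, h2⟩ := hg e he
    have hvS : (v : ℂ) ∈ (g e).1.region := h1 ▸ hreg _ _ hx
    exact ⟨⟨hS, hvS⟩, hx, (g e).1.pos_injective (h1.symm.trans (hP _ hS hvS))⟩
  · intro e he e' he' hee
    obtain ⟨q, hq, -, -, h0, -, h2⟩ := hg e he
    obtain ⟨q', hq', -, -, h0', -, h2'⟩ := hg e' he'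
    rw [hee] at h2
    obtain rfl : q = q' := Subtype.ext (h2.trans h2'.symm)
    rw [h0, h0']
  · rintro ⟨S, x⟩ ⟨⟨hS, hvS⟩, hx, hxP⟩
    simp only at hS hvS hx hxP
    have hv : (v : ℂ) = S.pos x.1 := by rw [hxP]; exact hP S hS hvS
    have hadj := h.adj_of_mem_out hS hx (p := v)
      (q := ⟨_, h.pos_mem_vertices hS (S.kind.out_spec x hx).2.2.1⟩) hv rfl
    have hm : v ∈ ((⟨s(v, _), hadj⟩ : (graph T).edgeSet) : Sym2 (vertices T)) :=
      Sym2.mem_mk_left _ _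
    refine ⟨⟨s(v, _), hadj⟩, hm, ?_⟩
    obtain ⟨q, hq, hS', hx', h0, h1, h2⟩ := hg _ hm
    have hqe := Sym2.congr_right.1 (Subtype.ext_iff.1 h0)
    obtain ⟨a, b⟩ := h.out_eq hS' hS hx' hx (h1.symm.trans hv) (h2.symm.trans (by rw [← hqe]))
    exact Prod.ext a b
  · intro e he
    obtain ⟨q, hq, hS, hx, h0, h1, h2⟩ := hg e he
    conv_lhs => rw [h0]
    exact weight_eq hl hS hx hq h1 h2

/-- Directed away from `v`, each edge belongs to exactly one supertile. So an edge between two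
supertiles is counted once, although it lies on both. -/
theorem weightedDegree_eq {l : (graph T).edgeSet → ℕ} (hl : FollowsRules T D l) (v : vertices T)
    (P : Supertile → ℤ × ℤ) (hP : ∀ S ∈ D, (v : ℂ) ∈ S.region → (v : ℂ) = S.pos (P S)) :
    weightedDegree l v = ∑ S ∈ (h.finite_at v).toFinset, S.kind.outSum (P S) := by
  classical
  obtain ⟨g, hg, hlg⟩ := h.bijOn_edges hl v P hP
  have e1 : weightedDegree l v = ∑ᶠ (x) (_ : x ∈ {x : Supertile × ((ℤ × ℤ) × (ℤ × ℤ) × ℕ) |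
      x.1 ∈ {S ∈ D | (v : ℂ) ∈ S.region} ∧ x.2 ∈ x.1.kind.out ∧ x.2.1 = P x.1}), x.2.2.2 :=
    finsum_mem_eq_of_bijOn g hg hlg
  have e2 : {x : Supertile × ((ℤ × ℤ) × (ℤ × ℤ) × ℕ) |
      x.1 ∈ {S ∈ D | (v : ℂ) ∈ S.region} ∧ x.2 ∈ x.1.kind.out ∧ x.2.1 = P x.1} =
      (((h.finite_at v).toFinset.biUnion fun S =>
        (S.kind.out.toFinset.filter fun e => e.1 = P S).map
          ⟨fun e => (S, e), Prod.mk_right_injective S⟩ : Finset _) : Set _) := by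
    ext ⟨S, x⟩
    simp
    tauto
  rw [e1, e2, finsum_mem_coe_finset, Finset.sum_biUnion]
  · refine Finset.sum_congr rfl fun S _ => ?_
    rw [Finset.sum_map]
    rfl
  · intro S _ S' _ hne
    rw [Function.onFun, Finset.disjoint_left]
    rintro x hx hx'
    simp only [Finset.mem_map] at hx hx'
    obtain ⟨_, _, rfl⟩ := hx
    obtain ⟨_, _, he⟩ := hx'
    exact hne (congrArg Prod.fst he).symm

theorem finite_neighborSet (v : vertices T) : ((graph T).neighborSet v).Finite := by
  refine Set.Finite.of_finite_image (f := Subtype.val) ?_ Subtype.val_injective.injOn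
  refine ((h.finite_at v).biUnion fun S _ =>
    (List.finite_toSet S.kind.out).image fun e => S.pos e.2.1).subset ?_
  rintro _ ⟨q, hq, rfl⟩
  obtain ⟨S, hS, x, hx, h1, h2⟩ := h.exists_mem_out hq
  exact mem_iUnion₂.2 ⟨S, ⟨hS, h1 ▸ S.pos_mem_region (S.kind.out_spec x hx).2.1⟩, x, hx, h2.symm⟩

theorem weightedDegree_inn {l : (graph T).edgeSet → ℕ} (hl : FollowsRules T D l) {v : vertices T}
    {S : Supertile} (hS : S ∈ D) {p : ℤ × ℤ} (hp : p ∈ S.kind.inn) (hv : (v : ℂ) = S.pos p) :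
    weightedDegree l v = S.kind.outSum p := by
  have huniq : ∀ S' ∈ D, (v : ℂ) ∈ S'.region → S' = S := fun S' hS' hvS' =>
    (h.eq_of_mem_interior hS hS' (hv ▸ S.pos_mem_interior hp) hvS').symm
  have hset : (h.finite_at v).toFinset = {S} := by
    ext S'
    simp only [Finite.mem_toFinset, mem_ofPred_eq, Finset.mem_singleton]
    constructor
    · rintro ⟨h1, h2⟩; exact huniq S' h1 h2
    · rintro rfl; exact ⟨hS, hv ▸ interior_subset (S'.pos_mem_interior hp)⟩
  rw [h.weightedDegree_eq hl v (fun _ => p) (fun S' hS' hvS' => by rw [huniq S' hS' hvS', hv]),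
    hset, Finset.sum_singleton]

end IsPartitioned

namespace Kind

/-- The bound lies below 12, the least possible sum at an external vertex. -/
theorem outSum_inn_le (k : Kind) : ∀ p ∈ k.inn, k.outSum p ≤ 9 := by
  cases k <;> decide +kernel

theorem outSum_inn_ne (k : Kind) : ∀ e ∈ k.out, e.1 ∈ k.inn → e.2.1 ∈ k.inn →
    k.outSum e.1 ≠ k.outSum e.2.1 := by
  cases k <;> decide +kernel

theorem out_cyc (k : Kind) : ∀ e ∈ k.out, ∀ i, e.1 = k.cyc i → ∀ j, e.2.1 = k.cyc j →
    i.val % 2 ≠ j.val % 2 := by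
  cases k <;> decide +kernel

end Kind

end Pinwheel

namespace Pinwheel

open Complex Set

/-! ## The angles of the supertiles at an external vertex -/

namespace Kind

/-- The type of the angle at an external vertex: `0` for a right angle, `1` for a straight angle,
`2` for the obtuse and `3` for the acute angle of a kite. -/
def angle : Kind → Fin 6 → Fin 4
  | rectangle => ![0, 0, 1, 0, 0, 1]
  | mirrorRectangle => ![0, 1, 0, 0, 1, 0]
  | kiteBlue => ![0, 2, 0, 1, 3, 1]
  | kiteRed => ![2, 0, 1, 3, 1, 0]

/-- Five times the rotation through the angle of the given type. -/
def turn : Fin 4 → ℤ × ℤ := ![(0, 5), (-5, 0), (-3, 4), (3, 4)]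

/-- All six sides have the same length, so the interior angle is a pure rotation from the next side
to the previous one. Its cosine and sine are multiples of 1/5, which keeps the identity integral. -/
theorem turn_spec (k : Kind) : ∀ i,
    5 * ((k.cyc (i - 1)).1 - (k.cyc i).1) =
      (turn (k.angle i)).1 * ((k.cyc (i + 1)).1 - (k.cyc i).1) -
        (turn (k.angle i)).2 * ((k.cyc (i + 1)).2 - (k.cyc i).2) ∧
    5 * ((k.cyc (i - 1)).2 - (k.cyc i).2) =
      (turn (k.angle i)).1 * ((k.cyc (i + 1)).2 - (k.cyc i).2) +
        (turn (k.angle i)).2 * ((k.cyc (i + 1)).1 - (k.cyc i).1) := by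
  cases k <;> decide +kernel

/-- One external edge of weight 3 leaves the vertex. One internal edge of weight 1 lies in a right,
obtuse or acute angle, three lie in a straight one. For blue vertices the internal weight is 2. -/
theorem outSum_red (k : Kind) : ∀ i : Fin 6, i.val % 2 = 1 →
    k.outSum (k.cyc i) = (![4, 6, 4, 4] : Fin 4 → ℕ) (k.angle i) := by
  cases k <;> decide +kernel

theorem outSum_blue (k : Kind) : ∀ i : Fin 6, i.val % 2 = 0 →
    k.outSum (k.cyc i) = (![5, 9, 5, 5] : Fin 4 → ℕ) (k.angle i) := by
  cases k <;> decide +kernel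

/-- Near an external vertex, a supertile fills its angle there. -/
theorem face_near (k : Kind) : ∀ i j : Fin 6, ∃ α β : ℤ,
    α = ((k.cyc (j + 1)).1 - (k.cyc j).1) * ((k.cyc (i + 1)).2 - (k.cyc i).2) -
      ((k.cyc (j + 1)).2 - (k.cyc j).2) * ((k.cyc (i + 1)).1 - (k.cyc i).1) ∧
    β = ((k.cyc (j + 1)).1 - (k.cyc j).1) * ((k.cyc (i + 1)).1 - (k.cyc i).1) +
      ((k.cyc (j + 1)).2 - (k.cyc j).2) * ((k.cyc (i + 1)).2 - (k.cyc i).2) ∧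
    ((k.faceInt 1 j (k.cyc i) = 0 ∧ (α = 0 ∧ β = 25 ∨
      α = 5 * (turn (k.angle i)).2 ∧ β = -5 * (turn (k.angle i)).1)) ∨
    (5 ≤ k.faceInt 1 j (k.cyc i) ∧ |α| ≤ 25 ∧ |β| ≤ 25)) := by
  intro i j
  refine ⟨_, _, rfl, rfl, ?_⟩
  revert i j
  cases k <;> decide +kernel

end Kind

/-- The rotation through the angle of the given type. -/
noncomputable def rot (a : Fin 4) : ℂ := ((Kind.turn a).1 + (Kind.turn a).2 * I) / 5

/-- The points close to `0` in the angle of the given type from the positive real axis. -/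
def cone (a : Fin 4) : Set ℂ :=
  {z | 0 ≤ z.im ∧ 0 ≤ z.re * (Kind.turn a).2 - z.im * (Kind.turn a).1} ∩ Metric.ball 0 (1 / 5)

namespace Supertile

variable (S : Supertile)

theorem prev_sub (i : Fin 6) : S.pos (S.kind.cyc (i - 1)) - S.pos (S.kind.cyc i) =
    rot (S.kind.angle i) * (S.pos (S.kind.cyc (i + 1)) - S.pos (S.kind.cyc i)) := by
  obtain ⟨h1, h2⟩ := S.kind.turn_spec i
  rw [pos_sub, pos_sub, rot]
  have h1' := congrArg (Int.cast : ℤ → ℂ) h1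
  have h2' := congrArg (Int.cast : ℤ → ℂ) h2
  push_cast at h1' h2' ⊢
  have h5' : (√5 : ℂ) ≠ 0 := by exact_mod_cast (by positivity : √5 ≠ 0)
  field_simp
  linear_combination h1' + I * h2' - ((Kind.turn (S.kind.angle i)).2 : ℂ) *
    ((S.kind.cyc (i + 1)).2 - (S.kind.cyc i).2) * I_sq

theorem norm_next_sub (i : Fin 6) :
    ‖S.pos (S.kind.cyc (i + 1)) - S.pos (S.kind.cyc i)‖ = √5 := by
  have h25 : ((S.kind.cyc (i + 1)).1 - (S.kind.cyc i).1) ^ 2 +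
      ((S.kind.cyc (i + 1)).2 - (S.kind.cyc i).2) ^ 2 = (25 : ℤ) := by
    revert i; cases S.kind <;> decide
  have := S.conj_pos_sub (S.kind.cyc (i + 1)) (S.kind.cyc i) (S.kind.cyc (i + 1)) (S.kind.cyc i)
  rw [← normSq_eq_conj_mul_self] at this
  have h := congrArg re this
  rw [Complex.norm_def]
  congr 1
  simp only [ofReal_re, add_re, mul_re, I_re, I_im, ofReal_im] at h
  rw [h]
  have h25' := congrArg (Int.cast : ℤ → ℝ) h25
  push_cast at h25' ⊢
  linarith

/-- The unit vector along the external edge that starts at the given external vertex. -/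
noncomputable def dir (i : Fin 6) : ℂ :=
  (S.pos (S.kind.cyc (i + 1)) - S.pos (S.kind.cyc i)) / √5

theorem norm_dir (i : Fin 6) : ‖S.dir i‖ = 1 := by
  have h5 : √5 ≠ 0 := by positivity
  rw [dir, norm_div, norm_next_sub, Complex.norm_real, Real.norm_of_nonneg (by positivity),
    div_self h5]

theorem add_dir_mul_mem_region (i : Fin 6) {z : ℂ} (hz : z ∈ cone (S.kind.angle i)) :
    S.pos (S.kind.cyc i) + S.dir i * z ∈ S.region := by
  obtain ⟨⟨h1, h2⟩, h3⟩ := hz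
  rw [mem_ball_zero_iff] at h3
  have h5 : 0 < √5 := by positivity
  have h52 : 2 ≤ √5 := by
    rw [Real.le_sqrt] <;> norm_num
  set s : ℝ := z.re / √5 with hs
  set t : ℝ := z.im / √5 with ht
  have hs1 : |s| ≤ 1 / 10 := by
    rw [hs, abs_div, abs_of_pos h5, div_le_iff₀ h5]
    have := (abs_re_le_norm z).trans_lt h3
    linarith
  have ht1 : |t| ≤ 1 / 10 := by
    rw [ht, abs_div, abs_of_pos h5, div_le_iff₀ h5]
    have := (abs_im_le_norm z).trans_lt h3
    linarith
  have ht0 : 0 ≤ t := div_nonneg h1 h5.le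
  have hst : 0 ≤ s * (Kind.turn (S.kind.angle i)).2 - t * (Kind.turn (S.kind.angle i)).1 := by
    have : s * (Kind.turn (S.kind.angle i)).2 - t * (Kind.turn (S.kind.angle i)).1 =
      (z.re * (Kind.turn (S.kind.angle i)).2 - z.im * (Kind.turn (S.kind.angle i)).1) / √5 := by
      rw [hs, ht]; ring
    rw [this]
    exact div_nonneg h2 h5.le
  set A : ℝ := ((S.kind.cyc (i + 1)).1 : ℝ) - (S.kind.cyc i).1 with hA
  set B : ℝ := ((S.kind.cyc (i + 1)).2 : ℝ) - (S.kind.cyc i).2 with hB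
  have e : S.pos (S.kind.cyc i) + S.dir i * z =
      S.place (pt ((S.kind.cyc i).1 + (A * s - B * t)) ((S.kind.cyc i).2 + (A * t + B * s))) := by
    have hz : z = √5 * (s + t * I) := by
      rw [hs, ht]
      have h5' : (√5 : ℂ) ≠ 0 := by exact_mod_cast h5.ne'
      push_cast
      field_simp
      exact (re_add_im z).symm
    have hpt : ∀ a b : ℝ, pt a b = (a + b * I) / √5 := by
      intro a b; apply Complex.ext <;> simp [pt]
    have h5' : (√5 : ℂ) ≠ 0 := by exact_mod_cast h5.ne'
    rw [dir, pos_sub, hz]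
    simp only [pos, place, hpt, hA, hB]
    push_cast
    field_simp
    linear_combination (S.u : ℂ) * ((S.kind.cyc (i + 1)).2 - (S.kind.cyc i).2) * t * I_sq
  rw [e, mem_region_iff]
  intro j
  obtain ⟨α, β, hα, hβ, hcase⟩ := S.kind.face_near i j
  have hf := S.kind.face_eq_faceInt one_pos j (S.kind.cyc i)
  simp only [Int.cast_one, div_one] at hf
  have hα' := congrArg (Int.cast : ℤ → ℝ) hα
  have hβ' := congrArg (Int.cast : ℤ → ℝ) hβ
  push_cast at hα' hβ'
  have key : S.kind.face j ((S.kind.cyc i).1 + (A * s - B * t)) ((S.kind.cyc i).2 + (A * t + B * s))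
      = S.kind.faceInt 1 j (S.kind.cyc i) + (s * α + t * β) := by
    rw [← hf, hα', hβ']
    simp only [Kind.face, hA, hB]
    ring
  rw [key]
  -- The line of side `j` passes through the vertex along the leaving or the entering side, which
  -- are the two conditions of the cone, or it is far away. In the last case `face` is at least 5
  -- and changes by at most 2.5 + 2.5; this is why the cones have radius 1/5.
  rcases hcase with ⟨h0, ⟨ha, hb⟩ | ⟨ha, hb⟩⟩ | ⟨h0, ha, hb⟩
  · rw [h0, ha, hb]; push_cast; linarith
  · rw [h0, ha, hb]; push_cast; linarith
  · have h0' : (5 : ℝ) ≤ S.kind.faceInt 1 j (S.kind.cyc i) := by exact_mod_cast h0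
    have ha' : |(α : ℝ)| ≤ 25 := by exact_mod_cast ha
    have hb' : |(β : ℝ)| ≤ 25 := by exact_mod_cast hb
    have m1 : |s * α| ≤ 1 / 10 * 25 := by
      rw [abs_mul]; exact mul_le_mul hs1 ha' (abs_nonneg _) (by norm_num)
    have m2 : |t * β| ≤ 1 / 10 * 25 := by
      rw [abs_mul]; exact mul_le_mul ht1 hb' (abs_nonneg _) (by norm_num)
    have := (abs_le.1 m1).1
    have := (abs_le.1 m2).1
    linarith

end Supertile

end Pinwheel

/-! ### The angle sum at an external vertex, by rotations and areas -/

namespace Pinwheel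

open Complex Set MeasureTheory

theorem rot_zero : rot 0 = I := by simp [rot, Kind.turn]

theorem rot_one : rot 1 = -1 := by simp [rot, Kind.turn]

theorem rot_two_mul_rot_three : rot 2 * rot 3 = -1 := by
  simp [rot, Kind.turn]
  linear_combination (16 / 25 : ℂ) * I_sq

/-- Modulo 5 every positive power of 3 + 4i is 3 + 4i again, so its imaginary part never vanishes.
The acute angle of a kite is thus not a rational multiple of π. -/
theorem rot_three_pow_ne_one {n : ℕ} (hn : 0 < n) : rot 3 ^ n ≠ 1 := by
  have key : ∀ n : ℕ, ∃ x y : ℤ, (3 + 4 * I : ℂ) ^ (n + 1) = x + y * I ∧ x % 5 = 3 ∧ y % 5 = 4 := by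
    intro n
    induction n with
    | zero => exact ⟨3, 4, by simp, by norm_num, by norm_num⟩
    | succ n ih =>
      obtain ⟨x, y, h1, h2, h3⟩ := ih
      refine ⟨3 * x - 4 * y, 4 * x + 3 * y, ?_, by omega, by omega⟩
      rw [pow_succ, h1]
      push_cast
      linear_combination (4 * y : ℂ) * I_sq
  intro h
  obtain ⟨m, rfl⟩ := Nat.exists_eq_add_of_le' hn
  obtain ⟨x, y, h1, h2, h3⟩ := key m
  have : (3 + 4 * I : ℂ) ^ (m + 1) = ((5 ^ (m + 1) : ℝ) : ℂ) := by
    have e : (3 + 4 * I : ℂ) = 5 * rot 3 := by simp [rot, Kind.turn]; ring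
    rw [e, mul_pow, h]; push_cast; ring
  rw [h1] at this
  have him := congrArg im this
  rw [ofReal_im] at him
  simp at him
  rw [him] at h3
  norm_num at h3

theorem I_pow_eq_one {n : ℕ} (h : I ^ n = 1) : 4 ∣ n := by
  rw [I_pow_eq_pow_mod] at h
  have h4 : n % 4 < 4 := Nat.mod_lt _ (by norm_num)
  apply Nat.dvd_of_mod_eq_zero
  interval_cases hn : n % 4
  · rfl
  · have := congrArg re h; norm_num at this
  · have := congrArg re h; norm_num at this
  · have := congrArg re h; norm_num [I_pow_three] at this

/-- Rotations through angles of supertiles that compose to the identity. -/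
theorem rot_relation {a b c d : ℕ} (h : rot 0 ^ a * rot 1 ^ b * rot 2 ^ c * rot 3 ^ d = 1) :
    c = d ∧ 4 ∣ a + 2 * b + 2 * c := by
  have hI4 : (I ^ a) ^ 4 = 1 := by rw [← pow_mul, mul_comm, pow_mul, I_pow_four, one_pow]
  have h14 : ((-1 : ℂ) ^ b) ^ 4 = 1 := by rw [← pow_mul, mul_comm, pow_mul]; norm_num
  have hinj : ∀ m n : ℕ, rot 3 ^ m = rot 3 ^ n → m ≤ n → m = n := by
    intro m n hmn hle
    by_contra hne
    have h0 : rot 3 ≠ 0 := by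
      intro h0
      have := rot_two_mul_rot_three
      rw [h0, mul_zero] at this
      norm_num at this
    have : rot 3 ^ (n - m) = 1 := by
      have e : rot 3 ^ m * rot 3 ^ (n - m) = rot 3 ^ m * 1 := by
        rw [← pow_add, Nat.add_sub_of_le hle, hmn, mul_one]
      exact mul_left_cancel₀ (pow_ne_zero _ h0) e
    exact rot_three_pow_ne_one (by omega) this
  -- Fourth powers remove the factors I and -1, and they remove the sign in `rot 2 * rot 3 = -1`.
  -- What remains is a relation between powers of `rot 3`.
  have h4 : rot 3 ^ (4 * d) = rot 3 ^ (4 * c) := by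
    have e1 := congrArg (· ^ 4) h
    simp only [mul_pow, rot_zero, rot_one, hI4, h14, one_mul, one_pow] at e1
    have e2 : (rot 2 * rot 3) ^ (4 * c) = 1 := by
      rw [rot_two_mul_rot_three, pow_mul]; norm_num
    rw [mul_pow] at e2
    have e3 : rot 2 ^ (4 * c) * rot 3 ^ (4 * d) = 1 := by
      rw [← e1, mul_comm 4 c, mul_comm 4 d, pow_mul, pow_mul]
    have h0 : rot 2 ^ (4 * c) ≠ 0 := left_ne_zero_of_mul_eq_one e3
    exact mul_left_cancel₀ h0 (e3.trans e2.symm)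
  have hcd : c = d := by
    rcases le_total c d with hle | hle
    · have := hinj _ _ h4.symm (by omega); omega
    · have := hinj _ _ h4 (by omega); omega
  refine ⟨hcd, I_pow_eq_one ?_⟩
  subst hcd
  rw [← h, mul_assoc, ← mul_pow, rot_two_mul_rot_three, rot_zero, rot_one, pow_add, pow_add,
    pow_mul, pow_mul, I_sq]

theorem measurableSet_cone (a : Fin 4) : MeasurableSet (cone a) := by
  refine MeasurableSet.inter ?_ measurableSet_ball
  refine IsClosed.measurableSet ?_
  exact (isClosed_le continuous_const continuous_im).inter (isClosed_le continuous_const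
    ((continuous_re.mul continuous_const).sub (continuous_im.mul continuous_const)))

theorem volume_preimage_mul_sub {c : ℂ} (hc : ‖c‖ = 1) (v : ℂ) {K : Set ℂ} (hK : MeasurableSet K) :
    volume {w | c * (w - v) ∈ K} = volume K := by
  have h1 := (rotation ⟨c, by simpa [Submonoid.unitSphere] using hc⟩).measurePreserving
  have h2 : MeasurePreserving (fun w : ℂ => w - v) volume volume :=
    measurePreserving_sub_right volume v
  exact (h1.comp h2).measure_preimage hK.nullMeasurableSet

theorem volume_preimage_mul {c : ℂ} (hc : ‖c‖ = 1) {K : Set ℂ} (hK : MeasurableSet K) :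
    volume {w | c * w ∈ K} = volume K := by
  simpa using volume_preimage_mul_sub hc 0 hK

theorem mul_mem_ball {c z : ℂ} {r : ℝ} (hc : ‖c‖ = 1) (hz : z ∈ Metric.ball (0 : ℂ) r) :
    c * z ∈ Metric.ball (0 : ℂ) r := by
  rw [mem_ball_zero_iff] at *
  rwa [norm_mul, hc, one_mul]

/-- Four turned copies of the sector cover the disc. Only this inequality is needed, so the overlap
of the copies along their edges does not matter. -/
theorem volume_ball_le_cone_zero : volume (Metric.ball (0 : ℂ) (1 / 5)) ≤ 4 * volume (cone 0) := by
  have hsub : Metric.ball (0 : ℂ) (1 / 5) ⊆ ({w | 1 * w ∈ cone 0} ∪ {w | I * w ∈ cone 0}) ∪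
      ({w | (-1) * w ∈ cone 0} ∪ {w | (-I) * w ∈ cone 0}) := by
    intro z hz
    have h1 := mul_mem_ball norm_one hz
    have h2 := mul_mem_ball norm_I hz
    have h3 := mul_mem_ball (c := -1) (by simp) hz
    have h4 := mul_mem_ball (c := -I) (by simp) hz
    simp only [mem_union, mem_ofPred_eq, cone, mem_inter_iff, h1, h2, h3, h4, and_true]
    simp [Kind.turn]
    rcases le_total 0 z.re with a | a <;> rcases le_total 0 z.im with b | b
    · exact Or.inl (Or.inl (by constructor <;> linarith))
    · exact Or.inl (Or.inr (by constructor <;> linarith))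
    · exact Or.inr (Or.inr (by constructor <;> linarith))
    · exact Or.inr (Or.inl (by constructor <;> linarith))
  refine (measure_mono hsub).trans ((measure_union_le _ _).trans
    ((add_le_add (measure_union_le _ _) (measure_union_le _ _)).trans (le_of_eq ?_)))
  rw [volume_preimage_mul norm_one (measurableSet_cone 0),
    volume_preimage_mul norm_I (measurableSet_cone 0),
    volume_preimage_mul (by simp) (measurableSet_cone 0),
    volume_preimage_mul (by simp) (measurableSet_cone 0)]
  ring

theorem volume_ball_le_cone_one : volume (Metric.ball (0 : ℂ) (1 / 5)) ≤ 2 * volume (cone 1) := by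
  have hsub : Metric.ball (0 : ℂ) (1 / 5) ⊆ {w | 1 * w ∈ cone 1} ∪ {w | (-1) * w ∈ cone 1} := by
    intro z hz
    have h1 := mul_mem_ball norm_one hz
    have h3 := mul_mem_ball (c := -1) (by simp) hz
    simp only [mem_union, mem_ofPred_eq, cone, mem_inter_iff, h1, h3, and_true]
    simp [Kind.turn]
    rcases le_total 0 z.im with a | a
    · exact Or.inl a
    · exact Or.inr ⟨a, by linarith⟩
  refine (measure_mono hsub).trans ((measure_union_le _ _).trans (le_of_eq ?_))
  rw [volume_preimage_mul norm_one (measurableSet_cone 1),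
    volume_preimage_mul (by simp) (measurableSet_cone 1)]
  ring

theorem volume_ball_le_cone_two_three :
    volume (Metric.ball (0 : ℂ) (1 / 5)) ≤ 2 * (volume (cone 2) + volume (cone 3)) := by
  -- This is the conjugate of `rot 3`; it places the obtuse sector directly after the acute one, and
  -- together they fill a half-disc.
  have hn : ‖((3 : ℂ) - 4 * I) / 5‖ = 1 := by
    rw [norm_div, Complex.norm_def, normSq_apply]
    norm_num
  have hn' : ‖-(((3 : ℂ) - 4 * I) / 5)‖ = 1 := by rw [norm_neg, hn]
  have hsub : Metric.ball (0 : ℂ) (1 / 5) ⊆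
      ({w | ((3 : ℂ) - 4 * I) / 5 * w ∈ cone 2} ∪ {w | 1 * w ∈ cone 3}) ∪
      ({w | -(((3 : ℂ) - 4 * I) / 5) * w ∈ cone 2} ∪ {w | (-1) * w ∈ cone 3}) := by
    intro z hz
    have h1 := mul_mem_ball norm_one hz
    have h2 := mul_mem_ball hn hz
    have h3 := mul_mem_ball (c := -1) (by simp) hz
    have h4 := mul_mem_ball hn' hz
    simp only [mem_union, mem_ofPred_eq, cone, mem_inter_iff, h1, h2, h3, h4, and_true]
    simp [Kind.turn]
    rcases le_total 0 z.im with b | b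
    · rcases le_total 0 (4 * z.re - 3 * z.im) with a | a
      · left; right; constructor <;> linarith
      · left; left; constructor <;> linarith
    · rcases le_total 0 (4 * z.re - 3 * z.im) with a | a
      · right; left; constructor <;> linarith
      · right; right; constructor <;> linarith
  refine (measure_mono hsub).trans ((measure_union_le _ _).trans
    ((add_le_add (measure_union_le _ _) (measure_union_le _ _)).trans (le_of_eq ?_)))
  rw [volume_preimage_mul hn (measurableSet_cone 2),
    volume_preimage_mul norm_one (measurableSet_cone 3),
    volume_preimage_mul hn' (measurableSet_cone 2),
    volume_preimage_mul (by simp) (measurableSet_cone 3)]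
  ring

namespace IsPartitioned

variable {T : Set Triangle} {D : Set Supertile} (h : IsPartitioned T D)
include h

section External

variable {v : ℂ} {idx : Supertile → Fin 6}
  (hidx : ∀ S ∈ D, v ∈ S.region → v = S.pos (S.kind.cyc (idx S)))
include hidx

/-- Moved to `v`, the sectors lie in one disc and in their respective supertiles. Different
supertiles meet only in their frontiers, which are null sets by convexity. -/
theorem sum_volume_cone_le : ∑ S ∈ (h.finite_at v).toFinset, volume (cone (S.kind.angle (idx S))) ≤
    volume (Metric.ball (0 : ℂ) (1 / 5)) := by
  set K : Supertile → Set ℂ := fun S =>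
    {w | (starRingEnd ℂ) (S.dir (idx S)) * (w - v) ∈ cone (S.kind.angle (idx S))} with hK
  have hn : ∀ S : Supertile, ‖(starRingEnd ℂ) (S.dir (idx S))‖ = 1 := fun S => by
    rw [RCLike.norm_conj, S.norm_dir]
  have hvol : ∀ S, volume (K S) = volume (cone (S.kind.angle (idx S))) := fun S =>
    volume_preimage_mul_sub (hn S) v (measurableSet_cone _)
  have hmeas : ∀ S, MeasurableSet (K S) := fun S =>
    (measurableSet_cone _).preimage (by fun_prop : Measurable fun w =>
      (starRingEnd ℂ) (S.dir (idx S)) * (w - v))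
  have hreg : ∀ S ∈ (h.finite_at v).toFinset, K S ⊆ S.region := by
    intro S hS w hw
    obtain ⟨hSD, hvS⟩ := (h.finite_at v).mem_toFinset.1 hS
    have := S.add_dir_mul_mem_region (idx S) hw
    rw [← hidx S hSD hvS] at this
    convert this using 1
    have e : S.dir (idx S) * (starRingEnd ℂ) (S.dir (idx S)) = 1 := by
      rw [mul_conj, normSq_eq_norm_sq, S.norm_dir]; norm_num
    linear_combination (v - w) * e
  have hball : ∀ S, K S ⊆ Metric.ball v (1 / 5) := by
    intro S w hw
    have := hw.2
    rw [mem_ball_zero_iff, norm_mul, hn, one_mul] at this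
    rwa [Metric.mem_ball, dist_eq]
  have hdisj : Set.Pairwise ↑(h.finite_at v).toFinset (Function.onFun (AEDisjoint volume) K) := by
    intro S hS S' hS' hne
    refine measure_mono_null (t := frontier S.region) ?_ (S.convex_region.addHaar_frontier volume)
    rintro w ⟨hw, hw'⟩
    rw [S.isClosed_region.frontier_eq]
    refine ⟨hreg S hS hw, fun hi => hne ?_⟩
    exact h.eq_of_mem_interior ((h.finite_at v).mem_toFinset.1 hS).1
      ((h.finite_at v).mem_toFinset.1 hS').1 hi (hreg S' hS' hw')
  calc ∑ S ∈ (h.finite_at v).toFinset, volume (cone (S.kind.angle (idx S)))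
      = ∑ S ∈ (h.finite_at v).toFinset, volume (K S) := by simp only [hvol]
    _ = volume (⋃ S ∈ (h.finite_at v).toFinset, K S) :=
        (measure_biUnion_finset₀ hdisj fun S _ => (hmeas S).nullMeasurableSet).symm
    _ ≤ volume (Metric.ball v (1 / 5)) := measure_mono (iUnion₂_subset fun S _ => hball S)
    _ = volume (Metric.ball (0 : ℂ) (1 / 5)) := Measure.addHaar_ball_center _ _ _

/-- A side that leaves `v` in one supertile enters `v` in another, so the next vertices `N` and the
previous vertices `M`, taken over all supertiles at `v`, form the same set. Each `M S - v` is `N S -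
v` turned by the angle of `S`; multiplying over all `S` and cancelling leaves the product of the
rotations. -/
theorem prod_rot_eq_one : ∏ S ∈ (h.finite_at v).toFinset, rot (S.kind.angle (idx S)) = 1 := by
  classical
  set A := (h.finite_at v).toFinset with hA
  have hmem : ∀ S, S ∈ A ↔ S ∈ D ∧ v ∈ S.region := fun S => (h.finite_at v).mem_toFinset
  have hv : ∀ S ∈ A, v = S.pos (S.kind.cyc (idx S)) := fun S hS =>
    hidx S ((hmem S).1 hS).1 ((hmem S).1 hS).2
  have hcyc : ∀ S : Supertile, ∀ i, S.pos (S.kind.cyc i) ∈ S.region := fun S i =>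
    S.pos_mem_region (List.mem_append_left _ (List.mem_ofFn.2 ⟨i, rfl⟩))
  have hout : ∀ S : Supertile, ∀ i, (S.kind.cyc i, S.kind.cyc (i + 1), 3) ∈ S.kind.out :=
    fun S i => Kind.mem_out.2 (Or.inl ⟨i, rfl⟩)
  have hidx' : ∀ S ∈ D, ∀ i, v = S.pos (S.kind.cyc i) → S ∈ A ∧ idx S = i := by
    intro S hS i hi
    have hSA : S ∈ A := (hmem S).2 ⟨hS, hi ▸ hcyc S i⟩
    exact ⟨hSA, S.kind.cyc_injective (S.pos_injective ((hv S hSA).symm.trans hi))⟩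
  set N : Supertile → ℂ := fun S => S.pos (S.kind.cyc (idx S + 1)) with hN
  set M : Supertile → ℂ := fun S => S.pos (S.kind.cyc (idx S - 1)) with hM
  have hNinj : Set.InjOn N A := by
    intro S hS S' hS' e
    exact (h.out_eq ((hmem S).1 hS).1 ((hmem S').1 hS').1 (hout S (idx S)) (hout S' (idx S'))
      ((hv S hS).symm.trans (hv S' hS')) e).1
  have hMinj : Set.InjOn M A := by
    intro S hS S' hS' e
    refine (h.out_eq ((hmem S).1 hS).1 ((hmem S').1 hS').1 (hout S (idx S - 1))
      (hout S' (idx S' - 1)) e ?_).1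
    simp only [sub_add_cancel]
    exact (hv S hS).symm.trans (hv S' hS')
  have himage : A.image N = A.image M := by
    ext z
    simp only [Finset.mem_image]
    constructor
    · rintro ⟨S, hS, rfl⟩
      obtain ⟨S', hS', j, h1, h2⟩ := h.exists_reverse ((hmem S).1 hS).1 (idx S)
      obtain ⟨hA', hj⟩ := hidx' S' hS' (j + 1) ((hv S hS).trans h2.symm)
      refine ⟨S', hA', ?_⟩
      simp only [hM, hN, hj, add_sub_cancel_right]
      exact h1
    · rintro ⟨S, hS, rfl⟩
      obtain ⟨S', hS', j, h1, h2⟩ := h.exists_reverse ((hmem S).1 hS).1 (idx S - 1)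
      rw [sub_add_cancel] at h1
      obtain ⟨hA', hj⟩ := hidx' S' hS' j ((hv S hS).trans h1.symm)
      refine ⟨S', hA', ?_⟩
      simp only [hM, hN, hj]
      exact h2
  have hprod : ∏ S ∈ A, (N S - v) = ∏ S ∈ A, (M S - v) := by
    rw [← Finset.prod_image (f := fun z => z - v) hNinj,
      ← Finset.prod_image (f := fun z => z - v) hMinj, himage]
  have hne : ∀ S ∈ A, N S - v ≠ 0 := by
    intro S hS h0
    rw [hv S hS, sub_eq_zero] at h0
    exact S.kind.cyc_ne _ (S.pos_injective h0)
  have hrot : ∏ S ∈ A, (M S - v) =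
      (∏ S ∈ A, rot (S.kind.angle (idx S))) * ∏ S ∈ A, (N S - v) := by
    rw [← Finset.prod_mul_distrib]
    refine Finset.prod_congr rfl fun S hS => ?_
    rw [hv S hS]
    exact S.prev_sub (idx S)
  rw [← hprod] at hrot
  exact (mul_right_cancel₀ (Finset.prod_ne_zero_iff.2 hne) ((one_mul _).trans hrot)).symm

/-- The angles at an external vertex: the numbers of right, straight, obtuse and acute ones. -/
theorem exists_angle_count : ∃ a b c : ℕ, a + 2 * b + 2 * c = 4 ∧ ∀ f : Fin 4 → ℕ,
    ∑ S ∈ (h.finite_at v).toFinset, f (S.kind.angle (idx S)) =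
      a * f 0 + b * f 1 + c * f 2 + c * f 3 := by
  classical
  set A := (h.finite_at v).toFinset with hA
  set n : Fin 4 → ℕ := fun j => (A.filter fun S => S.kind.angle (idx S) = j).card with hn
  have hsum : ∀ {M : Type} [AddCommMonoid M] (f : Fin 4 → M),
      ∑ S ∈ A, f (S.kind.angle (idx S)) = n 0 • f 0 + n 1 • f 1 + n 2 • f 2 + n 3 • f 3 := by
    intro M _ f
    rw [← Finset.sum_fiberwise A fun S => S.kind.angle (idx S), Fin.sum_univ_four]
    have : ∀ j, ∑ S ∈ A with S.kind.angle (idx S) = j, f (S.kind.angle (idx S)) = n j • f j := by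
      intro j
      rw [hn, ← Finset.sum_const]
      exact Finset.sum_congr rfl fun S hS => by rw [(Finset.mem_filter.1 hS).2]
    simp only [this]
  have hprod : ∏ S ∈ A, rot (S.kind.angle (idx S)) =
      rot 0 ^ n 0 * rot 1 ^ n 1 * rot 2 ^ n 2 * rot 3 ^ n 3 := by
    rw [← Finset.prod_fiberwise A fun S => S.kind.angle (idx S), Fin.prod_univ_four]
    have : ∀ j, ∏ S ∈ A with S.kind.angle (idx S) = j, rot (S.kind.angle (idx S)) =
        rot j ^ n j := by
      intro j
      rw [hn, ← Finset.prod_const]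
      exact Finset.prod_congr rfl fun S hS => by rw [(Finset.mem_filter.1 hS).2]
    simp only [this]
  -- The rotations determine the angle sum only up to full turns, and they match obtuse with acute
  -- angles. The areas bound it by one full turn, and at least one supertile contains `v`, so the
  -- multiple of 4 is exactly 4.
  obtain ⟨hcd, hdvd⟩ := rot_relation (hprod.symm.trans (h.prod_rot_eq_one hidx))
  have hvol := h.sum_volume_cone_le hidx
  rw [← hA, hsum (fun j => volume (cone j)), ← hcd] at hvol
  set V := volume (Metric.ball (0 : ℂ) (1 / 5)) with hV
  have hVtop : V ≠ ⊤ := measure_ball_lt_top.ne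
  have hVpos : 0 < V.toReal :=
    ENNReal.toReal_pos (Metric.measure_ball_pos _ _ (by norm_num)).ne' hVtop
  have hfin : ∀ j, volume (cone j) ≠ ⊤ := fun j =>
    ne_top_of_le_ne_top hVtop (measure_mono inter_subset_right)
  have e0 := volume_ball_le_cone_zero
  have e1 := volume_ball_le_cone_one
  have e2 := volume_ball_le_cone_two_three
  rw [← hV] at e0 e1 e2
  have f0 := hfin 0
  have f1 := hfin 1
  have f2 := hfin 2
  have f3 := hfin 3
  lift volume (cone 0) to NNReal using f0 with w0
  lift volume (cone 1) to NNReal using f1 with w1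
  lift volume (cone 2) to NNReal using f2 with w2
  lift volume (cone 3) to NNReal using f3 with w3
  lift V to NNReal using hVtop with V'
  simp only [nsmul_eq_mul] at hvol
  norm_cast at hvol e0 e1 e2
  rw [← NNReal.coe_le_coe] at hvol e0 e1 e2
  push_cast at hvol e0 e1 e2
  rw [ENNReal.coe_toReal] at hVpos
  have hle : ((n 0 + 2 * n 1 + 2 * n 2 : ℕ) : ℝ) ≤ 4 := by
    push_cast
    refine le_of_mul_le_mul_right ?_ hVpos
    have g0 := mul_le_mul_of_nonneg_left e0 (Nat.cast_nonneg (α := ℝ) (n 0))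
    have g1 := mul_le_mul_of_nonneg_left e1 (Nat.cast_nonneg (α := ℝ) (n 1))
    have g2 := mul_le_mul_of_nonneg_left e2 (Nat.cast_nonneg (α := ℝ) (n 2))
    linarith
  have hle' : n 0 + 2 * n 1 + 2 * n 2 ≤ 4 := by exact_mod_cast hle
  have hpos : n 0 + 2 * n 1 + 2 * n 2 ≠ 0 := by
    intro h0
    obtain ⟨S, hS, hvS⟩ := h.exists_mem v
    have hc := hsum (fun _ => 1)
    rw [← hcd, show n 0 = 0 by omega, show n 1 = 0 by omega, show n 2 = 0 by omega] at hc
    simp at hc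
    have : S ∈ A := (h.finite_at v).mem_toFinset.2 ⟨hS, hvS⟩
    simp [hc] at this
  refine ⟨n 0, n 1, n 2, by omega, fun f => ?_⟩
  rw [hsum f, ← hcd]
  simp only [smul_eq_mul]

end External

end IsPartitioned

end Pinwheel

/-! ### Vertex sums and the 1-2-3 property -/

namespace Pinwheel

open Complex Set

theorem Kind.out_spec_verts (k : Kind) {e : (ℤ × ℤ) × (ℤ × ℤ) × ℕ} (he : e ∈ k.out) :
    e.1 ∈ k.verts ∧ e.2.1 ∈ k.verts :=
  ⟨(k.out_spec e he).2.1, (k.out_spec e he).2.2.1⟩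

theorem Kind.mem_verts (k : Kind) {p : ℤ × ℤ} (hp : p ∈ k.verts) :
    (∃ i, p = k.cyc i) ∨ p ∈ k.inn := by
  rcases List.mem_append.1 hp with h | h
  · obtain ⟨i, hi⟩ := List.mem_ofFn.1 h
    exact Or.inl ⟨i, hi.symm⟩
  · exact Or.inr h

namespace IsPartitioned

variable {T : Set Triangle} {D : Set Supertile} (h : IsPartitioned T D)
include h

/-- A vertex that is external to one supertile is external, with the same colour, to all. -/
theorem exists_idx {S : Supertile} (hS : S ∈ D) (i : Fin 6) {v : ℂ}
    (hv : v = S.pos (S.kind.cyc i)) : ∃ idx : Supertile → Fin 6,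
      ∀ S' ∈ D, v ∈ S'.region → (idx S').val % 2 = i.val % 2 ∧
        v = S'.pos (S'.kind.cyc (idx S')) := by
  have : ∀ S' : Supertile, ∃ j : Fin 6, S' ∈ D → v ∈ S'.region → j.val % 2 = i.val % 2 ∧
      v = S'.pos (S'.kind.cyc j) := by
    intro S'
    by_cases hS' : S' ∈ D ∧ v ∈ S'.region
    · obtain ⟨j, h1, h2⟩ := h.cyc_fits hS'.1 hS (i := i) (hv ▸ hS'.2)
      exact ⟨j, fun _ _ => ⟨h1, hv.trans h2⟩⟩
    · exact ⟨0, fun h1 h2 => (hS' ⟨h1, h2⟩).elim⟩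
  choose idx hidx using this
  exact ⟨idx, fun S' h1 h2 => hidx S' h1 h2⟩

/-- Substituting a = 4 - 2b - 2c in 4a + 6b + 8c gives 16 - 2b, and b is at most 2. The lower bound
separates red vertices from internal ones. -/
theorem weightedDegree_red {l : (graph T).edgeSet → ℕ} (hl : FollowsRules T D l) {v : vertices T}
    {S : Supertile} (hS : S ∈ D) {i : Fin 6} (hi : i.val % 2 = 1)
    (hv : (v : ℂ) = S.pos (S.kind.cyc i)) :
    12 ≤ weightedDegree l v ∧ weightedDegree l v ≤ 16 := by
  obtain ⟨idx, hidx⟩ := h.exists_idx hS i hv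
  obtain ⟨a, b, c, hN, hf⟩ := h.exists_angle_count fun S' hS' hvS' => (hidx S' hS' hvS').2
  have e : weightedDegree l v = a * 4 + b * 6 + c * 4 + c * 4 := by
    rw [h.weightedDegree_eq hl v (fun S' => S'.kind.cyc (idx S'))
      fun S' hS' hvS' => (hidx S' hS' hvS').2]
    refine (Finset.sum_congr rfl fun S' hS' => ?_).trans (hf ![4, 6, 4, 4])
    obtain ⟨h1, h2⟩ := (h.finite_at v).mem_toFinset.1 hS'
    exact S'.kind.outSum_red _ ((hidx S' h1 h2).1.trans hi)
  omega

/-- Here 5a + 9b + 10c becomes 20 - b with b at most 2. -/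
theorem weightedDegree_blue {l : (graph T).edgeSet → ℕ} (hl : FollowsRules T D l)
    {v : vertices T} {S : Supertile} (hS : S ∈ D) {i : Fin 6} (hi : i.val % 2 = 0)
    (hv : (v : ℂ) = S.pos (S.kind.cyc i)) : 18 ≤ weightedDegree l v := by
  obtain ⟨idx, hidx⟩ := h.exists_idx hS i hv
  obtain ⟨a, b, c, hN, hf⟩ := h.exists_angle_count fun S' hS' hvS' => (hidx S' hS' hvS').2
  have e : weightedDegree l v = a * 5 + b * 9 + c * 5 + c * 5 := by
    rw [h.weightedDegree_eq hl v (fun S' => S'.kind.cyc (idx S'))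
      fun S' hS' hvS' => (hidx S' hS' hvS').2]
    refine (Finset.sum_congr rfl fun S' hS' => ?_).trans (hf ![5, 9, 5, 5])
    obtain ⟨h1, h2⟩ := (h.finite_at v).mem_toFinset.1 hS'
    exact S'.kind.outSum_blue _ ((hidx S' h1 h2).1.trans hi)
  omega

theorem isVertexColouring {l : (graph T).edgeSet → ℕ} (hl : FollowsRules T D l) :
    IsVertexColouring l := by
  intro v w hvw
  obtain ⟨S, hS, e, he, hv, hw⟩ := h.exists_mem_out hvw
  have hge : ∀ {v : vertices T} {i : Fin 6}, (v : ℂ) = S.pos (S.kind.cyc i) →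
      12 ≤ weightedDegree l v := by
    intro v i hv
    rcases Nat.mod_two_eq_zero_or_one i.val with hi | hi
    · exact le_trans (by norm_num) (h.weightedDegree_blue hl hS hi hv)
    · exact (h.weightedDegree_red hl hS hi hv).1
  have hle : ∀ {v : vertices T} {p : ℤ × ℤ}, (v : ℂ) = S.pos p → p ∈ S.kind.inn →
      weightedDegree l v ≤ 9 := by
    intro v p hv hp
    rw [h.weightedDegree_inn hl hS hp hv]
    exact S.kind.outSum_inn_le p hp
  obtain ⟨m1, m2⟩ := S.kind.out_spec_verts he
  rcases S.kind.mem_verts m1 with ⟨i, hi⟩ | h1 <;> rcases S.kind.mem_verts m2 with ⟨j, hj⟩ | h2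
  · have hij := S.kind.out_cyc e he i hi j hj
    rw [hi] at hv
    rw [hj] at hw
    rcases Nat.mod_two_eq_zero_or_one i.val with i2 | i2 <;>
      rcases Nat.mod_two_eq_zero_or_one j.val with j2 | j2
    · exact (hij (i2.trans j2.symm)).elim
    · have := h.weightedDegree_blue hl hS i2 hv
      have := (h.weightedDegree_red hl hS j2 hw).2
      omega
    · have := h.weightedDegree_blue hl hS j2 hw
      have := (h.weightedDegree_red hl hS i2 hv).2
      omega
    · exact (hij (i2.trans j2.symm)).elim
  · have := hge (hv.trans (by rw [hi]))
    have := hle hw h2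
    omega
  · have := hge (hw.trans (by rw [hj]))
    have := hle hv h1
    omega
  · rw [h.weightedDegree_inn hl hS h1 hv, h.weightedDegree_inn hl hS h2 hw]
    exact S.kind.outSum_inn_ne e he h1 h2

theorem isOneTwoThreeSolution {l : (graph T).edgeSet → ℕ} (hl : FollowsRules T D l) :
    IsOneTwoThreeSolution l :=
  ⟨h.finite_neighborSet, h.isEdgeLabelling hl, h.isVertexColouring hl⟩

end IsPartitioned

end Pinwheel

namespace Pinwheel

open Complex Set

/-! ## Sides of pinwheel triangles -/

/-- The set `K` contains a flat isosceles triangle with the base from `x` to `y`, on the left for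
`δ = 1` and on the right for `δ = -1`. -/
def Flank (K : Set ℂ) (x y : ℂ) (δ : ℝ) : Prop :=
  ∀ σ τ : ℝ, 0 ≤ τ → 5 * τ ≤ σ → 5 * τ ≤ 1 - σ → x + (σ + δ * τ * I) * (y - x) ∈ K

namespace Flank

variable {K K' : Set ℂ} {x y : ℂ} {δ : ℝ}

theorem symm (h : Flank K x y δ) : Flank K y x (-δ) := by
  intro σ τ h0 h1 h2
  have := h (1 - σ) τ h0 h2 (by linarith)
  convert this using 1
  push_cast
  ring

theorem eq_add (hxy : x ≠ y) (z : ℂ) :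
    z = x + ((((z - x) / (y - x)).re : ℝ) + (((z - x) / (y - x)).im : ℝ) * I) * (y - x) := by
  rw [re_add_im, div_mul_cancel₀ _ (sub_ne_zero.2 hxy.symm)]
  ring

theorem continuous_div (x y : ℂ) : Continuous fun z : ℂ => (z - x) / (y - x) := by fun_prop

theorem mem_interior (h : Flank K x y δ) (hxy : x ≠ y) (hδ : δ = 1 ∨ δ = -1) {σ τ : ℝ}
    (h0 : 0 < τ) (h1 : 5 * τ < σ) (h2 : 5 * τ < 1 - σ) :
    x + (σ + δ * τ * I) * (y - x) ∈ interior K := by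
  have hδ2 : δ * δ = 1 := by rcases hδ with rfl | rfl <;> norm_num
  have hre := continuous_re.comp (continuous_div x y)
  have him := (continuous_im.comp (continuous_div x y)).const_mul δ
  refine interior_maximal (t := {z | 0 < δ * ((z - x) / (y - x)).im} ∩
    ({z | 5 * (δ * ((z - x) / (y - x)).im) < ((z - x) / (y - x)).re} ∩
      {z | 5 * (δ * ((z - x) / (y - x)).im) < 1 - ((z - x) / (y - x)).re})) ?_ ?_ ?_
  · rintro z ⟨hz0, hz1, hz2⟩
    have := h _ _ (le_of_lt hz0) (le_of_lt hz1) (le_of_lt hz2)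
    rw [eq_add hxy z]
    convert this using 4
    push_cast
    rw [← mul_assoc, ← ofReal_mul, hδ2]
    simp
  · exact (isOpen_lt continuous_const him).inter ((isOpen_lt (him.const_mul 5) hre).inter
      (isOpen_lt (him.const_mul 5) (continuous_const.sub hre)))
  · have e : (x + (σ + δ * τ * I) * (y - x) - x) / (y - x) = σ + δ * τ * I := by
      rw [add_sub_cancel_left, mul_div_cancel_right₀ _ (sub_ne_zero.2 hxy.symm)]
    have e1 : ((σ : ℂ) + δ * τ * I).re = σ := by simp
    have e2 : δ * ((σ : ℂ) + δ * τ * I).im = τ := by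
      simp [← mul_assoc, hδ2]
    simp only [mem_inter_iff, mem_ofPred_eq, e, e1, e2]
    exact ⟨h0, h1, h2⟩

/-- The two flat triangles form a rhombus with the segment as a diagonal, and the relative interior
of the diagonal is interior to it. -/
theorem union_mem_interior (h : Flank K x y δ) (h' : Flank K' x y (-δ)) (hxy : x ≠ y)
    (hδ : δ = 1 ∨ δ = -1) {z : ℂ} (hz : z ∈ openSegment ℝ x y) : z ∈ interior (K ∪ K') := by
  wlog hδ1 : δ = 1 generalizing δ K K'
  · rw [union_comm]
    refine this (δ := -δ) h' (by rwa [neg_neg]) ?_ ?_ <;> rcases hδ with rfl | rfl <;> simp at *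
  subst hδ1
  have hre := continuous_re.comp (continuous_div x y)
  have him := (continuous_im.comp (continuous_div x y)).abs
  refine interior_maximal (t := {z | 5 * |((z - x) / (y - x)).im| < ((z - x) / (y - x)).re} ∩
      {z | 5 * |((z - x) / (y - x)).im| < 1 - ((z - x) / (y - x)).re}) ?_ ?_ ?_
  · rintro z ⟨hz1, hz2⟩
    simp only [mem_ofPred_eq] at hz1 hz2
    rw [eq_add hxy z]
    rcases le_total 0 ((z - x) / (y - x)).im with h0 | h0
    · rw [abs_of_nonneg h0] at hz1 hz2
      refine Or.inl ?_
      have := h _ _ h0 hz1.le hz2.le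
      simpa using this
    · rw [abs_of_nonpos h0] at hz1 hz2
      refine Or.inr ?_
      have := h' _ _ (neg_nonneg.2 h0) hz1.le hz2.le
      simpa using this
  · exact (isOpen_lt (him.const_mul 5) hre).inter
      (isOpen_lt (him.const_mul 5) (continuous_const.sub hre))
  · obtain ⟨s, hs0, hs1, rfl⟩ := mem_openSegment_iff_exists.1 hz
    have e : (x + (s : ℂ) * (y - x) - x) / (y - x) = s := by
      rw [add_sub_cancel_left, mul_div_cancel_right₀ _ (sub_ne_zero.2 hxy.symm)]
    simp only [mem_inter_iff, mem_ofPred_eq, e, ofReal_re, ofReal_im, abs_zero]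
    constructor <;> linarith

end Flank

/-- The relative interior of the segment between the points of an unordered pair. -/
def openSeg (e : Sym2 ℂ) : Set ℂ :=
  Sym2.lift ⟨fun x y => openSegment ℝ x y, fun x y => openSegment_symm ℝ x y⟩ e

namespace Triangle

/-- The coordinates of the endpoints of the hypotenuse, the short leg and the two halves of the
long leg. -/
def sidePts : Fin 4 → (ℝ × ℝ) × ℝ × ℝ :=
  ![((5, 0), 0, 10), ((0, 0), 5, 0), ((0, 0), 0, 5), ((0, 5), 0, 10)]

noncomputable def src (t : Triangle) (j : Fin 4) : ℂ := t.frame (sidePts j).1.1 (sidePts j).1.2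

noncomputable def tgt (t : Triangle) (j : Fin 4) : ℂ := t.frame (sidePts j).2.1 (sidePts j).2.2

/-- The hypotenuse, the short leg and the two halves of the long leg. -/
noncomputable def side (t : Triangle) (j : Fin 4) : Sym2 ℂ := s(t.src j, t.tgt j)

/-- The corners and the midpoint of the long leg. -/
def verts (t : Triangle) : Set ℂ := {t.a, t.b, t.c, t.frame 0 5}

theorem mem_verts {t : Triangle} {z : ℂ} :
    z ∈ t.verts ↔ z = t.a ∨ z = t.b ∨ z = t.c ∨ z = t.frame 0 5 := by
  simp [verts]

theorem src_mem_verts (t : Triangle) (j : Fin 4) : t.src j ∈ t.verts := by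
  rw [mem_verts]
  fin_cases j <;> simp [src, sidePts, frame_a, frame_b]

theorem tgt_mem_verts (t : Triangle) (j : Fin 4) : t.tgt j ∈ t.verts := by
  rw [mem_verts]
  fin_cases j <;> simp [tgt, sidePts, frame_b, frame_c]

section Std

variable {ε : ℝ} {a u : ℂ} (hε : ε = 1 ∨ ε = -1) (hu : u ≠ 0)
include hε hu

/-- The slope 1/5 of the flat triangles is below the smallest slope met at a side, the 1/2 at the
acute corner, so they fit on each of the four sides. -/
theorem flank_std (j : Fin 4) : ∃ δ : ℝ, (δ = 1 ∨ δ = -1) ∧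
    Flank (std ε a u).region ((std ε a u).src j) ((std ε a u).tgt j) δ := by
  have hε2 : (ε : ℂ) * ε = 1 := by rcases hε with rfl | rfl <;> norm_num
  have hI := I_mul_I
  have key : ∀ {X Y : ℝ} {z : ℂ}, z = (std ε a u).frame X Y → 0 ≤ X → 0 ≤ Y → 2 * X + Y ≤ 10 →
      z ∈ (std ε a u).region := fun hz h1 h2 h3 =>
    hz ▸ (frame_mem_region_std hε hu).2 ⟨h1, h2, h3⟩
  fin_cases j
  · refine ⟨ε, hε, fun σ τ h0 h1 h2 => key (X := 5 * (1 - σ - 2 * τ)) (Y := 5 * (2 * σ - τ)) ?_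
      (by linarith) (by linarith) (by linarith)⟩
    simp [src, tgt, sidePts, frame_std]
    linear_combination (2 * τ * u * (ε * ε)) * hI - 2 * τ * u * hε2
  · refine ⟨ε, hε, fun σ τ h0 h1 h2 => key (X := 5 * σ) (Y := 5 * τ) ?_
      (by linarith) (by linarith) (by linarith)⟩
    simp [src, tgt, sidePts, frame_std]
    ring
  · refine ⟨-ε, by rcases hε with rfl | rfl <;> simp, fun σ τ h0 h1 h2 =>
      key (X := 5 * τ) (Y := 5 * σ) ?_ (by linarith) (by linarith) (by linarith)⟩
    simp [src, tgt, sidePts, frame_std]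
    linear_combination (-τ * u * (ε * ε)) * hI + τ * u * hε2
  · refine ⟨-ε, by rcases hε with rfl | rfl <;> simp, fun σ τ h0 h1 h2 =>
      key (X := 5 * τ) (Y := 5 * (1 + σ)) ?_ (by linarith) (by linarith) (by linarith)⟩
    simp [src, tgt, sidePts, frame_std]
    linear_combination (-τ * u * (ε * ε)) * hI + τ * u * hε2

theorem notMem_openSegment_std {v : ℂ} (hv : v ∈ (std ε a u).verts) (j : Fin 4) :
    v ∉ openSegment ℝ ((std ε a u).src j) ((std ε a u).tgt j) := by
  intro hmem
  obtain ⟨s, hs0, hs1, hs⟩ := mem_openSegment_iff_exists.1 hmem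
  rw [src, tgt, frame_lerp] at hs
  rw [mem_verts, ← frame_a, ← frame_b, ← frame_c] at hv
  rcases hv with rfl | rfl | rfl | rfl <;>
    (obtain ⟨h1, h2⟩ := frame_std_injective hε hu hs
     fin_cases j <;> simp [sidePts] at h1 h2 <;>
      first | linarith | (rcases h2 with h2 | h2 <;> linarith))

theorem src_ne_tgt_std (j : Fin 4) : (std ε a u).src j ≠ (std ε a u).tgt j := by
  intro hmem
  obtain ⟨h1, h2⟩ := frame_std_injective hε hu hmem
  fin_cases j <;> simp [sidePts] at h1 h2

end Std

namespace IsPinwheel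

variable {s : ℝ} {t : Triangle} (hs : 0 < s) (h : t.IsPinwheel s)
include hs h

theorem exists_std' : ∃ (ε : ℝ) (u : ℂ), (ε = 1 ∨ ε = -1) ∧ u ≠ 0 ∧ t = std ε t.a u := by
  obtain ⟨ε, u, hε, hu, e⟩ := h.exists_std hs
  exact ⟨ε, u, hε, by rintro rfl; simp at hu; linarith, e⟩

theorem flank (j : Fin 4) : ∃ δ : ℝ, (δ = 1 ∨ δ = -1) ∧ Flank t.region (t.src j) (t.tgt j) δ := by
  obtain ⟨ε, u, hε, hu, e⟩ := h.exists_std' hs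
  rw [e]
  exact flank_std hε hu j

theorem src_ne_tgt (j : Fin 4) : t.src j ≠ t.tgt j := by
  obtain ⟨ε, u, hε, hu, e⟩ := h.exists_std' hs
  rw [e]
  exact src_ne_tgt_std hε hu j

theorem notMem_openSeg {v : ℂ} (hv : v ∈ t.verts) (j : Fin 4) : v ∉ openSeg (t.side j) := by
  obtain ⟨ε, u, hε, hu, e⟩ := h.exists_std' hs
  rw [e] at hv ⊢
  exact notMem_openSegment_std hε hu hv j

theorem mem_interior_or_mem_verts {z : ℂ} (hz : z ∈ t.region) :
    z ∈ interior t.region ∨ z ∈ t.verts ∨ ∃ j, z ∈ openSeg (t.side j) := by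
  have key : ∀ j, z ∈ segment ℝ (t.src j) (t.tgt j) →
      z ∈ t.verts ∨ ∃ j, z ∈ openSeg (t.side j) := by
    intro j hj
    rw [← insert_endpoints_openSegment] at hj
    rcases hj with rfl | rfl | hj
    · exact Or.inl (t.src_mem_verts j)
    · exact Or.inl (t.tgt_mem_verts j)
    · exact Or.inr ⟨j, hj⟩
  rcases h.mem_interior_or_mem_segment hs hz with h1 | h1 | h1 | h1 | h1
  · exact Or.inl h1
  · exact Or.inr (key 0 (by simpa [src, tgt, sidePts, frame_b, frame_c] using h1))
  · exact Or.inr (key 1 (by simpa [src, tgt, sidePts, frame_a, frame_b] using h1))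
  · exact Or.inr (key 2 (by simpa [src, tgt, sidePts, frame_a] using h1))
  · exact Or.inr (key 3 (by simpa [src, tgt, sidePts, frame_c] using h1))

/-- Two triangles with disjoint interiors and a common side are on different sides of it. -/
theorem flank_neg {t' : Triangle} (h' : t'.IsPinwheel s)
    (hdisj : Disjoint (interior t.region) (interior t'.region)) {j j' : Fin 4}
    (e : t'.side j' = t.side j) {δ : ℝ} (hδ : δ = 1 ∨ δ = -1)
    (hf : Flank t.region (t.src j) (t.tgt j) δ) :
    Flank t'.region (t.src j) (t.tgt j) (-δ) := by
  obtain ⟨δ', hδ', hf'⟩ := h'.flank hs j'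
  have hne := h.src_ne_tgt hs j
  have : ∃ δ' : ℝ, (δ' = 1 ∨ δ' = -1) ∧ Flank t'.region (t.src j) (t.tgt j) δ' := by
    rcases Sym2.eq_iff.1 e with ⟨e1, e2⟩ | ⟨e1, e2⟩
    · exact ⟨δ', hδ', by rwa [e1, e2] at hf'⟩
    · exact ⟨-δ', by rcases hδ' with rfl | rfl <;> simp, by
        have := hf'.symm; rwa [e1, e2] at this⟩
  obtain ⟨δ', hδ', hf'⟩ := this
  have hneq : δ' ≠ δ := by
    rintro rfl
    have h1 := hf.mem_interior hne hδ (σ := 1 / 2) (τ := 1 / 20) (by norm_num) (by norm_num)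
      (by norm_num)
    have h2 := hf'.mem_interior hne hδ (σ := 1 / 2) (τ := 1 / 20) (by norm_num) (by norm_num)
      (by norm_num)
    exact disjoint_left.1 hdisj h1 h2
  have : δ' = -δ := by
    rcases hδ with rfl | rfl <;> rcases hδ' with rfl | rfl <;> simp at *
  rwa [← this]

end IsPinwheel

end Triangle

end Pinwheel

namespace Pinwheel

open Complex Set

/-! ## Common sides in dissections -/

namespace Triangle

theorem frame_frame (t : Triangle) (i₁ j₁ i₂ j₂ i₃ j₃ x y : ℝ) :
    (⟨t.frame i₁ j₁, t.frame i₂ j₂, t.frame i₃ j₃⟩ : Triangle).frame x y =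
      t.frame (i₁ + x / 5 * (i₂ - i₁) + y / 10 * (i₃ - i₁))
        (j₁ + x / 5 * (j₂ - j₁) + y / 10 * (j₃ - j₁)) := by
  simp only [frame, real_smul]
  push_cast
  ring

/-- One of the five segments into which the dissection divides the hypotenuse. -/
noncomputable def hypPart (t : Triangle) (k : Fin 5) : Sym2 ℂ :=
  s(t.frame (5 - k.val) (2 * k.val), t.frame (4 - k.val) (2 * k.val + 2))

theorem hypPart_eq (t : Triangle) (k : Fin 5) : t.hypPart k =
    s(t.src 0 + (k.val / 5 : ℝ) * (t.tgt 0 - t.src 0),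
      t.src 0 + ((k.val + 1) / 5 : ℝ) * (t.tgt 0 - t.src 0)) := by
  rw [src, tgt, frame_lerp, frame_lerp, hypPart]
  congr 2 <;> simp [sidePts] <;> ring_nf

theorem hypPart_subset (t : Triangle) (k : Fin 5) : openSeg (t.hypPart k) ⊆ openSeg (t.side 0) := by
  intro z hz
  rw [hypPart_eq] at hz
  obtain ⟨r, h0, h1, rfl⟩ := mem_openSegment_iff_exists.1 hz
  have hk0 : (0 : ℝ) ≤ k.val := Nat.cast_nonneg _
  have hk1 : (k.val : ℝ) ≤ 4 := by exact_mod_cast Nat.lt_succ_iff.1 k.isLt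
  exact mem_openSegment_iff_exists.2 ⟨(k.val + r) / 5, by positivity, by linarith, by
    push_cast; ring⟩

theorem hypPart_eq_of_side_eq {t t' : Triangle} (h : t'.side 0 = t.side 0) (k : Fin 5) :
    ∃ k', t'.hypPart k' = t.hypPart k := by
  rcases Sym2.eq_iff.1 h with ⟨e1, e2⟩ | ⟨e1, e2⟩
  · exact ⟨k, by rw [hypPart_eq, hypPart_eq, e1, e2]⟩
  · refine ⟨Fin.rev k, ?_⟩
    rw [hypPart_eq, hypPart_eq, e1, e2, Sym2.eq_iff]
    right
    have : ((Fin.rev k).val : ℝ) = 4 - k.val := by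
      rw [Fin.val_rev, Nat.cast_sub (by omega)]; push_cast; ring
    rw [this]
    push_cast
    constructor <;> ring

section Child

variable (t : Triangle)

/-- The tables for the four kinds of sides carry the self-similarity: three hypotenuses of children
are the short leg and the half long legs of the parent, and the remaining two coincide. The other
sides of children are fifths of the hypotenuse or are shared inside. -/
theorem side_child_zero (i : Fin 5) : (t.child i).side 0 =
    (![t.side 3, t.side 1, t.side 2, (t.child 4).side 0, (t.child 3).side 0] :
      Fin 5 → Sym2 ℂ) i := by
  fin_cases i <;> simp only [side, src, tgt, sidePts, child] <;> simp [frame_frame]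

theorem side_child_one (i : Fin 5) : (t.child i).side 1 =
    (![(t.child 4).side 1, t.hypPart 0, (t.child 1).side 3, (t.child 1).side 2,
      (t.child 0).side 1] : Fin 5 → Sym2 ℂ) i := by
  fin_cases i <;> simp only [side, src, tgt, sidePts, child, hypPart] <;> simp [frame_frame] <;>
    norm_num

theorem side_child_two (i : Fin 5) : (t.child i).side 2 =
    (![t.hypPart 3, (t.child 3).side 1, (t.child 3).side 2, (t.child 2).side 2,
      t.hypPart 2] : Fin 5 → Sym2 ℂ) i := by
  fin_cases i <;> simp only [side, src, tgt, sidePts, child, hypPart] <;> simp [frame_frame] <;>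
    norm_num

theorem side_child_three (i : Fin 5) : (t.child i).side 3 =
    (![t.hypPart 4, (t.child 2).side 1, (t.child 3).side 3, (t.child 2).side 3,
      t.hypPart 1] : Fin 5 → Sym2 ℂ) i := by
  fin_cases i <;> simp only [side, src, tgt, sidePts, child, hypPart] <;> simp [frame_frame] <;>
    norm_num

/-- A side of a triangle of the dissection is a leg, a part of the hypotenuse, or inside. -/
theorem side_child (i : Fin 5) (j : Fin 4) :
    (j = 0 ∧ ∃ k ≠ 0, (t.child i).side j = t.side k) ∨
    (j ≠ 0 ∧ ∃ k, (t.child i).side j = t.hypPart k) ∨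
    ∃ i' ≠ i, ∃ j', (j' = 0 ↔ j = 0) ∧ (t.child i').side j' = (t.child i).side j := by
  fin_cases j
  · have h := t.side_child_zero i
    fin_cases i
    · exact Or.inl ⟨rfl, 3, by decide, h⟩
    · exact Or.inl ⟨rfl, 1, by decide, h⟩
    · exact Or.inl ⟨rfl, 2, by decide, h⟩
    · exact Or.inr (Or.inr ⟨4, by decide, 0, by decide, h.symm⟩)
    · exact Or.inr (Or.inr ⟨3, by decide, 0, by decide, h.symm⟩)
  · have h := t.side_child_one i
    fin_cases i
    · exact Or.inr (Or.inr ⟨4, by decide, 1, by decide, h.symm⟩)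
    · exact Or.inr (Or.inl ⟨by decide, 0, h⟩)
    · exact Or.inr (Or.inr ⟨1, by decide, 3, by decide, h.symm⟩)
    · exact Or.inr (Or.inr ⟨1, by decide, 2, by decide, h.symm⟩)
    · exact Or.inr (Or.inr ⟨0, by decide, 1, by decide, h.symm⟩)
  · have h := t.side_child_two i
    fin_cases i
    · exact Or.inr (Or.inl ⟨by decide, 3, h⟩)
    · exact Or.inr (Or.inr ⟨3, by decide, 1, by decide, h.symm⟩)
    · exact Or.inr (Or.inr ⟨3, by decide, 2, by decide, h.symm⟩)
    · exact Or.inr (Or.inr ⟨2, by decide, 2, by decide, h.symm⟩)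
    · exact Or.inr (Or.inl ⟨by decide, 2, h⟩)
  · have h := t.side_child_three i
    fin_cases i
    · exact Or.inr (Or.inl ⟨by decide, 4, h⟩)
    · exact Or.inr (Or.inr ⟨2, by decide, 1, by decide, h.symm⟩)
    · exact Or.inr (Or.inr ⟨3, by decide, 3, by decide, h.symm⟩)
    · exact Or.inr (Or.inr ⟨2, by decide, 3, by decide, h.symm⟩)
    · exact Or.inr (Or.inl ⟨by decide, 1, h⟩)

theorem exists_side_zero_child {k : Fin 4} (hk : k ≠ 0) : ∃ i, (t.child i).side 0 = t.side k := by
  fin_cases k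
  · exact (hk rfl).elim
  · exact ⟨1, t.side_child_zero 1⟩
  · exact ⟨2, t.side_child_zero 2⟩
  · exact ⟨0, t.side_child_zero 0⟩

theorem exists_side_child (k : Fin 5) : ∃ i, ∃ j ≠ 0, (t.child i).side j = t.hypPart k := by
  fin_cases k
  · exact ⟨1, 1, by decide, t.side_child_one 1⟩
  · exact ⟨4, 3, by decide, t.side_child_three 4⟩
  · exact ⟨4, 2, by decide, t.side_child_two 4⟩
  · exact ⟨0, 2, by decide, t.side_child_two 0⟩
  · exact ⟨0, 3, by decide, t.side_child_three 0⟩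

end Child

theorem IsPinwheel.child_injective {s : ℝ} (hs : 0 < s) {t : Triangle} (h : t.IsPinwheel s) :
    Function.Injective t.child := by
  intro i j hij
  by_contra hne
  obtain ⟨ε, u, hε, hu, e⟩ := h.exists_std' hs
  have hd := disjoint_interior_child hε t.a hu hne
  rw [← e, hij, disjoint_self] at hd
  exact ((h.of_mem_dissect hs (mem_dissect.2 ⟨j, rfl⟩)).nonempty_interior
    (by positivity)).ne_empty hd

theorem IsPinwheel.openSeg_side_subset {s : ℝ} (hs : 0 < s) {t : Triangle} (h : t.IsPinwheel s)
    (j : Fin 4) : openSeg (t.side j) ⊆ frontier t.region := by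
  obtain ⟨h1, h2, h3⟩ := corner_ne_of_isPinwheel hs h
  have hac : segment ℝ t.a t.c ⊆ frontier t.region :=
    h.segment_subset_frontier hs (by simp [corners]) (by simp [corners]) h2
  have hm : t.frame 0 5 ∈ segment ℝ t.a t.c := by
    rw [← frame_a, ← frame_c]
    exact mem_segment_iff_exists.2 ⟨1 / 2, by norm_num, by norm_num, by
      rw [frame_lerp]; norm_num⟩
  refine (openSegment_subset_segment ℝ _ _).trans ?_
  fin_cases j <;> simp only [src, tgt, sidePts] <;> simp [frame_a, frame_b, frame_c]
  · exact h.segment_subset_frontier hs (by simp [corners]) (by simp [corners]) h3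
  · exact h.segment_subset_frontier hs (by simp [corners]) (by simp [corners]) h1
  · exact ((convex_segment _ _).segment_subset (left_mem_segment _ _ _) hm).trans hac
  · exact ((convex_segment _ _).segment_subset hm (right_mem_segment _ _ _)).trans hac

/-- In an iterated dissection, sides in the inside of the large triangle are common to two
triangles: hypotenuses fit to hypotenuses and legs fit to legs. -/
theorem IsPinwheel.exists_side_eq {s : ℝ} (hs : 0 < s) {t : Triangle} (h : t.IsPinwheel s) (n : ℕ) :
    ∀ P ∈ dissectIter n t, ∀ j, (∃ Q ∈ dissectIter n t, Q ≠ P ∧ ∃ j', (j' = 0 ↔ j = 0) ∧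
      Q.side j' = P.side j) ∨ Disjoint (openSeg (P.side j)) (interior t.region) := by
  induction n with
  | zero =>
    rintro P rfl j
    refine Or.inr (disjoint_left.2 fun z hz hz' => ?_)
    exact (h.openSeg_side_subset hs j hz).2 hz'
  | succ n ih =>
    intro P hP j
    obtain ⟨P₁, hP₁, hPP⟩ := mem_dissectIter_succ'.1 hP
    obtain ⟨i, rfl⟩ := mem_dissect.1 hPP
    have hP₁w := h.of_mem_dissectIter hs hP₁
    have hs' : 0 < s / √5 ^ n := by positivity
    have hmem : ∀ {Q}, Q ∈ dissectIter n t → ∀ i, Q.child i ∈ dissectIter (n + 1) t :=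
      fun hQ i => mem_dissectIter_succ'.2 ⟨_, hQ, mem_dissect.2 ⟨i, rfl⟩⟩
    have hne : ∀ {Q}, Q ∈ dissectIter n t → Q ≠ P₁ → ∀ i', Q.child i' ≠ P₁.child i := by
      intro Q hQ hQP i' e
      have hd := h.disjoint_dissectIter hs hQ hP₁ hQP
      obtain ⟨z, hz⟩ := (hP₁w.of_mem_dissect hs' hPP).nonempty_interior (by positivity)
      exact disjoint_left.1 hd (interior_mono (region_child_subset Q i') (e ▸ hz))
        (interior_mono (region_child_subset P₁ i) hz)
    -- On a leg or on the hypotenuse of `P₁` the neighbour of `P₁` across that side supplies the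
    -- matching child; the five parts of the hypotenuse match in either direction. A side inside
    -- `P₁` is shared with another child of `P₁`.
    rcases P₁.side_child i j with ⟨rfl, k, hk, e⟩ | ⟨hj, k, e⟩ | ⟨i', hi', j', hjj, e⟩
    · rw [e]
      rcases ih P₁ hP₁ k with ⟨Q, hQ, hQP, j', hjj, e'⟩ | hd
      · obtain ⟨i', hi'⟩ := Q.exists_side_zero_child (mt hjj.1 hk)
        exact Or.inl ⟨_, hmem hQ i', hne hQ hQP i', 0, by simp, hi'.trans e'⟩
      · exact Or.inr hd
    · rw [e]
      rcases ih P₁ hP₁ 0 with ⟨Q, hQ, hQP, j', hjj, e'⟩ | hd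
      · obtain rfl := hjj.2 rfl
        obtain ⟨k', hk'⟩ := hypPart_eq_of_side_eq e' k
        obtain ⟨i', j', hj', hi'⟩ := Q.exists_side_child k'
        exact Or.inl ⟨_, hmem hQ i', hne hQ hQP i', j', by simp [hj, hj'], hi'.trans hk'⟩
      · exact Or.inr (hd.mono_left (P₁.hypPart_subset k))
    · refine Or.inl ⟨_, hmem hP₁ i', fun e' => hi' (hP₁w.child_injective hs' e'), j', hjj, e⟩

end Triangle

end Pinwheel

namespace Pinwheel

open Complex Set

/-! ## Colours of points -/

/-- The number `z` lies in `ℤ[i, 1/5]`, and its residue modulo `1 + i` is `e`. -/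
def IsGauss (e : ZMod 2) (z : ℂ) : Prop :=
  ∃ (n : ℕ) (x y : ℤ), 5 ^ n * z = x + y * I ∧ ((x + y : ℤ) : ZMod 2) = e

namespace IsGauss

variable {e e' : ZMod 2} {z w : ℂ}

theorem of_int (x y : ℤ) : IsGauss ((x + y : ℤ) : ZMod 2) (x + y * I) := ⟨0, x, y, by simp, rfl⟩

/-- The residue does not depend on the power of 5 in the denominator because 5 is odd. -/
theorem eq (h : IsGauss e z) (h' : IsGauss e' z) : e = e' := by
  obtain ⟨n, x, y, h1, rfl⟩ := h
  obtain ⟨m, x', y', h1', rfl⟩ := h'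
  have key : (5 : ℂ) ^ m * (x + y * I) = 5 ^ n * (x' + y' * I) := by
    rw [← h1, ← h1']; ring
  have hre : (((5 : ℤ) ^ m * x : ℤ) : ℂ) + ((5 ^ m * y : ℤ) : ℂ) * I =
      ((5 ^ n * x' : ℤ) : ℂ) + ((5 ^ n * y' : ℤ) : ℂ) * I := by
    push_cast; linear_combination key
  have h2 := congrArg re hre
  have h3 := congrArg im hre
  simp only [add_re, add_im, mul_re, mul_im, I_re, I_im, intCast_re, intCast_im] at h2 h3
  have h2' : (5 : ℤ) ^ m * x = 5 ^ n * x' := by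
    have : (((5 : ℤ) ^ m * x : ℤ) : ℝ) = ((5 ^ n * x' : ℤ) : ℝ) := by linarith
    exact_mod_cast this
  have h3' : (5 : ℤ) ^ m * y = 5 ^ n * y' := by
    have : (((5 : ℤ) ^ m * y : ℤ) : ℝ) = ((5 ^ n * y' : ℤ) : ℝ) := by linarith
    exact_mod_cast this
  have h5 : (5 : ZMod 2) = 1 := by decide
  have h2'' := congrArg (Int.cast : ℤ → ZMod 2) h2'
  have h3'' := congrArg (Int.cast : ℤ → ZMod 2) h3'
  push_cast at h2'' h3'' ⊢
  rw [h5, one_pow, one_pow, one_mul, one_mul] at h2'' h3''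
  rw [h2'', h3'']

theorem add (h : IsGauss e z) (h' : IsGauss e' w) : IsGauss (e + e') (z + w) := by
  obtain ⟨n, x, y, h1, rfl⟩ := h
  obtain ⟨m, x', y', h1', rfl⟩ := h'
  refine ⟨n + m, 5 ^ m * x + 5 ^ n * x', 5 ^ m * y + 5 ^ n * y', ?_, ?_⟩
  · push_cast
    linear_combination (5 : ℂ) ^ m * h1 + 5 ^ n * h1'
  · have h5 : (5 : ZMod 2) = 1 := by decide
    push_cast
    rw [h5, one_pow, one_pow]
    ring

theorem mul (h : IsGauss e z) (h' : IsGauss e' w) : IsGauss (e * e') (z * w) := by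
  obtain ⟨n, x, y, h1, rfl⟩ := h
  obtain ⟨m, x', y', h1', rfl⟩ := h'
  refine ⟨n + m, x * x' - y * y', x * y' + y * x', ?_, ?_⟩
  · push_cast
    rw [pow_add, mul_mul_mul_comm, h1, h1']
    linear_combination (y : ℂ) * y' * I_mul_I
  · have h2 : ∀ z : ZMod 2, -z = z := by decide
    push_cast
    linear_combination h2 (y * y')

theorem neg (h : IsGauss e z) : IsGauss e (-z) := by
  have := (of_int (-1) 0).mul h
  have h2 : ((-1 + 0 : ℤ) : ZMod 2) = 1 := by decide
  rw [h2, one_mul] at this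
  simpa using this

theorem div_five (h : IsGauss e z) : IsGauss e (z / 5) := by
  obtain ⟨n, x, y, h1, rfl⟩ := h
  exact ⟨n + 1, x, y, by rw [← h1]; ring, rfl⟩

theorem sub (h : IsGauss e z) (h' : IsGauss e' w) : IsGauss (e + e') (z - w) := by
  rw [sub_eq_add_neg]; exact h.add h'.neg

end IsGauss

namespace Triangle

/-- The colour of a point of the lattice spanned by the triangle. -/
def Col (t : Triangle) (e : ZMod 2) (z : ℂ) : Prop := IsGauss e ((z - t.a) / (t.b - t.a))

theorem Col.eq {t : Triangle} {e e' : ZMod 2} {z : ℂ} (h : t.Col e z) (h' : t.Col e' z) : e = e' :=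
  IsGauss.eq h h'

/-- The two triangles give the same two colour classes. -/
def SameCol (t t' : Triangle) : Prop := ∃ δ, ∀ e z, t.Col e z ↔ t'.Col (e + δ) z

theorem SameCol.refl (t : Triangle) : SameCol t t := ⟨0, fun e z => by rw [add_zero]⟩

theorem SameCol.symm {t t' : Triangle} (h : SameCol t t') : SameCol t' t := by
  obtain ⟨δ, h⟩ := h
  have h2 : ∀ δ : ZMod 2, δ + δ = 0 := by decide
  exact ⟨δ, fun e z => by rw [h, add_assoc, h2, add_zero]⟩

theorem SameCol.trans {t t' t'' : Triangle} (h : SameCol t t') (h' : SameCol t' t'') :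
    SameCol t t'' := by
  obtain ⟨δ, h⟩ := h
  obtain ⟨δ', h'⟩ := h'
  exact ⟨δ + δ', fun e z => by rw [h, h', add_assoc]⟩

/-- The numerators are Gaussian integers of norm 5 and odd coordinate sum, so the relative legs are
units of ℤ[i, 1/5] with residue 1. -/
theorem isGauss_childLeg {ε : ℝ} (hε : ε = 1 ∨ ε = -1) (i : Fin 5) :
    IsGauss 1 (childLeg ε i) ∧ IsGauss 1 (childLeg ε i)⁻¹ := by
  have key : ∀ x y : ℤ, ((x + y : ℤ) : ZMod 2) = 1 → x ^ 2 + y ^ 2 = 5 → ∀ z : ℂ,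
      z = (x + y * I) / 5 → IsGauss 1 z ∧ IsGauss 1 z⁻¹ := by
    rintro x y hp h5 z rfl
    have h5' : (x : ℂ) ^ 2 + y ^ 2 = 5 := by exact_mod_cast h5
    have hm : ((x : ℂ) + y * I) * (x + (-y) * I) = 5 := by
      linear_combination h5' - y ^ 2 * I_sq
    have hinv : (((x : ℂ) + y * I) / 5)⁻¹ = x + ((-y : ℤ) : ℂ) * I := by
      rw [inv_div]
      push_cast
      rw [div_eq_iff (left_ne_zero_of_mul (hm ▸ (by norm_num : (5 : ℂ) ≠ 0))), ← hm, mul_comm]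
    refine ⟨?_, ?_⟩
    · have := (IsGauss.of_int x y).div_five
      rwa [hp] at this
    · have := IsGauss.of_int x (-y)
      rw [hinv]
      have hn : ∀ a b : ZMod 2, a + -b = a + b := by decide
      push_cast at this hp ⊢
      rwa [hn, hp] at this
  rcases hε with rfl | rfl
  · fin_cases i
    · exact key (-2) (-1) (by decide) (by norm_num) _ (by simp [childLeg]; ring)
    · exact key 1 (-2) (by decide) (by norm_num) _ (by simp [childLeg]; ring)
    · exact key (-2) (-1) (by decide) (by norm_num) _ (by simp [childLeg]; ring)
    · exact key 2 1 (by decide) (by norm_num) _ (by simp [childLeg])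
    · exact key (-2) (-1) (by decide) (by norm_num) _ (by simp [childLeg]; ring)
  · fin_cases i
    · exact key (-2) 1 (by decide) (by norm_num) _ (by simp [childLeg])
    · exact key 1 2 (by decide) (by norm_num) _ (by simp [childLeg])
    · exact key (-2) 1 (by decide) (by norm_num) _ (by simp [childLeg])
    · exact key 2 (-1) (by decide) (by norm_num) _ (by simp [childLeg])
    · exact key (-2) 1 (by decide) (by norm_num) _ (by simp [childLeg])

theorem isGauss_childCorner {ε : ℝ} (hε : ε = 1 ∨ ε = -1) (i : Fin 5) :
    ∃ e, IsGauss e (((childCorner i).1 + ε * (childCorner i).2 * I) / 5) := by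
  have key : ∀ x y : ℤ, ∀ z : ℂ, z = x + y * I → ∃ e, IsGauss e (z / 5) :=
    fun x y z hz => ⟨_, hz ▸ (IsGauss.of_int x y).div_five⟩
  rcases hε with rfl | rfl
  · fin_cases i
    · exact key 2 6 _ (by simp [childCorner])
    · exact key 4 2 _ (by simp [childCorner])
    · exact key 2 1 _ (by simp [childCorner])
    · exact key 2 1 _ (by simp [childCorner])
    · exact key 2 6 _ (by simp [childCorner])
  · fin_cases i
    · exact key 2 (-6) _ (by simp [childCorner])
    · exact key 4 (-2) _ (by simp [childCorner])
    · exact key 2 (-1) _ (by simp [childCorner])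
    · exact key 2 (-1) _ (by simp [childCorner])
    · exact key 2 (-6) _ (by simp [childCorner])

/-- The coordinate changes by a translation of some residue `δ` and by a unit of residue 1, so
colours are at most exchanged. -/
theorem IsPinwheel.sameCol_child {s : ℝ} (hs : 0 < s) {t : Triangle} (h : t.IsPinwheel s)
    (i : Fin 5) : SameCol t (t.child i) := by
  obtain ⟨ε, u, hε, hu, e⟩ := h.exists_std' hs
  rw [e]
  generalize t.a = a
  obtain ⟨δ, hδ⟩ := isGauss_childCorner hε i
  obtain ⟨h1, h2⟩ := isGauss_childLeg hε i
  have hne : childLeg ε i ≠ 0 := by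
    intro h0
    have := norm_childLeg hε i
    rw [h0, norm_zero] at this
    have h5 : 0 < 1 / √5 := by positivity
    linarith
  have hd2 : ∀ e : ZMod 2, e + δ + δ = e := by
    have : ∀ e δ : ZMod 2, e + δ + δ = e := by decide
    exact fun e => this e δ
  refine ⟨δ, fun e z => ?_⟩
  rw [child_std hε, Col, Col, frame_std]
  simp only [std, add_sub_cancel_left]
  have e1 : (z - (a + u * ((childCorner i).1 + ε * (childCorner i).2 * I) / 5)) /
      (u * childLeg ε i) = ((z - a) / u -
        ((childCorner i).1 + ε * (childCorner i).2 * I) / 5) * (childLeg ε i)⁻¹ := by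
    field_simp
    ring
  rw [e1]
  constructor
  · intro hz
    have := (hz.sub hδ).mul h2
    rwa [mul_one] at this
  · intro hz
    have := (hz.mul h1).add hδ
    rw [inv_mul_cancel_right₀ hne, sub_add_cancel, mul_one, hd2] at this
    exact this

theorem IsPinwheel.sameCol_of_mem_dissectIter {n : ℕ} {s : ℝ} (hs : 0 < s) {t t' : Triangle}
    (h : t.IsPinwheel s) (ht' : t' ∈ dissectIter n t) : SameCol t t' := by
  induction n generalizing t' with
  | zero => rw [show t' = t from ht']; exact SameCol.refl t
  | succ n ih =>
    obtain ⟨t₁, h₁, h₂⟩ := mem_dissectIter_succ'.1 ht'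
    obtain ⟨i, rfl⟩ := mem_dissect.1 h₂
    exact (ih h₁).trans ((h.of_mem_dissectIter hs h₁).sameCol_child (by positivity) i)

/-- The vertices on the boundary of a triangle are coloured alternately. -/
def Alternates (col : ZMod 2 → ℂ → Prop) (t : Triangle) (e : ZMod 2) : Prop :=
  col e t.a ∧ col (e + 1) t.b ∧ col e t.c ∧ col (e + 1) (t.frame 0 5)

/-- From the right angle, in units of the short leg, the vertices are 0, 1, ±2i and ±i. -/
theorem IsPinwheel.exists_alternates {s : ℝ} (hs : 0 < s) {t t₀ : Triangle} (h : t.IsPinwheel s)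
    (h₀ : SameCol t₀ t) : ∃ e, Alternates t₀.Col t e := by
  obtain ⟨δ, h₀⟩ := h₀
  obtain ⟨ε, u, hε, hu, e⟩ := h.exists_std' hs
  have hε' : ∃ x : ℤ, (x : ℝ) = ε ∧ (x : ZMod 2) = 1 := by
    rcases hε with rfl | rfl
    · exact ⟨1, by norm_num, by decide⟩
    · exact ⟨-1, by norm_num, by decide⟩
  obtain ⟨x, rfl, hx⟩ := hε'
  rw [e] at h₀ ⊢
  have h2 : ∀ δ : ZMod 2, δ + δ = 0 ∧ δ + 1 + δ = 1 := by decide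
  refine ⟨δ, ?_, ?_, ?_, ?_⟩ <;> rw [h₀] <;> simp only [h2, Col, frame_std] <;> simp only [std]
  · have := IsGauss.of_int 0 0
    simpa using this
  · have := IsGauss.of_int 1 0
    simpa [hu] using this
  · have := IsGauss.of_int 0 (2 * x)
    rw [show (((0 + 2 * x : ℤ)) : ZMod 2) = 0 by push_cast; rw [hx]; decide] at this
    convert this using 1
    rw [div_eq_iff (by simpa using hu)]
    push_cast
    ring
  · have := IsGauss.of_int 0 x
    rw [zero_add, hx] at this
    convert this using 1
    rw [div_eq_iff (by simpa using hu)]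
    push_cast
    ring

end Triangle

end Pinwheel

namespace Pinwheel

open Complex Set Filter

/-! ## The parents of the tiles of a pinwheel tiling -/

namespace Triangle

/-- The five triangles in whose dissections `t` can occur. -/
noncomputable def parent (t : Triangle) : Fin 5 → Triangle :=
  ![⟨t.frame 10 (-10), t.frame 0 (-15), t.frame 0 10⟩,
    ⟨t.frame 0 10, t.frame 5 0, t.frame (-20) 0⟩,
    ⟨t.frame 5 0, t.frame (-5) (-5), t.frame (-5) 20⟩,
    ⟨t.frame (-5) 0, t.frame 5 (-5), t.frame 5 20⟩,
    ⟨t.frame 10 10, t.frame 0 15, t.frame 0 (-10)⟩]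

theorem parent_child (t : Triangle) (i : Fin 5) : (t.child i).parent i = t := by
  have h : t = ⟨t.frame 0 0, t.frame 5 0, t.frame 0 10⟩ := by rw [frame_a, frame_b, frame_c]
  conv_rhs => rw [h]
  fin_cases i <;> simp only [parent, child] <;> simp [frame_frame] <;> norm_num

theorem IsPinwheel.isPacking_dissectIter {n : ℕ} {s : ℝ} (hs : 0 < s) {t : Triangle}
    (h : t.IsPinwheel s) : IsPacking (s / √5 ^ n) (dissectIter n t) :=
  ⟨by positivity, fun _ ht' => h.of_mem_dissectIter hs ht',
    fun _ h₁ _ h₂ hne => h.disjoint_dissectIter hs h₁ h₂ hne⟩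

end Triangle

open Triangle

/-- The triangles of `L` form a tiling by larger pinwheel triangles with common sides; its
dissection is `T`. -/
structure IsParentTiling (T L : Set Triangle) : Prop where
  isPacking : IsPacking √5 L
  dissect_subset : ∀ P ∈ L, P.dissect ⊆ T
  exists_mem_dissect : ∀ t ∈ T, ∃ P ∈ L, t ∈ P.dissect
  exists_side_eq : ∀ P ∈ L, ∀ j, ∃ Q ∈ L, Q ≠ P ∧ ∃ j', (j' = 0 ↔ j = 0) ∧ Q.side j' = P.side j
  exists_sameCol : ∃ t₀, ∀ P ∈ L, SameCol t₀ P

namespace IsPinwheelTiling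

variable {T : Set Triangle} (hT : IsPinwheelTiling T)
include hT

theorem exists_two : ∃ t ∈ T, ∃ t' ∈ T, t ≠ t' := by
  obtain ⟨t, ht, -⟩ := hT.isTiling.exists_mem_region 0
  -- A tile of size 1 has diameter at most 6 by `dist_le`, so a point at distance 7 lies in another
  -- tile.
  obtain ⟨t', ht', hz⟩ := hT.isTiling.exists_mem_region (t.a + 7)
  refine ⟨t, ht, t', ht', ?_⟩
  rintro rfl
  have := (hT.isTile t ht).dist_le one_pos hz (corner_mem_region (p := t.a) (by simp [corners]))
  rw [dist_eq, add_sub_cancel_left] at this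
  norm_num at this

/-- The ancestors of a growing finite part of the tiling. -/
theorem exists_ultrafilter : ∃ (ι : Type) (U : Ultrafilter ι) (n : ι → ℕ) (t : ι → Triangle),
    (∀ i, (t i).IsPinwheel (√5 ^ (n i + 1))) ∧
    (∀ t' ∈ T, ∀ᶠ i in U, t' ∈ dissectIter (n i + 1) (t i)) := by
  classical
  obtain ⟨t₁, h₁, t₂, h₂, hne⟩ := hT.exists_two
  have hex : ∀ F : Finset T, ∃ (n : ℕ) (t : Triangle), t.IsPinwheel (√5 ^ (n + 1)) ∧
      (↑F : Set T).image Subtype.val ⊆ t.dissectIter (n + 1) := by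
    intro F
    -- Adding two distinct tiles to the finite set forces at least one dissection, so there is a
    -- last step to undo.
    obtain ⟨n, t, h, hF⟩ := hT.legal ((↑F : Set T).image Subtype.val ∪ {t₁, t₂})
      ((F.finite_toSet.image _).union (toFinite _)) (union_subset (by
        rintro _ ⟨t, -, rfl⟩; exact t.2) (by rintro _ (rfl | rfl) <;> assumption))
    cases n with
    | zero =>
      have e₁ : t₁ = t := hF (by simp)
      have e₂ : t₂ = t := hF (by simp)
      exact (hne (e₁.trans e₂.symm)).elim
    | succ n => exact ⟨n, t, h, subset_union_left.trans hF⟩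
  choose n t h hF using hex
  refine ⟨Finset T, Ultrafilter.of atTop, n, t, h, fun t' ht' => ?_⟩
  refine (Ultrafilter.of_le atTop) ?_
  filter_upwards [eventually_ge_atTop {(⟨t', ht'⟩ : T)}] with F hF'
  exact hF F ⟨⟨t', ht'⟩, hF' (Finset.mem_singleton_self _), rfl⟩

/-- The parents are the limit of the next-to-last dissections along the ultrafilter. Statements
about finitely many triangles hold in the limit because they hold in a single dissection that
contains all of them. -/
theorem exists_isParentTiling : ∃ L, IsParentTiling T L := by
  obtain ⟨ι, U, n, t, hw, hU⟩ := hT.exists_ultrafilter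
  have h5 : 0 < √5 := by positivity
  have hpw : ∀ i, 0 < √5 ^ (n i + 1) := fun i => by positivity
  have hT1 : IsPacking 1 T := ⟨one_pos, hT.isTile, hT.isTiling.disjoint⟩
  have hpack : ∀ i, IsPacking √5 (dissectIter (n i) (t i)) := fun i => by
    have := (hw i).isPacking_dissectIter (n := n i) (hpw i)
    rwa [pow_succ, mul_div_cancel_left₀ _ (by positivity)] at this
  have hpack' : ∀ i, IsPacking 1 (dissectIter (n i + 1) (t i)) := fun i => by
    have := (hw i).isPacking_dissectIter (n := n i + 1) (hpw i)
    rwa [div_self (hpw i).ne'] at this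
  set L : Set Triangle := {P | ∀ᶠ i in U, P ∈ dissectIter (n i) (t i)} with hL
  have hLp : IsPacking √5 L := by
    refine ⟨h5, fun P hP => ?_, fun P hP Q hQ hne => ?_⟩
    · obtain ⟨i, hi⟩ := Eventually.exists hP
      exact (hpack i).isPinwheel P hi
    · obtain ⟨i, hi, hi'⟩ := (Eventually.and hP hQ).exists
      exact (hpack i).disjoint P hi Q hi' hne
  -- A child of a limit triangle and the tile of `T` at one of its interior points occur together in
  -- some approximating dissection, where they must coincide.
  have hsub : ∀ P ∈ L, P.dissect ⊆ T := by
    intro P hP t' ht'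
    have hmem : ∀ᶠ i in U, t' ∈ dissectIter (n i + 1) (t i) := by
      filter_upwards [hP] with i hi
      exact mem_dissectIter_succ'.2 ⟨P, hi, ht'⟩
    obtain ⟨i, hi⟩ := hmem.exists
    obtain ⟨z, hz⟩ := ((hpack' i).isPinwheel t' hi).nonempty_interior one_pos
    obtain ⟨t'', ht'', hz'⟩ := hT.isTiling.exists_mem_region z
    obtain ⟨j, hj, hj'⟩ := (hmem.and (hU t'' ht'')).exists
    rwa [(hpack' j).eq_of_mem_interior_of_mem hj hj' hz hz']
  -- The parent may vary with `i`, but only among five triangles; an ultrafilter settles on one of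
  -- finitely many alternatives.
  have hpar : ∀ t' ∈ T, ∃ P ∈ L, t' ∈ P.dissect := by
    intro t' ht'
    have : ∀ᶠ i in U, ∃ k : Fin 5, t'.parent k ∈ dissectIter (n i) (t i) ∧
        t' ∈ (t'.parent k).dissect := by
      filter_upwards [hU t' ht'] with i hi
      obtain ⟨P, hP, h1⟩ := mem_dissectIter_succ'.1 hi
      obtain ⟨k, rfl⟩ := mem_dissect.1 h1
      exact ⟨k, by rwa [parent_child], by rwa [parent_child]⟩
    obtain ⟨k, hk⟩ := Ultrafilter.eventually_exists_iff.1 this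
    exact ⟨_, hk.mono fun i hi => hi.1, hk.exists.choose_spec.2⟩
  -- This excludes the boundary alternative of `exists_side_eq` at any given point, once the
  -- finitely many tiles near it are captured.
  have hint : ∀ z, ∀ᶠ i in U, z ∈ interior (t i).region := by
    intro z
    have hall : ∀ᶠ i in U, ∀ t' ∈ {t' ∈ T | (t'.region ∩ Metric.closedBall z 1).Nonempty},
        t' ∈ dissectIter (n i + 1) (t i) :=
      (eventually_all_finite (hT1.finite_near z 1)).2 fun t' ht' => hU t' ht'.1
    filter_upwards [hall] with i hi
    refine interior_maximal ?_ Metric.isOpen_ball (Metric.mem_ball_self (x := z) one_pos)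
    intro w hw
    obtain ⟨t', ht', hwt⟩ := hT.isTiling.exists_mem_region w
    exact region_subset_of_mem_dissectIter
      (hi t' ⟨ht', w, hwt, Metric.ball_subset_closedBall hw⟩) hwt
  refine ⟨L, hLp, hsub, hpar, fun P hP j => ?_, ?_⟩
  · have hPw := hLp.isPinwheel P hP
    have hne := hPw.src_ne_tgt h5 j
    obtain ⟨δ, hδ, hf⟩ := hPw.flank h5 j
    -- The point lies just across side `j` from `P`. It determines `Q` independently of `i`, and the
    -- neighbour found in a finite dissection has `z` in its interior, so it is `Q`.
    set z : ℂ := P.src j + ((1 / 2 : ℝ) + (-δ : ℝ) * (1 / 20 : ℝ) * I) * (P.tgt j - P.src j) with hz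
    obtain ⟨t', ht', hzt⟩ := hT.isTiling.exists_mem_region z
    obtain ⟨Q, hQ, htQ⟩ := hpar t' ht'
    have hzQ : z ∈ Q.region := region_subset_of_mem_dissect htQ hzt
    have hm : P.src j + (1 / 2 : ℝ) * (P.tgt j - P.src j) ∈ openSeg (P.side j) :=
      mem_openSegment_iff_exists.2 ⟨1 / 2, by norm_num, by norm_num, rfl⟩
    obtain ⟨i, hi, hPi, hQi⟩ := ((hint (P.src j + (1 / 2 : ℝ) * (P.tgt j - P.src j))).and
      (Eventually.and hP hQ)).exists
    rcases (hw i).exists_side_eq (hpw i) (n i) P hPi j with ⟨Q', hQ', hQP, j', hj, e⟩ | hd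
    · have hf' := hPw.flank_neg h5 ((hpack i).isPinwheel Q' hQ')
        ((hpack i).disjoint P hPi Q' hQ' hQP.symm) e hδ hf
      have hzQ' : z ∈ interior Q'.region := hf'.mem_interior hne
        (by rcases hδ with rfl | rfl <;> simp) (by norm_num) (by norm_num) (by norm_num)
      obtain rfl := (hpack i).eq_of_mem_interior_of_mem hQ' hQi hzQ' hzQ
      exact ⟨Q', hQ, hQP, j', hj, e⟩
    · exact (disjoint_left.1 hd hm hi).elim
  · obtain ⟨t', ht', -⟩ := hT.exists_two
    obtain ⟨P₀, hP₀, -⟩ := hpar t' ht'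
    refine ⟨P₀, fun P hP => ?_⟩
    obtain ⟨i, hi, hi'⟩ := (Eventually.and hP₀ hP).exists
    exact ((hw i).sameCol_of_mem_dissectIter (hpw i) hi).symm.trans
      ((hw i).sameCol_of_mem_dissectIter (hpw i) hi')

end IsPinwheelTiling

end Pinwheel

namespace Pinwheel

open Complex Set

/-! ## Pairs of triangles with a common hypotenuse -/

namespace Triangle

/-- The triangle that forms a rectangle with `t`. -/
noncomputable def rectangleMate (t : Triangle) : Triangle :=
  ⟨t.frame 5 10, t.frame 0 10, t.frame 5 0⟩

/-- The triangle that forms a kite with `t`. -/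
noncomputable def kiteMate (t : Triangle) : Triangle :=
  ⟨t.frame 8 4, t.frame 5 0, t.frame 0 10⟩

section Std

variable {ε ε' : ℝ} {a a' u u' : ℂ} (hε : ε = 1 ∨ ε = -1) (hε' : ε' = 1 ∨ ε' = -1) (hu : u ≠ 0)
  (hu' : u' ≠ 0)
include hε hε'

omit hε' in
-- These two triangles are mirror images in the perpendicular bisector of the hypotenuse and lie on
-- the same side of it. The point (3/2, 9/2) is on that axis, so it has equal coordinates in both
-- frames and is interior to both.
theorem not_disjoint_of_swap (hu : u ≠ 0) (hu' : u' ≠ 0) (h1 : a' + u' = a + 2 * ε * I * u)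
    (h2 : a' + 2 * (-ε) * I * u' = a + u) :
    ¬ Disjoint (interior (std ε a u).region) (interior (std (-ε) a' u').region) := by
  have hJ : (ε * I : ℂ) * (ε * I) = -1 := by
    rcases hε with rfl | rfl <;> simp
  have hnε : -ε = 1 ∨ -ε = -1 := by rcases hε with rfl | rfl <;> simp
  have h0 : (1 + 2 * (ε * I) : ℂ) ≠ 0 := by
    intro h0
    have : (1 + 2 * (ε * I) : ℂ) * (1 - 2 * (ε * I)) = 5 := by linear_combination -4 * hJ
    rw [h0, zero_mul] at this
    norm_num at this
  have hz : (std ε a u).frame (3 / 2) (9 / 2) = (std (-ε) a' u').frame (3 / 2) (9 / 2) := by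
    rw [frame_std, frame_std]
    refine mul_right_cancel₀ h0 ?_
    push_cast
    generalize hJe : (ε * I : ℂ) = J at *
    have h1' : a' + u' = a + 2 * J * u := by rw [h1, ← hJe]; ring
    have h2' : a' - 2 * J * u' = a + u := by rw [← h2, ← hJe]; ring
    have e1 : (3 / 2 + ε * (9 / 2) * I : ℂ) = 3 / 2 + 9 / 2 * J := by rw [← hJe]; ring
    have e2 : (3 / 2 + -ε * (9 / 2) * I : ℂ) = 3 / 2 - 9 / 2 * J := by rw [← hJe]; ring
    rw [e1, e2]
    have hb : u' * (1 + 2 * J) = -u * (1 - 2 * J) := by linear_combination h1' - h2'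
    have ha : a' = a + 2 * J * u - u' := by linear_combination h1'
    rw [ha]
    linear_combination (7 / 10 + 9 / 10 * J) * hb - 2 / 5 * u * hJ
  intro hd
  refine disjoint_left.1 hd ((frame_mem_interior_std hε hu (X := 3 / 2) (Y := 9 / 2)).2
    (by norm_num)) ?_
  rw [hz]
  exact (frame_mem_interior_std hnε hu').2 (by norm_num)

/-- Two triangles with a common hypotenuse form a kite or a rectangle. -/
theorem std_mate_cases (hu : u ≠ 0) (hu' : u' ≠ 0) (hne : std ε a u ≠ std ε' a' u')
    (hd : Disjoint (interior (std ε a u).region) (interior (std ε' a' u').region))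
    (e : (std ε' a' u').side 0 = (std ε a u).side 0) :
    (ε' = -ε ∧ std ε' a' u' = (std ε a u).kiteMate) ∨
      (ε' = ε ∧ std ε' a' u' = (std ε a u).rectangleMate) := by
  have hJ : (ε * I : ℂ) * (ε * I) = -1 := by
    rcases hε with rfl | rfl <;> simp
  have hcase : ε' = ε ∨ ε' = -ε := by
    rcases hε with rfl | rfl <;> rcases hε' with rfl | rfl <;> simp
  have h0 : (1 - 2 * (ε * I) : ℂ) ≠ 0 := by
    intro h0
    have : (1 + 2 * (ε * I) : ℂ) * (1 - 2 * (ε * I)) = 5 := by linear_combination -4 * hJ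
    rw [h0, mul_zero] at this
    norm_num at this
  simp only [side, src, tgt, sidePts, Matrix.cons_val_zero, frame_b, frame_c] at e
  simp only [std] at e
  -- With matched ends, equal orientations give the same triangle and opposite ones a kite. With
  -- swapped ends, equal orientations give a rectangle and opposite ones an overlap.
  rcases Sym2.eq_iff.1 e with ⟨h1, h2⟩ | ⟨h1, h2⟩ <;> rcases hcase with rfl | rfl
  · refine (hne ?_).elim
    have : u' = u := by
      refine mul_right_cancel₀ h0 ?_
      linear_combination h1 - h2
    subst this
    rw [add_left_injective _ h1]
  · refine Or.inl ⟨rfl, ?_⟩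
    rw [kiteMate, frame_b, frame_c, frame_std]
    ext1
    · simp only [std]
      push_cast at h2 ⊢
      linear_combination (1 - 2 * (ε * I)) / 5 * (h2 + 2 * (ε * I) * h1) +
        (4 * (a' - a) - 8 * u) / 5 * hJ
    · exact h1
    · exact h2
  · refine Or.inr ⟨rfl, ?_⟩
    have : u' = -u := by
      refine mul_right_cancel₀ h0 ?_
      linear_combination h1 - h2
    subst this
    rw [rectangleMate, frame_b, frame_c, frame_std]
    ext1
    · simp only [std]
      push_cast
      linear_combination h1
    · exact h1
    · exact h2
  · exact (not_disjoint_of_swap hε hu hu' h1 (by push_cast at h2; exact h2) hd).elim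

end Std

end Triangle

namespace IsPacking

open Triangle

variable {s : ℝ} {W : Set Triangle} (h : IsPacking s W)
include h

/-- A hypotenuse is common to at most two triangles. -/
theorem eq_of_side_zero_eq {P Q Q' : Triangle} (hP : P ∈ W) (hQ : Q ∈ W) (hQ' : Q' ∈ W)
    (hQP : Q ≠ P) (hQP' : Q' ≠ P) (e : Q.side 0 = P.side 0) (e' : Q'.side 0 = P.side 0) :
    Q = Q' := by
  by_contra hne
  have hd₁ := h.disjoint P hP Q hQ hQP.symm
  have hd₂ := h.disjoint P hP Q' hQ' hQP'.symm
  have hd₃ := h.disjoint Q hQ Q' hQ' hne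
  obtain ⟨n1, n2, n3⟩ := corner_ne_of_isPinwheel h.pos (h.isPinwheel P hP)
  obtain ⟨ε₁, u₁, hε₁, hu₁, e₁⟩ := (h.isPinwheel P hP).exists_std' h.pos
  obtain ⟨ε₂, u₂, hε₂, hu₂, e₂⟩ := (h.isPinwheel Q hQ).exists_std' h.pos
  obtain ⟨ε₃, u₃, hε₃, hu₃, e₃⟩ := (h.isPinwheel Q' hQ').exists_std' h.pos
  have k₁ := std_mate_cases hε₁ hε₂ hu₁ hu₂ (by rw [← e₁, ← e₂]; exact hQP.symm)
    (by rw [← e₁, ← e₂]; exact hd₁) (by rw [← e₁, ← e₂]; exact e)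
  have k₂ := std_mate_cases hε₁ hε₃ hu₁ hu₃ (by rw [← e₁, ← e₃]; exact hQP'.symm)
    (by rw [← e₁, ← e₃]; exact hd₂) (by rw [← e₁, ← e₃]; exact e')
  have k₃ := std_mate_cases hε₂ hε₃ hu₂ hu₃ (by rw [← e₂, ← e₃]; exact hne)
    (by rw [← e₂, ← e₃]; exact hd₃) (by rw [← e₂, ← e₃]; exact e'.trans e.symm)
  rw [← e₁, ← e₂] at k₁
  rw [← e₁, ← e₃] at k₂
  rw [← e₂, ← e₃] at k₃
  have hk : ∀ t : Triangle, t.kiteMate.b = t.b := fun t => t.frame_b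
  have hr : ∀ t : Triangle, t.rectangleMate.b = t.c := fun t => t.frame_c
  -- Two mates of the same type coincide. If one completes a kite and the other a rectangle, they
  -- have opposite orientations and would form a kite with each other, but then their corners `b`
  -- would agree, although these are the two ends of the hypotenuse of `P`.
  rcases k₁ with ⟨g₁, f₁⟩ | ⟨g₁, f₁⟩ <;> rcases k₂ with ⟨g₂, f₂⟩ | ⟨g₂, f₂⟩
  · exact hne (f₁.trans f₂.symm)
  · rcases k₃ with ⟨g₃, f₃⟩ | ⟨g₃, f₃⟩
    · have b₁ := hk P
      rw [← f₁] at b₁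
      have b₂ := hr P
      rw [← f₂] at b₂
      have b₃ := hk Q
      rw [← f₃] at b₃
      exact n3 (b₁.symm.trans (b₃.symm.trans b₂))
    · rcases hε₁ with rfl | rfl <;> linarith
  · rcases k₃ with ⟨g₃, f₃⟩ | ⟨g₃, f₃⟩
    · have b₁ := hr P
      rw [← f₁] at b₁
      have b₂ := hk P
      rw [← f₂] at b₂
      have b₃ := hk Q
      rw [← f₃] at b₃
      exact n3 (b₂.symm.trans (b₃.trans b₁))
    · rcases hε₁ with rfl | rfl <;> linarith
  · exact hne (f₁.trans f₂.symm)

end IsPacking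

end Pinwheel

namespace Pinwheel

open Complex Set Triangle

/-! ## Supertiles from pairs of triangles -/

/-- The supertile `S` consists of the triangles `P` and `Q`, and its colours are given by `col`. -/
structure Supertile.IsPair (col : ZMod 2 → ℂ → Prop) (S : Supertile) (P Q : Triangle) : Prop where
  tiles_eq : S.tiles = P.dissect ∪ Q.dissect
  verts_eq : S.blue ∪ S.red = P.verts ∪ Q.verts
  blue : ∀ v ∈ S.blue, col 0 v
  red : ∀ v ∈ S.red, col 1 v

namespace Supertile

theorem IsPair.symm {col : ZMod 2 → ℂ → Prop} {S : Supertile} {P Q : Triangle}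
    (h : S.IsPair col P Q) : S.IsPair col Q P :=
  ⟨by rw [h.tiles_eq, union_comm], by rw [h.verts_eq, union_comm], h.blue, h.red⟩

theorem dissect_map (S : Supertile) (t : Triangle) :
    (t.map S.place).dissect = Triangle.map S.place '' t.dissect := by
  have hf : ∀ i j, (t.map S.place).frame i j = S.place (t.frame i j) := by
    intro i j
    simp only [Triangle.frame, Triangle.map, place, real_smul]
    ring
  simp only [dissect, image_insert_eq, image_singleton, hf]
  rfl

theorem tiles_of_kind {S : Supertile} {A B : Triangle} (h : S.kind.tiles = A.dissect ∪ B.dissect) :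
    S.tiles = (A.map S.place).dissect ∪ (B.map S.place).dissect := by
  rw [tiles, h, image_union, dissect_map, dissect_map]

theorem exists_place (k : Kind) (b : ℂ) {c : ℂ} (hc : ‖c‖ = √5) : ∃ S : Supertile, S.kind = k ∧
    ∀ x y, S.place (pt x y) = b + c * (x + y * I) / 5 := by
  have h5 : (0 : ℝ) < √5 := by positivity
  have h5' : (√5 : ℂ) ≠ 0 := by exact_mod_cast h5.ne'
  have h55 : (√5 : ℂ) * √5 = 5 := by exact_mod_cast Real.mul_self_sqrt (by norm_num : (0 : ℝ) ≤ 5)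
  refine ⟨⟨k, ⟨c / √5, ?_⟩, b⟩, rfl, fun x y => ?_⟩
  · rw [Submonoid.unitSphere]
    simp [hc, abs_of_pos h5, h5.ne']
  · have : pt x y = (x + y * I) / √5 := by
      rw [eq_div_iff h5']
      apply Complex.ext <;> simp [pt, h5.ne']
    rw [place, this]
    simp only
    rw [div_mul_div_comm, h55, add_comm]

section Pair

variable {col : ZMod 2 → ℂ → Prop} {ε : ℝ} {a u : ℂ}

theorem exists_place_std (k : Kind) (hε : ε = 1 ∨ ε = -1) (hu : ‖u‖ = √5) : ∃ S : Supertile,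
    S.kind = k ∧ ∀ x y, S.place (pt (ε * x) y) = (std ε a u).frame x y := by
  have hn : ‖(ε : ℂ) * u‖ = √5 := by
    rcases hε with rfl | rfl <;> simpa using hu
  have hε2 : (ε : ℂ) * ε = 1 := by rcases hε with rfl | rfl <;> norm_num
  obtain ⟨S, hS, hp⟩ := exists_place k a hn
  refine ⟨S, hS, fun x y => ?_⟩
  rw [hp, frame_std]
  push_cast
  linear_combination u * x / 5 * hε2

theorem std_eq_frame : std ε a u =
    ⟨(std ε a u).frame 0 0, (std ε a u).frame 5 0, (std ε a u).frame 0 10⟩ := by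
  rw [frame_a, frame_b, frame_c]

theorem exists_rectangle_kind (hε : ε = 1 ∨ ε = -1) : ∃ k : Kind,
    k.tiles = dissect ⟨pt (ε * 0) 0, pt (ε * 5) 0, pt (ε * 0) 10⟩ ∪
      dissect ⟨pt (ε * 5) 10, pt (ε * 0) 10, pt (ε * 5) 0⟩ ∧
    k.blue = {pt (ε * 0) 0, pt (ε * 0) 10, pt (ε * 5) 5} ∧
    k.red = {pt (ε * 5) 0, pt (ε * 5) 10, pt (ε * 0) 5} := by
  rcases hε with rfl | rfl
  · exact ⟨.rectangle, by simp [Kind.tiles], by simp [Kind.blue], by simp [Kind.red]⟩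
  · exact ⟨.mirrorRectangle, by simp [Kind.tiles], by simp [Kind.blue], by simp [Kind.red]⟩

theorem exists_isPair_rectangle (hε : ε = 1 ∨ ε = -1) (hu : ‖u‖ = √5)
    (hP : Alternates col (std ε a u) 0) (hQ : Alternates col (std ε a u).rectangleMate 1) :
    ∃ S : Supertile, S.IsPair col (std ε a u) (std ε a u).rectangleMate := by
  have hm : (std ε a u).rectangleMate.frame 0 5 = (std ε a u).frame 5 5 := by
    rw [rectangleMate, frame_frame]; norm_num
  obtain ⟨p1, p2, p3, p4⟩ := hP
  obtain ⟨q1, q2, q3, q4⟩ := hQ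
  rw [← frame_a] at p1
  rw [← frame_b] at p2
  rw [← frame_c] at p3
  rw [hm] at q4
  simp only [rectangleMate] at q1
  have h11 : (1 + 1 : ZMod 2) = 0 := by decide
  rw [zero_add] at p2 p4
  rw [h11] at q4
  obtain ⟨k, hk1, hk2, hk3⟩ := exists_rectangle_kind hε
  obtain ⟨S, rfl, hp⟩ := exists_place_std (a := a) k hε hu
  have hverts : (std ε a u).verts ∪ (std ε a u).rectangleMate.verts =
      {(std ε a u).frame 0 0, (std ε a u).frame 0 10, (std ε a u).frame 5 5} ∪
      {(std ε a u).frame 5 0, (std ε a u).frame 5 10, (std ε a u).frame 0 5} := by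
    ext v
    rw [mem_union, Triangle.mem_verts, Triangle.mem_verts, hm, ← frame_a, ← frame_b, ← frame_c]
    simp only [rectangleMate, frame_a, frame_b, frame_c, mem_union, mem_insert_iff,
      mem_singleton_iff]
    tauto
  have htiles : S.tiles = (std ε a u).dissect ∪ (std ε a u).rectangleMate.dissect := by
    rw [tiles_of_kind hk1]
    simp only [Triangle.map, hp, rectangleMate, ← std_eq_frame]
  have hblue : S.blue = {(std ε a u).frame 0 0, (std ε a u).frame 0 10,
      (std ε a u).frame 5 5} := by
    rw [Supertile.blue, hk2]
    simp only [image_insert_eq, image_singleton, hp]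
  have hred : S.red = {(std ε a u).frame 5 0, (std ε a u).frame 5 10, (std ε a u).frame 0 5} := by
    rw [Supertile.red, hk3]
    simp only [image_insert_eq, image_singleton, hp]
  refine ⟨S, htiles, by rw [hblue, hred, hverts], ?_, ?_⟩
  · rw [hblue]
    rintro v (rfl | rfl | rfl) <;> assumption
  · rw [hred]
    rintro v (rfl | rfl | rfl) <;> assumption

/-- The anticlockwise case suffices because the halves of a kite have opposite orientations. The
colour of the right angles decides between the two kites. -/
theorem exists_isPair_kite (hu : ‖u‖ = √5) {e : ZMod 2} (hP : Alternates col (std 1 a u) e)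
    (hQ : Alternates col (std 1 a u).kiteMate e) :
    ∃ S : Supertile, S.IsPair col (std 1 a u) (std 1 a u).kiteMate := by
  have hm : (std 1 a u).kiteMate.frame 0 5 = (std 1 a u).frame 4 7 := by
    rw [kiteMate, frame_frame]; norm_num
  obtain ⟨p1, p2, p3, p4⟩ := hP
  obtain ⟨q1, q2, q3, q4⟩ := hQ
  rw [← frame_a] at p1
  rw [← frame_b] at p2
  rw [← frame_c] at p3
  rw [hm] at q4
  simp only [kiteMate] at q1
  set A : Set ℂ := {(std 1 a u).frame 0 0, (std 1 a u).frame 0 10, (std 1 a u).frame 8 4} with hA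
  set B : Set ℂ := {(std 1 a u).frame 5 0, (std 1 a u).frame 0 5, (std 1 a u).frame 4 7} with hB
  have hverts : (std 1 a u).verts ∪ (std 1 a u).kiteMate.verts = A ∪ B := by
    ext v
    rw [mem_union, Triangle.mem_verts, Triangle.mem_verts, hm, ← frame_a, ← frame_b, ← frame_c]
    simp only [hA, hB, kiteMate, frame_a, frame_b, frame_c, mem_union, mem_insert_iff,
      mem_singleton_iff]
    tauto
  have hcA : ∀ v ∈ A, col e v := by rintro v (rfl | rfl | rfl) <;> assumption
  have hcB : ∀ v ∈ B, col (e + 1) v := by rintro v (rfl | rfl | rfl) <;> assumption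
  have htiles : ∀ S : Supertile, (∀ x y, S.place (pt (1 * x) y) = (std 1 a u).frame x y) →
      S.kind.tiles = dissect ⟨pt 0 0, pt 5 0, pt 0 10⟩ ∪ dissect ⟨pt 8 4, pt 5 0, pt 0 10⟩ →
      S.tiles = (std 1 a u).dissect ∪ (std 1 a u).kiteMate.dissect := by
    intro S hp hS
    simp only [one_mul] at hp
    rw [tiles_of_kind hS]
    simp only [Triangle.map, hp, kiteMate, ← std_eq_frame]
  have h2 : ∀ e : ZMod 2, e = 0 ∨ e = 1 := by decide
  rcases h2 e with rfl | rfl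
  · obtain ⟨S, hS, hp⟩ := exists_place_std (ε := 1) (a := a) .kiteBlue (Or.inl rfl) hu
    have hb : S.blue = A := by
      simp only [one_mul] at hp
      simp only [Supertile.blue, hS, Kind.blue, image_insert_eq, image_singleton, hp, hA]
    have hr : S.red = B := by
      simp only [one_mul] at hp
      simp only [Supertile.red, hS, Kind.red, image_insert_eq, image_singleton, hp, hB]
    refine ⟨S, htiles S hp (by rw [hS]; rfl), by rw [hb, hr, hverts], ?_, ?_⟩
    · rwa [hb]
    · rwa [hr]
  · obtain ⟨S, hS, hp⟩ := exists_place_std (ε := 1) (a := a) .kiteRed (Or.inl rfl) hu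
    have hb : S.blue = B := by
      simp only [one_mul] at hp
      simp only [Supertile.blue, hS, Kind.blue, image_insert_eq, image_singleton, hp, hB]
    have hr : S.red = A := by
      simp only [one_mul] at hp
      simp only [Supertile.red, hS, Kind.red, image_insert_eq, image_singleton, hp, hA]
    refine ⟨S, htiles S hp (by rw [hS]; rfl), by rw [hb, hr, hverts, union_comm], ?_, ?_⟩
    · rwa [hb]
    · rwa [hr]

end Pair

end Supertile

/-- A pair of alternately coloured triangles with a common hypotenuse is a coloured supertile. -/
theorem IsPacking.exists_isPair {W : Set Triangle} (h : IsPacking √5 W)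
    {col : ZMod 2 → ℂ → Prop} (hcol : ∀ e e' z, col e z → col e' z → e = e') {P Q : Triangle}
    (hP : P ∈ W) (hQ : Q ∈ W) (hne : P ≠ Q) (e : Q.side 0 = P.side 0)
    (hcP : ∃ e, Alternates col P e) (hcQ : ∃ e, Alternates col Q e) :
    ∃ S : Supertile, S.IsPair col P Q := by
  have h5 := h.pos
  have hd := h.disjoint P hP Q hQ hne
  obtain ⟨ε₁, u₁, hε₁, hu₁, e₁⟩ := (h.isPinwheel P hP).exists_std h5
  obtain ⟨ε₂, u₂, hε₂, hu₂, e₂⟩ := (h.isPinwheel Q hQ).exists_std h5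
  have hu₁' : u₁ ≠ 0 := by rintro rfl; rw [norm_zero] at hu₁; linarith
  have hu₂' : u₂ ≠ 0 := by rintro rfl; rw [norm_zero] at hu₂; linarith
  obtain ⟨f₁, c₁⟩ := hcP
  obtain ⟨f₂, c₂⟩ := hcQ
  have h2 : ∀ f : ZMod 2, f = 0 ∨ f = 1 := by decide
  rcases std_mate_cases hε₁ hε₂ hu₁' hu₂' (by rw [← e₁, ← e₂]; exact hne)
    (by rw [← e₁, ← e₂]; exact hd) (by rw [← e₁, ← e₂]; exact e) with ⟨hε, k₁⟩ | ⟨hε, k₁⟩ <;>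
  rcases std_mate_cases hε₂ hε₁ hu₂' hu₁' (by rw [← e₁, ← e₂]; exact hne.symm)
    (by rw [← e₁, ← e₂]; exact hd.symm) (by rw [← e₁, ← e₂]; exact e.symm)
    with ⟨hε', k₂⟩ | ⟨hε', k₂⟩ <;> rw [← e₁, ← e₂] at k₁ k₂
  · have hff : f₂ = f₁ := hcol _ _ Q.c c₂.2.2.1 (by
      rw [k₁, kiteMate, frame_c]; exact c₁.2.2.1)
    subst hff
    rcases hε₁ with rfl | rfl
    · rw [k₁] at c₂ ⊢
      rw [e₁] at c₁ c₂ ⊢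
      exact Supertile.exists_isPair_kite hu₁ c₁ c₂
    · obtain rfl : ε₂ = 1 := by linarith
      rw [k₂] at c₁ ⊢
      rw [e₂] at c₁ c₂ ⊢
      obtain ⟨S, hS⟩ := Supertile.exists_isPair_kite hu₂ c₂ c₁
      exact ⟨S, hS.symm⟩
  · rcases hε₁ with rfl | rfl <;> linarith
  · rcases hε₁ with rfl | rfl <;> linarith
  · have hff : f₂ + 1 = f₁ := hcol _ _ P.c (by
      have := c₂.2.1
      rwa [k₁, rectangleMate, frame_c] at this) c₁.2.2.1
    subst hff
    have h11 : (1 + 1 : ZMod 2) = 0 := by decide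
    -- The right angles of the two halves of a rectangle have different colours. The standard
    -- rectangle starts at a blue right angle, so the half of colour 0 comes first.
    rcases h2 f₂ with rfl | rfl
    · rw [k₂] at c₁ ⊢
      rw [e₂] at c₁ c₂ ⊢
      obtain ⟨S, hS⟩ := Supertile.exists_isPair_rectangle hε₂ hu₂ c₂ (by rwa [zero_add] at c₁)
      exact ⟨S, hS.symm⟩
    · rw [h11] at c₁
      rw [k₁] at c₂ ⊢
      rw [e₁] at c₁ c₂ ⊢
      exact Supertile.exists_isPair_rectangle hε₁ hu₁ c₁ c₂

end Pinwheel

namespace Pinwheel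

open Complex Set Triangle

/-! ## Every pinwheel tiling has a coloured partition -/

namespace Triangle

theorem verts_subset_region (t : Triangle) : t.verts ⊆ t.region := by
  intro v hv
  rcases mem_verts.1 hv with rfl | rfl | rfl | rfl
  · exact corner_mem_region (by simp [corners])
  · exact corner_mem_region (by simp [corners])
  · exact corner_mem_region (by simp [corners])
  · exact frame_mem_region (by norm_num) (by norm_num) (by norm_num)

end Triangle

namespace IsParentTiling

variable {T L : Set Triangle} (h : IsParentTiling T L)
include h

/-- If `v` were inside a side of `Q`, then `Q` and its neighbour across that side would fill a
neighbourhood of `v`, so `P` would be one of the two. But no vertex of a triangle lies in the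
relative interior of its own sides. -/
theorem mem_verts {P Q : Triangle} (hP : P ∈ L) (hQ : Q ∈ L) {v : ℂ} (hv : v ∈ P.verts)
    (hvQ : v ∈ Q.region) : v ∈ Q.verts := by
  have h5 := h.isPacking.pos
  have hPw := h.isPacking.isPinwheel P hP
  have hQw := h.isPacking.isPinwheel Q hQ
  have hvP := P.verts_subset_region hv
  rcases hQw.mem_interior_or_mem_verts h5 hvQ with h1 | h1 | ⟨j, h1⟩
  · rwa [h.isPacking.eq_of_mem_interior_of_mem hQ hP h1 hvP]
  · exact h1
  · obtain ⟨Q', hQ', hne, j', -, e⟩ := h.exists_side_eq Q hQ j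
    have hQw' := h.isPacking.isPinwheel Q' hQ'
    obtain ⟨δ, hδ, hf⟩ := hQw.flank h5 j
    have hf' := hQw.flank_neg h5 hQw' (h.isPacking.disjoint Q hQ Q' hQ' hne.symm) e hδ hf
    have hint := hf.union_mem_interior hf' (hQw.src_ne_tgt h5 j) hδ h1
    obtain ⟨y, hy, hyP⟩ := hPw.exists_mem_interior h5 hvP isOpen_interior hint
    rcases interior_subset hy with hy | hy
    · rwa [← h.isPacking.eq_of_mem_interior_of_mem hP hQ hyP hy]
    · have := h.isPacking.eq_of_mem_interior_of_mem hP hQ' hyP hy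
      subst this
      rw [← e] at h1
      exact (hPw.notMem_openSeg h5 hv j' h1).elim

theorem eq_of_mem_dissect {P Q t : Triangle} (hP : P ∈ L) (hQ : Q ∈ L) (htP : t ∈ P.dissect)
    (htQ : t ∈ Q.dissect) : P = Q := by
  have hw := (h.isPacking.isPinwheel P hP).of_mem_dissect h.isPacking.pos htP
  obtain ⟨z, hz⟩ := hw.nonempty_interior (div_pos h.isPacking.pos (by positivity))
  exact h.isPacking.eq_of_mem_interior_of_mem hP hQ
    (interior_mono (region_subset_of_mem_dissect htP) hz)
    (region_subset_of_mem_dissect htQ (interior_subset hz))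

/-- Two triangles have a common hypotenuse. -/
theorem exists_mate {P : Triangle} (hP : P ∈ L) : ∃ Q ∈ L, P ≠ Q ∧ Q.side 0 = P.side 0 := by
  obtain ⟨Q, hQ, hne, j, hj, e⟩ := h.exists_side_eq P hP 0
  obtain rfl := hj.2 rfl
  exact ⟨Q, hQ, hne.symm, e⟩

theorem exists_isColouredPartition : ∃ D, IsColouredPartition T D := by
  obtain ⟨t₀, ht₀⟩ := h.exists_sameCol
  have hcol : ∀ e e' z, t₀.Col e z → t₀.Col e' z → e = e' := fun e e' z h1 h2 => h1.eq h2
  have halt : ∀ P ∈ L, ∃ e, Alternates t₀.Col P e := fun P hP =>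
    (h.isPacking.isPinwheel P hP).exists_alternates h.isPacking.pos (ht₀ P hP)
  -- A symmetric pair can be placed in standard position in more than one way. Choosing the
  -- supertile for the unordered pair ensures that each pair contributes only one member to `D`.
  have hex : ∀ x : Sym2 Triangle, ∃ S : Supertile, ∀ P Q, x = s(P, Q) → P ∈ L → Q ∈ L → P ≠ Q →
      Q.side 0 = P.side 0 → S.IsPair t₀.Col P Q := by
    intro x
    induction x using Sym2.ind with
    | _ P Q =>
      by_cases hPQ : P ∈ L ∧ Q ∈ L ∧ P ≠ Q ∧ Q.side 0 = P.side 0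
      · obtain ⟨hP, hQ, hne, e⟩ := hPQ
        obtain ⟨S, hS⟩ := h.isPacking.exists_isPair hcol hP hQ hne e (halt P hP) (halt Q hQ)
        refine ⟨S, fun P' Q' hx _ _ _ _ => ?_⟩
        rcases Sym2.eq_iff.1 hx with ⟨rfl, rfl⟩ | ⟨rfl, rfl⟩
        · exact hS
        · exact hS.symm
      · refine ⟨⟨.rectangle, 1, 0⟩, fun P' Q' hx h1 h2 h3 h4 => (hPQ ?_).elim⟩
        rcases Sym2.eq_iff.1 hx with ⟨rfl, rfl⟩ | ⟨rfl, rfl⟩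
        · exact ⟨h1, h2, h3, h4⟩
        · exact ⟨h2, h1, h3.symm, h4.symm⟩
  choose σ hσ using hex
  set D : Set Supertile := {S | ∃ P ∈ L, ∃ Q ∈ L, P ≠ Q ∧ Q.side 0 = P.side 0 ∧ S = σ s(P, Q)}
    with hD
  have hpair : ∀ S ∈ D, ∃ P ∈ L, ∃ Q ∈ L, S.IsPair t₀.Col P Q := by
    rintro S ⟨P, hP, Q, hQ, hne, e, rfl⟩
    exact ⟨P, hP, Q, hQ, hσ _ P Q rfl hP hQ hne e⟩
  -- Fitting of vertices is geometric and ignores colours; the colours then agree because `t₀.Col`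
  -- gives a point at most one colour.
  have hfit : ∀ S ∈ D, ∀ S' ∈ D, ∀ p ∈ S.blue ∪ S.red, p ∈ S'.region → p ∈ S'.blue ∪ S'.red := by
    intro S hS S' hS' p hp hp'
    obtain ⟨P, hP, Q, hQ, hPQ⟩ := hpair S hS
    obtain ⟨P', hP', Q', hQ', hPQ'⟩ := hpair S' hS'
    have hreg : S'.region = P'.region ∪ Q'.region := by
      rw [Supertile.region, hPQ'.tiles_eq, biUnion_dissect_union]
    rw [hPQ'.verts_eq]
    rw [hPQ.verts_eq] at hp
    rw [hreg] at hp'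
    rcases hp with hp | hp <;> rcases hp' with hp' | hp'
    · exact Or.inl (h.mem_verts hP hP' hp hp')
    · exact Or.inr (h.mem_verts hP hQ' hp hp')
    · exact Or.inl (h.mem_verts hQ hP' hp hp')
    · exact Or.inr (h.mem_verts hQ hQ' hp hp')
  have h01 : (0 : ZMod 2) ≠ 1 := by decide
  refine ⟨D, ?_, ?_, ?_, ?_⟩
  · intro S hS
    obtain ⟨P, hP, Q, hQ, hPQ⟩ := hpair S hS
    rw [hPQ.tiles_eq]
    exact union_subset (h.dissect_subset P hP) (h.dissect_subset Q hQ)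
  · intro t ht
    obtain ⟨P, hP, htP⟩ := h.exists_mem_dissect t ht
    obtain ⟨Q, hQ, hne, e⟩ := h.exists_mate hP
    refine ⟨σ s(P, Q), ⟨⟨P, hP, Q, hQ, hne, e, rfl⟩, ?_⟩, ?_⟩
    · rw [(hσ _ P Q rfl hP hQ hne e).tiles_eq]
      exact Or.inl htP
    · rintro _ ⟨⟨P', hP', Q', hQ', hne', e', rfl⟩, ht'⟩
      rw [(hσ _ P' Q' rfl hP' hQ' hne' e').tiles_eq] at ht'
      rcases ht' with ht' | ht'
      · obtain rfl := h.eq_of_mem_dissect hP hP' htP ht'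
        rw [h.isPacking.eq_of_side_zero_eq hP hQ hQ' hne.symm hne'.symm e e']
      · obtain rfl := h.eq_of_mem_dissect hP hQ' htP ht'
        rw [h.isPacking.eq_of_side_zero_eq hP hQ hP' hne.symm hne' e e'.symm, Sym2.eq_swap]
  · intro S hS S' hS' p hp hp'
    obtain ⟨P, hP, Q, hQ, hPQ⟩ := hpair S hS
    obtain ⟨P', hP', Q', hQ', hPQ'⟩ := hpair S' hS'
    rcases hfit S hS S' hS' p (Or.inl hp) hp' with h1 | h1
    · exact h1
    · exact (h01 (hcol _ _ p (hPQ.blue p hp) (hPQ'.red p h1))).elim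
  · intro S hS S' hS' p hp hp'
    obtain ⟨P, hP, Q, hQ, hPQ⟩ := hpair S hS
    obtain ⟨P', hP', Q', hQ', hPQ'⟩ := hpair S' hS'
    rcases hfit S hS S' hS' p (Or.inr hp) hp' with h1 | h1
    · exact (h01 (hcol _ _ p (hPQ'.blue p h1) (hPQ.red p hp))).elim
    · exact h1

end IsParentTiling

end Pinwheel

theorem mainTheorem5 (T : Set Pinwheel.Triangle) (hT : Pinwheel.IsPinwheelTiling T) :
    (∃ D : Set Pinwheel.Supertile, Pinwheel.IsColouredPartition T D) ∧
    ∀ D : Set Pinwheel.Supertile, Pinwheel.IsColouredPartition T D →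
      (∃! l : (Pinwheel.graph T).edgeSet → ℕ, Pinwheel.FollowsRules T D l) ∧
      ∀ l : (Pinwheel.graph T).edgeSet → ℕ, Pinwheel.FollowsRules T D l →
        (∀ v : Pinwheel.vertices T, (∃ S ∈ D, (v : ℂ) ∈ S.red) → weightedDegree l v ≤ 16) ∧
        (∀ v : Pinwheel.vertices T, (∃ S ∈ D, (v : ℂ) ∈ S.blue) → 18 ≤ weightedDegree l v) ∧
        IsOneTwoThreeSolution l := by
  obtain ⟨L, hL⟩ := hT.exists_isParentTiling
  refine ⟨hL.exists_isColouredPartition, fun D hD => ?_⟩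
  have h : Pinwheel.IsPartitioned T D := ⟨hT.isTiling, hT.isTile, hD⟩
  refine ⟨h.existsUnique_followsRules, fun l hl => ⟨?_, ?_, h.isOneTwoThreeSolution hl⟩⟩
  · rintro v ⟨S, hS, hv⟩
    obtain ⟨i, hi, hvi⟩ := S.mem_red.1 hv
    exact (h.weightedDegree_red hl hS hi hvi).2
  · rintro v ⟨S, hS, hv⟩
    obtain ⟨i, hi, hvi⟩ := S.mem_blue.1 hv
    exact h.weightedDegree_blue hl hS hi hvi
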